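/- Let $0<\alpha<1$, $R>1/\sqrt2$, and $\Omega=\{\xi\in\mathbf R^2:|\xi|>R\}$. Write $B(\xi)$ for the unit ball centred at $\xi$ and $[f]_{\alpha,U}=\sup_{\eta\neq\eta'\in U}|f(\eta)-f(\eta')|/|\eta-\eta'|^{\alpha}$. For $r\in\{0,2\}$ put $$\|f:C^{r,\alpha}_*(\Omega)\|=\max\Big(\max_{0\le j\le r}\sup_{\xi\in\Omega}|D^jf(\xi)|\,|\xi|^{1+j-r},\ \sup_{\xi\in\Omega}\,[D^rf]_{\alpha,B(\xi)\cap\Omega}\,|\xi|^{1+\alpha}\Big).$$ For an integer $m\ge1$, let $C^{r,\alpha}_*(\Omega)$ be the space of functions in $C^{r,\alpha}_{loc}(\Omega)$ (up to the boundary) for which this norm is finite and whose graph over $\Omega$ is invariant under the rotation by $180^\circ$ about the $x$-axis and under the reflections across the planes containing the $z$-axis and making an angle $\frac{\pi}{2m}+\frac{k\pi}{m}$, $k\in\mathbf Z$, with the $xz$-plane. Let $C^{2,\alpha}_{cone}(\Omega)$ be the space of functions $v\in C^{2,\alpha}_{loc}(\Omega)$ of the form $v(\xi)=\varphi(\xi/|\xi|)\,|\xi|+w(\xi)$,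 with $C^2$ functions $\varphi:S^1\to\mathbf R$ and $w:\Omega\to\mathbf R$, for which the quantities $$\|\varphi:C^{2,\alpha}(S^1)\|,\quad \sup_{\xi\in\Omega}|\xi|\,\|w:C^{2,\alpha}(\Omega\cap B(\xi))\|,\quad \|D^2w:C^{0,\alpha}_*(\Omega)\|,\quad \|\xi\cdot\nabla w:C^{0,\alpha}_*(\Omega)\|$$ are all finite. Such a decomposition is unique, and $\|v:C^{2,\alpha}_{cone}(\Omega)\|$ denotes the maximum of these four quantities. **Lemma.** There is a constant $C$, depending only on $\alpha$ and $R$ (in particular not on $m$), such that the following holds for every $m\ge1$. Let $E\in C^{0,\alpha}_*(\Omega)$ and let $v\in C^{2,\alpha}_*(\Omega)$, continuous on $\overline\Omega$, be a solution of $$\Delta v-\xi\cdot\nabla v+v=E\ \text{ in }\Omega,\qquad v=0\ \text{ on }\partial\Omega.$$ Then $v\in C^{2,\alpha}_{cone}(\Omega)$ and $$\|v:C^{2,\alpha}_{cone}(\Omega)\|\le C\,\|E:C^{0,\alpha}_*(\Omega)\|.$$ In particular $v=\varphi(\xi/|\xi|)|\xi|+w$ with $\varphi\in C^{2,\alpha}(S^1)$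 and $|w(\xi)|\le C\,\|E:C^{0,\alpha}_*(\Omega)\|\,|\xi|^{-1}$. -/

import Mathlib

open scoped ENNReal NNReal Gradient Laplacian

noncomputable section

/-- The Euclidean plane. -/
abbrev Plane : Type := EuclideanSpace ℝ (Fin 2)

/-- The exterior domain `{ξ : R < |ξ|}`.  Hölder norms over it control the functions and their
derivatives up to the boundary circle. -/
def exteriorDomain (R : ℝ) : Set Plane := {ξ | R < ‖ξ‖}

section Holder

variable {X F : Type*} [NormedAddCommGroup X] [NormedSpace ℝ X]
  [NormedAddCommGroup F] [NormedSpace ℝ F]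

/-- The Hölder seminorm `[f]_{α,s}`, the supremum of `|f η - f η'| / |η - η'|^α` over `η, η' ∈ s`
(the term `η = η'` is `0`). -/
def holderSeminorm (α : ℝ) (s : Set X) (f : X → F) : ℝ≥0∞ :=
  ⨆ η ∈ s, ⨆ η' ∈ s, ‖f η - f η'‖ₑ / ‖η - η'‖ₑ ^ α

/-- The `C^{k,α}` norm on the open set `U`: the maximum of `sup_U |D^j f|`, `j ≤ k`, and
`[D^k f]_{α,U}`. -/
def holderENorm (k : ℕ) (α : ℝ) (U : Set X) (f : X → F) : ℝ≥0∞ :=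
  max (⨆ j ∈ Finset.range (k + 1), ⨆ ξ ∈ U, ‖iteratedFDeriv ℝ j f ξ‖ₑ)
    (holderSeminorm α U (iteratedFDeriv ℝ k f))

/-- The weighted norm `‖f : C^{k,α}(U, weight)‖`, the supremum over `ξ ∈ U` of
`weight(ξ)⁻¹ ‖f : C^{k,α}(U ∩ B(ξ))‖`, where `B(ξ)` is the unit ball centred at `ξ`. -/
def weightedHolderENorm (k : ℕ) (α : ℝ) (U : Set X) (weight : X → ℝ≥0∞) (f : X → F) : ℝ≥0∞ :=
  ⨆ ξ ∈ U, (weight ξ)⁻¹ * holderENorm k α (U ∩ Metric.ball ξ 1) f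

/-- Functions of class `C^{k,α}_loc`: `f` is `C^k` on the open set `U` and `D^k f` is
`α`-Hölder on every bounded part of `U`. -/
def MemHolderLoc (k : ℕ) (α : ℝ) (U : Set X) (f : X → F) : Prop :=
  ContDiffOn ℝ k f U ∧
    ∀ ρ : ℝ, holderSeminorm α (U ∩ Metric.ball 0 ρ) (iteratedFDeriv ℝ k f) < ∞

/-- The norm `‖f : C_*^{r,α}(U)‖`: the maximum of `sup_U |D^j f(ξ)| |ξ|^{1+j-r}`, `j ≤ r`, and
`sup_{ξ ∈ U} [D^r f]_{α, B(ξ) ∩ U} |ξ|^{1+α}`, where `B(ξ)` is the unit ball centred at `ξ`. -/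
def starENorm (r : ℕ) (α : ℝ) (U : Set X) (f : X → F) : ℝ≥0∞ :=
  max
    (⨆ j ∈ Finset.range (r + 1), ⨆ ξ ∈ U,
      ‖iteratedFDeriv ℝ j f ξ‖ₑ * ‖ξ‖ₑ ^ (-(r : ℝ) + 1 + (j : ℝ)))
    (⨆ ξ ∈ U,
      holderSeminorm α (Metric.ball ξ 1 ∩ U) (iteratedFDeriv ℝ r f) * ‖ξ‖ₑ ^ (1 + α))

end Holder

/-- Reflection of the plane across the line through the origin that makes the angle `β` with
the first axis. -/
def reflectAcross (β : ℝ) (ξ : Plane) : Plane :=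
  !₂[Real.cos (2 * β) * ξ 0 + Real.sin (2 * β) * ξ 1,
    Real.sin (2 * β) * ξ 0 - Real.cos (2 * β) * ξ 1]

/-- The graph `{(x, y, v(x, y))}` of `v` over `Ω = {|ξ| > R}` is invariant under the rotation of
`180°` about the `x`-axis, `(x, y, z) ↦ (x, -y, -z)`, and under the reflections across the
vertical planes through the `z`-axis making an angle `π/(2m) + kπ/m` with the `xz`-plane. -/
def HasImposedSymmetries (m : ℕ) (R : ℝ) (v : Plane → ℝ) : Prop :=
  (∀ ξ ∈ exteriorDomain R, v !₂[ξ 0, -ξ 1] = -v ξ) ∧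
    ∀ k : ℤ, ∀ ξ ∈ exteriorDomain R,
      v (reflectAcross (Real.pi / (2 * m) + k * Real.pi / m) ξ) = v ξ

/-- The space `C_*^{r,α}(Ω)`, `Ω = {|ξ| > R}`, with the symmetries of order `m` imposed. -/
structure MemStar (r : ℕ) (α : ℝ) (m : ℕ) (R : ℝ) (v : Plane → ℝ) : Prop where
  memLoc : MemHolderLoc r α (exteriorDomain R) v
  norm_lt_top : starENorm r α (exteriorDomain R) v < ∞
  symm : HasImposedSymmetries m R v

/-- The unit circle `S¹`. -/
abbrev UnitCircle : Type := Metric.sphere (0 : Plane) 1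

/-- The point of angle `θ` on the unit circle. -/
def circlePoint (θ : ℝ) : UnitCircle :=
  ⟨!₂[Real.cos θ, Real.sin θ], by simp [EuclideanSpace.norm_eq]⟩

/-- The direction `ξ / |ξ|` of a nonzero vector. -/
def direction (ξ : Plane) (h : ξ ≠ 0) : UnitCircle :=
  ⟨‖ξ‖⁻¹ • ξ, by simp [norm_smul, h]⟩

/-- The `C^{k,α}(S¹)` norm, with respect to arc length. -/
def circleENorm (k : ℕ) (α : ℝ) (φ : UnitCircle → ℝ) : ℝ≥0∞ :=
  holderENorm k α Set.univ (fun θ : ℝ => φ (circlePoint θ))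

/-- `v(ξ) = φ(ξ/|ξ|) |ξ| + w(ξ)` on `Ω = {|ξ| > R}` with `φ` of class `C²` on the circle and `w`
of class `C²` on `Ω`. -/
structure IsConeDecomposition (R : ℝ) (v : Plane → ℝ) (φ : UnitCircle → ℝ) (w : Plane → ℝ) :
    Prop where
  eq : ∀ (ξ : Plane) (hξ : ξ ≠ 0), ξ ∈ exteriorDomain R → v ξ = φ (direction ξ hξ) * ‖ξ‖ + w ξ
  contDiff_phi : ContDiff ℝ 2 (fun θ : ℝ => φ (circlePoint θ))
  contDiffOn_w : ContDiffOn ℝ 2 w (exteriorDomain R)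

/-- The maximum of `‖φ : C^{2,α}(S¹)‖`, `‖w : C^{2,α}(Ω, |ξ|⁻¹)‖`, `‖D²w : C_*^{0,α}(Ω)‖` and
`‖ξ·∇w : C_*^{0,α}(Ω)‖`. -/
def coneQuantity (α R : ℝ) (φ : UnitCircle → ℝ) (w : Plane → ℝ) : ℝ≥0∞ :=
  max (max (circleENorm 2 α φ)
      (weightedHolderENorm 2 α (exteriorDomain R) (fun ξ => ‖ξ‖ₑ⁻¹) w))
    (max (starENorm 0 α (exteriorDomain R) (iteratedFDeriv ℝ 2 w))
      (starENorm 0 α (exteriorDomain R) (fun ξ => inner ℝ ξ (∇ w ξ))))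

/-- The space `C^{2,α}_cone(Ω)`, `Ω = {|ξ| > R}`. -/
def MemCone (α R : ℝ) (v : Plane → ℝ) : Prop :=
  MemHolderLoc 2 α (exteriorDomain R) v ∧
    ∃ φ w, IsConeDecomposition R v φ w ∧ coneQuantity α R φ w < ∞

/-- The norm `‖v : C^{2,α}_cone(Ω)‖`.  A decomposition with finite quantities is unique, see
`IsConeDecomposition.coneENorm_eq`, so for `v ∈ C^{2,α}_cone(Ω)` the infimum is the maximum of
these quantities for that decomposition. -/
def coneENorm (α R : ℝ) (v : Plane → ℝ) : ℝ≥0∞ :=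
  ⨅ (φ : UnitCircle → ℝ) (w : Plane → ℝ) (_ : IsConeDecomposition R v φ w), coneQuantity α R φ w

/-- The operator `𝓛 v = Δ v - ξ·∇v + v`. -/
def shrinkerOperator (v : Plane → ℝ) (ξ : Plane) : ℝ :=
  Δ v ξ - inner ℝ ξ (∇ v ξ) + v ξ

/-- `v` solves `𝓛 v = E` in `Ω = {|ξ| > R}` and `v = 0` on `∂Ω` (continuously up to `∂Ω`). -/
structure IsDirichletSolution (R : ℝ) (E v : Plane → ℝ) : Prop where
  continuousOn : ContinuousOn v {ξ | R ≤ ‖ξ‖}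
  eq_zero : ∀ ξ, ‖ξ‖ = R → v ξ = 0
  eq : ∀ ξ ∈ exteriorDomain R, shrinkerOperator v ξ = E ξ

theorem isOpen_exteriorDomain (R : ℝ) : IsOpen (exteriorDomain R) :=
  isOpen_lt continuous_const continuous_norm

theorem enorm_mul_le_coneQuantity {α R : ℝ} {φ : UnitCircle → ℝ} {w : Plane → ℝ}
    {ξ : Plane} (hξ : ξ ∈ exteriorDomain R) :
    ‖ξ‖ₑ * ‖w ξ‖ₑ ≤ coneQuantity α R φ w := by
  have h1 : ‖w ξ‖ₑ ≤ holderENorm 2 α (exteriorDomain R ∩ Metric.ball ξ 1) w := by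
    refine le_trans ?_ (le_max_left _ _)
    refine le_trans ?_ (le_iSup₂_of_le (i := 0) (by simp) le_rfl)
    refine le_trans ?_ (le_iSup₂_of_le (i := ξ) ⟨hξ, by simp⟩ le_rfl)
    rw [← ofReal_norm, ← ofReal_norm, norm_iteratedFDeriv_zero]
  have h2 : ‖ξ‖ₑ * ‖w ξ‖ₑ ≤
      weightedHolderENorm 2 α (exteriorDomain R) (fun ξ => ‖ξ‖ₑ⁻¹) w := by
    refine le_trans ?_ (le_iSup₂_of_le (i := ξ) hξ le_rfl)
    simp only [inv_inv]
    gcongr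
  exact h2.trans ((le_max_right _ _).trans (le_max_left _ _))

theorem IsConeDecomposition.phi_unique {α R : ℝ} (hR : 0 < R) {v : Plane → ℝ}
    {φ₁ φ₂ : UnitCircle → ℝ} {w₁ w₂ : Plane → ℝ}
    (h₁ : IsConeDecomposition R v φ₁ w₁) (h₂ : IsConeDecomposition R v φ₂ w₂)
    (q₁ : coneQuantity α R φ₁ w₁ < ∞) (q₂ : coneQuantity α R φ₂ w₂ < ∞) : φ₁ = φ₂ := by
  have key : ∀ {φ : UnitCircle → ℝ} {w : Plane → ℝ}, coneQuantity α R φ w < ∞ →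
      ∀ ξ ∈ exteriorDomain R, ‖ξ‖ * |w ξ| ≤ (coneQuantity α R φ w).toReal := by
    intro φ w q ξ hξ
    have h := ENNReal.toReal_mono q.ne (enorm_mul_le_coneQuantity (α := α) (φ := φ) (w := w) hξ)
    simpa using h
  funext ω
  have hω : ‖(ω : Plane)‖ = 1 := by simp
  set K := (coneQuantity α R φ₁ w₁).toReal + (coneQuantity α R φ₂ w₂).toReal with hK
  have bound : ∀ r : ℝ, R + 1 ≤ r → |φ₁ ω - φ₂ ω| ≤ K / r := by
    intro r hr
    have hr1 : 1 ≤ r := by linarith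
    have hr0 : 0 < r := by linarith
    have hn : ‖r • (ω : Plane)‖ = r := by rw [norm_smul, hω]; simp [abs_of_pos hr0]
    have hmem : r • (ω : Plane) ∈ exteriorDomain R := by
      change R < ‖r • (ω : Plane)‖
      rw [hn]; linarith
    have hne : r • (ω : Plane) ≠ 0 := by
      intro h0; rw [h0, norm_zero] at hn; linarith
    have hdir : direction (r • (ω : Plane)) hne = ω := by
      apply Subtype.ext
      change ‖r • (ω : Plane)‖⁻¹ • r • (ω : Plane) = ω
      rw [hn, smul_smul, inv_mul_cancel₀ hr0.ne', one_smul]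
    have e1 := h₁.eq _ hne hmem
    have e2 := h₂.eq _ hne hmem
    have k1 := key q₁ _ hmem
    have k2 := key q₂ _ hmem
    rw [hdir, hn] at e1 e2
    rw [hn] at k1 k2
    have e3 : (φ₁ ω - φ₂ ω) * r = w₂ (r • (ω : Plane)) - w₁ (r • (ω : Plane)) := by linarith
    have e4 : |φ₁ ω - φ₂ ω| * r ≤ |w₂ (r • (ω : Plane))| + |w₁ (r • (ω : Plane))| := by
      calc |φ₁ ω - φ₂ ω| * r = |(φ₁ ω - φ₂ ω) * r| := by rw [abs_mul, abs_of_pos hr0]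
        _ ≤ _ := by rw [e3]; exact abs_sub _ _
    rw [le_div_iff₀ hr0]
    have := abs_nonneg (w₁ (r • (ω : Plane)))
    have := abs_nonneg (w₂ (r • (ω : Plane)))
    nlinarith
  have lim : Filter.Tendsto (fun r : ℝ => K / r) Filter.atTop (nhds 0) :=
    Filter.Tendsto.div_atTop tendsto_const_nhds Filter.tendsto_id
  have h0 : |φ₁ ω - φ₂ ω| ≤ 0 :=
    ge_of_tendsto lim ((Filter.eventually_ge_atTop (R + 1)).mono bound)
  exact sub_eq_zero.mp (abs_nonpos_iff.mp h0)

theorem starENorm_zero_congr {F : Type*} [NormedAddCommGroup F] [NormedSpace ℝ F]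
    {α R : ℝ} {f g : Plane → F} (h : Set.EqOn f g (exteriorDomain R)) :
    starENorm 0 α (exteriorDomain R) f = starENorm 0 α (exteriorDomain R) g := by
  have hd : ∀ ξ ∈ exteriorDomain R, ∀ j, iteratedFDeriv ℝ j f ξ = iteratedFDeriv ℝ j g ξ :=
    fun ξ hξ j =>
      (Filter.EventuallyEq.iteratedFDeriv ℝ
        (h.eventuallyEq_of_mem ((isOpen_exteriorDomain R).mem_nhds hξ)) j).eq_of_nhds
  unfold starENorm holderSeminorm
  congr 1
  · refine iSup_congr fun j => iSup_congr fun _ => iSup_congr fun ξ => iSup_congr fun hξ => ?_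
    rw [hd ξ hξ]
  · refine iSup_congr fun ξ => iSup_congr fun _ => ?_
    congr 1
    refine iSup_congr fun η => iSup_congr fun hη => iSup_congr fun η' => iSup_congr fun hη' => ?_
    rw [hd η hη.2, hd η' hη'.2]

theorem coneQuantity_congr {α R : ℝ} {φ : UnitCircle → ℝ} {w₁ w₂ : Plane → ℝ}
    (h : Set.EqOn w₁ w₂ (exteriorDomain R)) :
    coneQuantity α R φ w₁ = coneQuantity α R φ w₂ := by
  have hev : ∀ ξ ∈ exteriorDomain R, w₁ =ᶠ[nhds ξ] w₂ := fun ξ hξ =>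
    h.eventuallyEq_of_mem ((isOpen_exteriorDomain R).mem_nhds hξ)
  have hd : ∀ j, Set.EqOn (iteratedFDeriv ℝ j w₁) (iteratedFDeriv ℝ j w₂) (exteriorDomain R) :=
    fun j ξ hξ => (Filter.EventuallyEq.iteratedFDeriv ℝ (hev ξ hξ) j).eq_of_nhds
  have hg : Set.EqOn (fun ξ => inner ℝ ξ (∇ w₁ ξ)) (fun ξ => inner ℝ ξ (∇ w₂ ξ))
      (exteriorDomain R) := fun ξ hξ => by
    simp only [gradient, (hev ξ hξ).fderiv_eq]
  have hw : weightedHolderENorm 2 α (exteriorDomain R) (fun ξ => ‖ξ‖ₑ⁻¹) w₁ =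
      weightedHolderENorm 2 α (exteriorDomain R) (fun ξ => ‖ξ‖ₑ⁻¹) w₂ := by
    unfold weightedHolderENorm holderENorm holderSeminorm
    refine iSup_congr fun ξ => iSup_congr fun _ => ?_
    congr 2
    · refine iSup_congr fun j => iSup_congr fun _ => iSup_congr fun η => iSup_congr fun hη => ?_
      rw [hd j hη.1]
    · refine iSup_congr fun η => iSup_congr fun hη => iSup_congr fun η' => iSup_congr fun hη' => ?_
      rw [hd 2 hη.1, hd 2 hη'.1]
  unfold coneQuantity
  rw [starENorm_zero_congr (hd 2), starENorm_zero_congr hg, hw]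

theorem IsConeDecomposition.coneENorm_eq {α R : ℝ} (hR : 0 < R) {v : Plane → ℝ}
    {φ : UnitCircle → ℝ} {w : Plane → ℝ} (h : IsConeDecomposition R v φ w)
    (q : coneQuantity α R φ w < ∞) : coneENorm α R v = coneQuantity α R φ w := by
  refine le_antisymm (iInf_le_of_le φ (iInf_le_of_le w (iInf_le_of_le h le_rfl))) ?_
  refine le_iInf fun φ' => le_iInf fun w' => le_iInf fun h' => ?_
  by_cases q' : coneQuantity α R φ' w' < ∞
  · have hφ : φ = φ' := h.phi_unique hR h' q q'
    subst hφ
    refine (coneQuantity_congr fun ξ hξ => ?_).le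
    have hne : ξ ≠ 0 := by
      rintro rfl
      have : R < ‖(0 : Plane)‖ := hξ
      rw [norm_zero] at this
      linarith
    have e1 := h.eq ξ hne hξ
    have e2 := h'.eq ξ hne hξ
    linarith
  · rw [not_lt_top_iff.mp q']
    exact le_top

end

/-!
In the coordinates `ξ = e^s (cos θ, sin θ)` the function `f(s, θ) = e^{-s} v` satisfies
`f_ss + (2 - e^{2s}) f_s + f + f_θθ = g`, where `g = e^s E`, and vanishes on the line
`s₀ = log R`.  The norm of `E` bounds `g` and its Hölder quotients at scales up to `e^{-s}`, the
scale of unit distances in the plane.  Along rays the drift `-e^{2s} f_s` is strong and forces `f`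
to converge as `s → ∞`; the limit is the profile `φ` of the cone, and `w` is the remainder.  All
estimates come from the maximum principle and from one-variable arguments; no elliptic regularity
theory is used.  The only symmetry used is the oddness in `θ`, so that the constants do not depend
on `m`.

Since `f` is odd and periodic it vanishes for `θ = 0` and `θ = π`, and on the half plane there is
an explicit positive supersolution, thanks to the bound on `R` from below.  This bounds `f`
(`PolarSolution.abs_f_le`).  The zeroth order term is then moved to the right-hand side.  What
remains is an operator without zeroth order term which commutes with translations in `θ`, so that
the maximum principle applies to symmetric differences in `θ`, as functions of `s` and of the
increments.  First differences give a Lipschitz bound (`PolarSolution.abs_f_sub_le`).  Third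
differences with independent increments `h, k, l` are compared with a barrier
`x^{(2+α)/3} (C + B κ)`, where `x = h k l` (`tripleBarrier`).  The power is concave enough in each
increment to absorb the part of the right-hand side of size `x^{α/3}`; the bounded factor `κ`,
increasing in `s`, makes use of the drift to absorb the part that is Hölder only at scales below
`e^{-s}`.  This is the core of the proof (`PolarSolution.abs_third_difference_le`): it shows that
`f_θθ` is `α`-Hölder in `θ`, uniformly in `s`, with no loss at large scales.

With `f_θθ` under control the equation becomes a linear equation of first order for
`y = e^{2s} f_s` along each ray, `y' = e^{2s} (y + H)`, `H = g - f - f_θθ`, whose homogeneous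
solution grows like `exp (e^{2s} / 2)`.  A solution of moderate growth is therefore bounded by the
supremum of `|H|` (`abs_le_of_hasDerivAt_drift`).  Hence `f_s = O(e^{-2s})`, and the modulus of
continuity of `H` in `θ` carries over to `y`.  Hölder bounds in `s` follow: for `f_θθ`, because
its second differences in `s` are controlled by the modulus of continuity of `f_ss` in `θ`
(`PolarSolution.exists_fθθ_radial`); for `y`, because the equation is invariant under translations
in the variable `e^{2s}` (`PolarSolution.abs_y_radial_sub_le`); for the mixed derivative, because
its difference quotients converge at the rate of the step to the power `α`
(`PolarSolution.exists_shortHolder_mixed`).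

By the decay of `f_s` the limit `φ` exists and `f - φ = O(e^{-2s})`; comparing difference quotients
one finds that `φ` is twice differentiable, with the bounds of `f_θθ`
(`PolarSolution.exists_profile`).  The remainder has the polar form `f - φ`, and its Hessian and
radial derivative are `e^{-s}` times functions with Hölder bounds at scales up to `e^{-s}`.  Such
functions satisfy the weighted Hölder bounds in the plane (`ShortHolder.abs_sub_le_of_mem_ball`),
which gives the four norms of the decomposition (`exists_isConeDecomposition`).
-/

section

open Set Filter Topology

noncomputable section

/-! ### One-variable calculus -/

/-- Otherwise the strict second derivative test makes the point a local minimum as well, and the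
function is locally constant. -/
theorem second_deriv_nonpos_of_isLocalMax {u u' : ℝ → ℝ} {u'' x : ℝ}
    (h1 : ∀ᶠ y in 𝓝 x, HasDerivAt u (u' y) y) (h2 : HasDerivAt u' u'' x)
    (hm : IsLocalMax u x) : u'' ≤ 0 := by
  by_contra! hpos
  have e1 : deriv u =ᶠ[𝓝 x] u' := h1.mono fun y hy => hy.deriv
  have e2 : deriv (deriv u) x = u'' := by rw [e1.deriv_eq, h2.deriv]
  have hmin : IsLocalMin u x :=
    isLocalMin_of_deriv_deriv_pos (by rw [e2]; exact hpos) hm.deriv_eq_zero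
      h1.self_of_nhds.continuousAt
  have hc : u =ᶠ[𝓝 x] fun _ => u x := by
    filter_upwards [hm, hmin] with y hy hy'
    exact le_antisymm hy hy'
  have e3 : deriv u =ᶠ[𝓝 x] fun _ => 0 := by simpa using hc.deriv
  have e4 : deriv (deriv u) x = 0 := by rw [e3.deriv_eq]; simp
  linarith

/-- The compactness half of the maximum principle on `[s₀, ∞) × K`, `K` compact: a function that is
nonpositive at `s = s₀` and for large `s` is nonpositive as soon as it has no positive maximum at
an interior `s`. -/
theorem nonpos_of_no_positive_max {X : Type*} [TopologicalSpace X] {K : Set X} (hK : IsCompact K)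
    {u : ℝ → X → ℝ} {s₀ : ℝ}
    (hc : ContinuousOn (fun p : ℝ × X => u p.1 p.2) (Ici s₀ ×ˢ K))
    (h0 : ∀ x ∈ K, u s₀ x ≤ 0) (hinf : ∃ S, ∀ s ≥ S, ∀ x ∈ K, u s x ≤ 0)
    (hmax : ∀ s > s₀, ∀ x ∈ K, 0 < u s x → (∀ s' ≥ s₀, ∀ x' ∈ K, u s' x' ≤ u s x) → False) :
    ∀ s ≥ s₀, ∀ x ∈ K, u s x ≤ 0 := by
  intro s hs x hx
  by_contra! hpos
  obtain ⟨S, hS⟩ := hinf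
  have hcomp : IsCompact (Icc s₀ (max S s) ×ˢ K) := isCompact_Icc.prod hK
  have hmem : (s, x) ∈ Icc s₀ (max S s) ×ˢ K := ⟨⟨hs, le_max_right _ _⟩, hx⟩
  obtain ⟨⟨t, y⟩, ⟨ht, hy⟩, hty⟩ := hcomp.exists_isMaxOn ⟨_, hmem⟩
    (hc.mono (prod_mono Icc_subset_Ici_self subset_rfl))
  have hpos' : 0 < u t y := lt_of_lt_of_le hpos (hty hmem)
  have ht0 : s₀ < t := by
    rcases ht.1.lt_or_eq with h | h
    · exact h
    · exact absurd (h0 y hy) (by rw [h]; exact not_le.mpr hpos')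
  refine hmax t ht0 y hy hpos' fun s' hs' x' hx' => ?_
  by_cases hle : s' ≤ max S s
  · exact hty (show (s', x') ∈ _ from ⟨⟨hs', hle⟩, hx'⟩)
  · exact (hS s' ((le_max_left _ _).trans (not_le.mp hle).le) x' hx').trans hpos'.le

theorem abs_sub_le_of_hasDerivAt {u u' : ℝ → ℝ} {a b M : ℝ} (hab : a ≤ b)
    (h1 : ∀ y ∈ Icc a b, HasDerivAt u (u' y) y) (hM : ∀ y ∈ Icc a b, |u' y| ≤ M) :
    |u b - u a| ≤ M * (b - a) := by
  have := (convex_Icc a b).norm_image_sub_le_of_norm_hasDerivWithin_le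
    (fun y hy => (h1 y hy).hasDerivWithinAt) hM (left_mem_Icc.mpr hab) (right_mem_Icc.mpr hab)
  simpa [abs_of_nonneg (sub_nonneg.mpr hab)] using this

theorem abs_second_difference_le {u u' u'' : ℝ → ℝ} {x h M : ℝ} (hh : 0 ≤ h)
    (h1 : ∀ y ∈ Icc x (x + 2 * h), HasDerivAt u (u' y) y)
    (h2 : ∀ y ∈ Icc x (x + 2 * h), HasDerivAt u' (u'' y) y)
    (hM : ∀ y ∈ Icc x (x + 2 * h), |u'' y| ≤ M) :
    |u (x + 2 * h) - 2 * u (x + h) + u x| ≤ M * h ^ 2 := by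
  have key := abs_sub_le_of_hasDerivAt (u := fun t => u (t + h) - u t)
    (u' := fun t => u' (t + h) - u' t) (a := x) (b := x + h) (M := M * h) (by linarith)
    (fun y hy => by
      have a := (h1 (y + h) ⟨by linarith [hy.1], by linarith [hy.2]⟩).comp_add_const y h
      exact a.sub (h1 y ⟨by linarith [hy.1], by linarith [hy.2]⟩))
    (fun y hy => by
      have := abs_sub_le_of_hasDerivAt (u := u') (u' := u'') (a := y) (b := y + h) (M := M)
        (by linarith) (fun z hz => h2 z ⟨by linarith [hy.1, hz.1], by linarith [hy.2, hz.2]⟩)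
        (fun z hz => hM z ⟨by linarith [hy.1, hz.1], by linarith [hy.2, hz.2]⟩)
      simpa using this)
  have e : u (x + 2 * h) - 2 * u (x + h) + u x = u (x + h + h) - u (x + h) - (u (x + h) - u x) := by
    rw [show x + h + h = x + 2 * h by ring]; ring
  rw [e]
  calc _ ≤ _ := key
    _ = _ := by ring

/-- Summing a geometric series of dyadic increments. -/
theorem abs_sub_limit_le_of_dyadic {q : ℝ → ℝ} {L C α h₀ : ℝ} (hα : 0 < α)
    (hq : ∀ h, 0 < h → h ≤ h₀ → |q h - q (h / 2)| ≤ C * h ^ α)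
    (hL : Tendsto q (𝓝[>] 0) (𝓝 L)) {h : ℝ} (h0 : 0 < h) (hh : h ≤ h₀) :
    |q h - L| ≤ C / (1 - 2 ^ (-α)) * h ^ α := by
  have hC : 0 ≤ C := by
    have := (abs_nonneg _).trans (hq h h0 hh)
    exact nonneg_of_mul_nonneg_left this (Real.rpow_pos_of_pos h0 α)
  set t : ℝ := 2 ^ (-α) with ht
  have ht0 : 0 < t := Real.rpow_pos_of_pos two_pos _
  have ht1 : t < 1 := Real.rpow_lt_one_of_one_lt_of_neg one_lt_two (by linarith)
  have hD : 0 ≤ C / (1 - t) := div_nonneg hC (by linarith)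
  have hind : ∀ n : ℕ, |q h - q (h / 2 ^ n)| ≤ C / (1 - t) * h ^ α * (1 - t ^ n) := by
    intro n
    induction n with
    | zero => simp
    | succ n ih =>
      have hp : (0 : ℝ) < 2 ^ n := by positivity
      have h2 := hq (h / 2 ^ n) (by positivity)
        ((div_le_self h0.le (one_le_pow₀ one_le_two)).trans hh)
      have e1 : (h / 2 ^ n) ^ α = h ^ α * t ^ n := by
        rw [Real.div_rpow h0.le hp.le, div_eq_mul_inv, ht, ← Real.rpow_natCast 2 n,
          ← Real.rpow_mul two_pos.le, ← Real.rpow_neg two_pos.le, ← Real.rpow_natCast _ n,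
          ← Real.rpow_mul two_pos.le]
        ring_nf
      have e2 : h / 2 ^ n / 2 = h / 2 ^ (n + 1) := by rw [pow_succ]; field_simp
      rw [e1, e2] at h2
      have e3 : C * (h ^ α * t ^ n) = C / (1 - t) * h ^ α * (t ^ n - t ^ (n + 1)) := by
        have : (1 - t) ≠ 0 := by linarith
        field_simp
        ring
      calc |q h - q (h / 2 ^ (n + 1))|
          ≤ |q h - q (h / 2 ^ n)| + |q (h / 2 ^ n) - q (h / 2 ^ (n + 1))| := abs_sub_le _ _ _
        _ ≤ _ := by rw [e3] at h2; linarith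
  have hlim : Tendsto (fun n : ℕ => |q h - q (h / 2 ^ n)|) atTop (𝓝 |q h - L|) := by
    refine (tendsto_const_nhds.sub (hL.comp ?_)).abs
    refine tendsto_nhdsWithin_iff.mpr ⟨?_, Eventually.of_forall fun n => by
      simp only [mem_Ioi]; positivity⟩
    have := (tendsto_pow_atTop_nhds_zero_of_lt_one (r := (1 / 2 : ℝ)) (by norm_num)
      (by norm_num)).const_mul h
    simpa [div_eq_mul_inv] using this
  refine le_of_tendsto hlim (Eventually.of_forall fun n => (hind n).trans ?_)
  have : 0 ≤ t ^ n := by positivity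
  have h3 : 0 ≤ C / (1 - t) * h ^ α := mul_nonneg hD (Real.rpow_nonneg h0.le _)
  nlinarith

theorem abs_sub_le_of_steps {u : ℝ → ℝ} {x d B : ℝ} (N : ℕ) (hd : 0 ≤ d)
    (hu : ∀ y, x ≤ y → y + d ≤ x + N * d → |u (y + d) - u y| ≤ B) :
    |u (x + N * d) - u x| ≤ N * B := by
  induction N with
  | zero => simp
  | succ N ih =>
    have h1 := ih fun y hy hy' => hu y hy (by push_cast; linarith)
    have h2 := hu (x + N * d) (by have : 0 ≤ N * d := by positivity
                                  linarith) (by push_cast; linarith)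
    have e : x + (N + 1 : ℕ) * d = x + N * d + d := by push_cast; ring
    rw [e]
    calc _ ≤ |u (x + N * d + d) - u (x + N * d)| + |u (x + N * d) - u x| := abs_sub_le _ _ _
      _ ≤ _ := by push_cast; linarith

/-- A Hölder bound at scales up to `ℓ` propagates to all scales by chaining. -/
theorem abs_sub_le_of_holder_short {u : ℝ → ℝ} {C α ℓ : ℝ} (hC : 0 ≤ C) (hα : 0 < α)
    (hℓ : 0 < ℓ) (hu : ∀ y d, 0 ≤ d → d ≤ ℓ → |u (y + d) - u y| ≤ C * d ^ α) {x d : ℝ}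
    (hd : 0 ≤ d) : |u (x + d) - u x| ≤ 2 * C * (d ^ α + d * ℓ ^ (α - 1)) := by
  have p1 : 0 ≤ d ^ α := Real.rpow_nonneg hd _
  have p2 : 0 ≤ ℓ ^ (α - 1) := Real.rpow_nonneg hℓ.le _
  by_cases h : d ≤ ℓ
  · refine (hu x d hd h).trans ?_
    nlinarith [mul_nonneg hC p1, mul_nonneg hC (mul_nonneg hd p2)]
  · push Not at h
    set N := ⌈d / ℓ⌉₊ with hN
    have h1 : 1 < d / ℓ := by rwa [one_lt_div hℓ]
    have hN1 : d / ℓ ≤ N := Nat.le_ceil _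
    have hN2 : (N : ℝ) ≤ 2 * (d / ℓ) := by
      have := Nat.ceil_lt_add_one (a := d / ℓ) (by positivity)
      linarith
    have hN0 : (0 : ℝ) < N := by linarith
    have hs : d / N ≤ ℓ := by
      rw [div_le_iff₀ hN0]; rw [div_le_iff₀ hℓ] at hN1; linarith
    have key := abs_sub_le_of_steps (u := u) (x := x) (d := d / N) (B := C * ℓ ^ α) N
      (by positivity) (fun y _ _ => (hu y (d / N) (by positivity) hs).trans (by
        gcongr))
    rw [mul_div_cancel₀ _ hN0.ne'] at key
    have e : ℓ ^ α = ℓ * ℓ ^ (α - 1) := by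
      rw [Real.rpow_sub_one hℓ.ne']; field_simp
    calc _ ≤ _ := key
      _ ≤ 2 * (d / ℓ) * (C * ℓ ^ α) := by
        have : 0 ≤ C * ℓ ^ α := by positivity
        gcongr
      _ = 2 * C * (d * ℓ ^ (α - 1)) := by rw [e]; field_simp
      _ ≤ _ := by nlinarith [mul_nonneg hC p1]

theorem nonpos_of_hasDerivAt_nonneg_of_tendsto {z z' : ℝ → ℝ} {x₀ : ℝ}
    (h1 : ∀ x > x₀, HasDerivAt z (z' x) x) (h2 : ∀ x > x₀, 0 ≤ z' x)
    (h3 : Tendsto z atTop (𝓝 0)) {x : ℝ} (hx : x₀ < x) : z x ≤ 0 := by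
  have hm : MonotoneOn z (Ioi x₀) := by
    refine monotoneOn_of_deriv_nonneg (convex_Ioi _)
      (fun y hy => (h1 y hy).continuousAt.continuousWithinAt)
      (fun y hy => (h1 y (by simpa using hy)).differentiableAt.differentiableWithinAt)
      fun y hy => ?_
    rw [interior_Ioi] at hy
    rw [(h1 y hy).deriv]
    exact h2 y hy
  refine ge_of_tendsto h3 ((eventually_ge_atTop x).mono fun y hy => ?_)
  exact hm hx (lt_of_lt_of_le hx hy) hy

/-- Comparison of derivatives on a half line, integrated from infinity. -/
theorem abs_le_of_abs_hasDerivAt_le {D D' B B' : ℝ → ℝ} {x₀ : ℝ}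
    (h1 : ∀ x > x₀, HasDerivAt D (D' x) x) (h2 : ∀ x > x₀, HasDerivAt B (B' x) x)
    (h3 : ∀ x > x₀, |D' x| ≤ -B' x) (h4 : Tendsto D atTop (𝓝 0)) (h5 : Tendsto B atTop (𝓝 0))
    {x : ℝ} (hx : x₀ < x) : |D x| ≤ B x := by
  have a := nonpos_of_hasDerivAt_nonneg_of_tendsto (z := fun x => D x - B x)
    (fun y hy => (h1 y hy).sub (h2 y hy))
    (fun y hy => by linarith [neg_abs_le (D' y), h3 y hy]) (by simpa using h4.sub h5) hx
  have b := nonpos_of_hasDerivAt_nonneg_of_tendsto (z := fun x => -D x - B x)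
    (fun y hy => (h1 y hy).neg.sub (h2 y hy))
    (fun y hy => by linarith [le_abs_self (D' y), h3 y hy]) (by simpa using h4.neg.sub h5) hx
  exact abs_le.mpr ⟨by linarith, by linarith⟩

/-- Bounds of order `e^{2s}` are negligible against `exp (e^{2s} / 2)`, the homogeneous solution of
the drift equation. -/
theorem tendsto_of_abs_le_exp {y : ℝ → ℝ} {K s₀ : ℝ}
    (hy : ∀ s > s₀, |y s| ≤ K * Real.exp (2 * s)) :
    Tendsto (fun s => y s * Real.exp (-(Real.exp (2 * s) / 2))) atTop (𝓝 0) := by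
  have h1 : Tendsto (fun s : ℝ => Real.exp (2 * s) / 2) atTop atTop :=
    (Real.tendsto_exp_atTop.comp (tendsto_id.const_mul_atTop two_pos)).atTop_div_const two_pos
  have h2 := ((Real.tendsto_pow_mul_exp_neg_atTop_nhds_zero 1).comp h1).const_mul (2 * K)
  rw [mul_zero] at h2
  refine squeeze_zero_norm' ((eventually_gt_atTop s₀).mono fun s hs => ?_) h2
  rw [norm_mul, Real.norm_eq_abs, Real.norm_of_nonneg (Real.exp_pos _).le]
  calc _ ≤ K * Real.exp (2 * s) * Real.exp (-(Real.exp (2 * s) / 2)) :=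
        mul_le_mul_of_nonneg_right (hy s hs) (Real.exp_pos _).le
    _ = _ := by simp only [Function.comp, pow_one]; ring

/-- A solution of `y' = e^{2s} (y + H)` that does not grow like the homogeneous solution
`exp (e^{2s} / 2)` is bounded by any `M` with `|H| ≤ M - e^{-2s} M'`. -/
theorem abs_le_of_hasDerivAt_drift {y H M M' : ℝ → ℝ} {s₀ K K' : ℝ}
    (h1 : ∀ s > s₀, HasDerivAt y (Real.exp (2 * s) * (y s + H s)) s)
    (h2 : ∀ s > s₀, HasDerivAt M (M' s) s)
    (h3 : ∀ s > s₀, |H s| ≤ M s - Real.exp (-(2 * s)) * M' s)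
    (h4 : ∀ s > s₀, |y s| ≤ K * Real.exp (2 * s))
    (h5 : ∀ s > s₀, |M s| ≤ K' * Real.exp (2 * s)) {s : ℝ} (hs : s₀ < s) :
    |y s| ≤ M s := by
  have he : ∀ t : ℝ, HasDerivAt (fun s => Real.exp (-(Real.exp (2 * s) / 2)))
      (Real.exp (-(Real.exp (2 * t) / 2)) * -Real.exp (2 * t)) t := by
    intro t
    refine ((((hasDerivAt_id t).const_mul 2).exp.div_const 2).neg).exp.congr_deriv ?_
    simp only [id, Pi.neg_apply]
    ring_nf
  have key := abs_le_of_abs_hasDerivAt_le (fun t ht => (h1 t ht).mul (he t))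
    (fun t ht => (h2 t ht).mul (he t)) (fun t ht => ?_) (tendsto_of_abs_le_exp h4)
    (tendsto_of_abs_le_exp h5) hs
  · simp only [Pi.mul_apply] at key
    rw [abs_mul, abs_of_pos (Real.exp_pos _)] at key
    exact le_of_mul_le_mul_right key (Real.exp_pos _)
  · set w := Real.exp (-(Real.exp (2 * t) / 2)) with hw
    have hw0 : 0 < w := Real.exp_pos _
    have he0 : 0 < Real.exp (2 * t) := Real.exp_pos _
    have e0 : Real.exp (2 * t) * Real.exp (-(2 * t)) = 1 := by rw [← Real.exp_add]; simp
    have e1 : Real.exp (2 * t) * (y t + H t) * w + y t * (w * -Real.exp (2 * t)) =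
        (w * Real.exp (2 * t)) * H t := by ring
    have e2 : -(M' t * w + M t * (w * -Real.exp (2 * t))) =
        (w * Real.exp (2 * t)) * (M t - Real.exp (-(2 * t)) * M' t) := by
      linear_combination (w * M' t) * e0
    rw [e1, e2, abs_mul, abs_of_pos (mul_pos hw0 he0)]
    exact mul_le_mul_of_nonneg_left (h3 t ht) (mul_pos hw0 he0).le

/-- A function whose increments satisfy `|Δ_d| ≤ |Δ_{2d}| / 2 + C d^α / 2` is `α`-Hölder. -/
theorem holder_of_doubling {D : ℝ → ℝ} {K C α ℓ : ℝ} (hα : α < 1) (hK : 0 ≤ K) (hC : 0 ≤ C)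
    (hbig : ∀ d, 0 < d → ℓ / 2 ≤ d → d ≤ ℓ → D d ≤ K * d ^ α)
    (hstep : ∀ d, 0 < d → d ≤ ℓ / 2 → D d ≤ D (2 * d) / 2 + C * d ^ α / 2) {d : ℝ}
    (hd : 0 < d) (hd' : d ≤ ℓ) : D d ≤ (K + C / (1 - 2 ^ α / 2)) * d ^ α := by
  set t : ℝ := 2 ^ α / 2 with ht
  have ht1 : t < 1 := by
    have : (2 : ℝ) ^ α < 2 := by
      simpa using Real.rpow_lt_rpow_of_exponent_lt one_lt_two hα
    rw [ht]; linarith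
  have ht0 : 0 < t := by rw [ht]; positivity
  set B := K + C / (1 - t) with hB
  have hB0 : 0 ≤ C / (1 - t) := div_nonneg hC (by linarith)
  have hKB : K ≤ B := by rw [hB]; linarith
  have hBt : t * B + C / 2 ≤ B := by
    have e : C / (1 - t) * (1 - t) = C := div_mul_cancel₀ _ (by linarith)
    have : 0 ≤ K * (1 - t) := mul_nonneg hK (by linarith)
    rw [hB]
    nlinarith
  have hind : ∀ n : ℕ, ∀ d, 0 < d → d ≤ ℓ → ℓ / 2 ^ (n + 1) ≤ d → D d ≤ B * d ^ α := by
    intro n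
    induction n with
    | zero =>
      intro d hd hd' hn
      rw [zero_add, pow_one] at hn
      exact (hbig d hd hn hd').trans (mul_le_mul_of_nonneg_right hKB (Real.rpow_nonneg hd.le _))
    | succ n ih =>
      intro d hd hd' hn
      rcases le_total (ℓ / 2) d with h | h
      · exact (hbig d hd h hd').trans
          (mul_le_mul_of_nonneg_right hKB (Real.rpow_nonneg hd.le _))
      · have h1 := ih (2 * d) (by linarith) (by linarith) (by
          rw [pow_succ, div_le_iff₀ (by positivity)] at hn
          rw [div_le_iff₀ (by positivity)]
          linarith)
        rw [Real.mul_rpow two_pos.le hd.le] at h1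
        have h2 := hstep d hd h
        have h3 := mul_le_mul_of_nonneg_right hBt (Real.rpow_nonneg hd.le α)
        have e : t * B * d ^ α = B * (2 ^ α * d ^ α) / 2 := by rw [ht]; ring
        linarith
  obtain ⟨n, hn⟩ := pow_unbounded_of_one_lt (ℓ / d) one_lt_two
  refine hind n d hd hd' ?_
  rw [div_lt_iff₀ hd] at hn
  rw [div_le_iff₀ (by positivity), pow_succ]
  have := mul_pos hd (pow_pos two_pos n : (0 : ℝ) < 2 ^ n)
  linarith

/-- The symmetric second difference `w (x + h) - 2 w x + w (x - h)`. -/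
def secondDiff (w : ℝ → ℝ) (h x : ℝ) : ℝ := w (x + h) - 2 * w x + w (x - h)

theorem abs_secondDiff_sub_le {w w' w'' : ℝ → ℝ} {h x c M : ℝ} (hh : 0 ≤ h)
    (h1 : ∀ y, HasDerivAt w (w' y) y) (h2 : ∀ y, HasDerivAt w' (w'' y) y)
    (hM : ∀ y ∈ Icc (x - h) (x + h), |w'' y - c| ≤ M) :
    |secondDiff w h x - c * h ^ 2| ≤ M * h ^ 2 := by
  have key := abs_second_difference_le (u := fun y => w y - c * (y - x) ^ 2 / 2)
    (u' := fun y => w' y - c * (y - x)) (u'' := fun y => w'' y - c) (x := x - h) (h := h) (M := M)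
    hh (fun y _ => by
      refine ((h1 y).sub (((((hasDerivAt_id y).sub_const x).pow 2).const_mul c).div_const
        2)).congr_deriv ?_
      simp only [id]; push_cast; ring)
    (fun y _ => by
      refine ((h2 y).sub (((hasDerivAt_id y).sub_const x).const_mul c)).congr_deriv ?_
      ring)
    (fun y hy => hM y ⟨hy.1, by linarith [hy.2]⟩)
  refine le_of_eq_of_le ?_ key
  unfold secondDiff
  rw [show x - h + 2 * h = x + h by ring, show x - h + h = x by ring]
  congr 1
  ring

theorem tendsto_secondDiff_div {w w' w'' : ℝ → ℝ} (h1 : ∀ y, HasDerivAt w (w' y) y)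
    (h2 : ∀ y, HasDerivAt w' (w'' y) y) (hc : Continuous w'') (x : ℝ) :
    Tendsto (fun h => secondDiff w h x / h ^ 2) (𝓝[>] 0) (𝓝 (w'' x)) := by
  rw [Metric.tendsto_nhds]
  intro ε hε
  obtain ⟨δ, hδ, hδ'⟩ := Metric.continuousAt_iff.mp (hc.continuousAt (x := x)) (ε / 2)
    (by positivity)
  filter_upwards [Ioo_mem_nhdsGT hδ] with h hh
  have key := abs_secondDiff_sub_le (x := x) (c := w'' x) (M := ε / 2) hh.1.le h1 h2
    (fun y hy => (hδ' (by
      rw [Real.dist_eq]; exact lt_of_le_of_lt (abs_le.mpr ⟨by linarith [hy.1], by linarith [hy.2]⟩)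
        hh.2)).le)
  have hpos : 0 < h ^ 2 := pow_pos hh.1 2
  have e : secondDiff w h x / h ^ 2 - w'' x = (secondDiff w h x - w'' x * h ^ 2) / h ^ 2 := by
    rw [sub_div, mul_div_cancel_right₀ _ hpos.ne']
  rw [Real.dist_eq, e, abs_div, abs_of_pos hpos]
  refine lt_of_le_of_lt ((div_le_iff₀ hpos).mpr key) (by linarith)

/-- If the increments of second differences with step `h` over a distance `h` are `O(h^{2+α})`, the
second difference quotients converge at the rate `h^α`: halving the step changes the quotient by a
combination of two such increments. -/
theorem abs_secondDiff_div_sub_le {w w' w'' : ℝ → ℝ} {T α : ℝ} (hα : 0 < α)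
    (h1 : ∀ y, HasDerivAt w (w' y) y) (h2 : ∀ y, HasDerivAt w' (w'' y) y) (hc : Continuous w'')
    (hT : ∀ x h, 0 < h → h ≤ 1 → |secondDiff w h (x + h) - secondDiff w h x| ≤ T * h ^ (2 + α))
    {x h : ℝ} (hh : 0 < h) (hh' : h ≤ 1) :
    |secondDiff w h x / h ^ 2 - w'' x| ≤ T / (1 - 2 ^ (-α)) * h ^ α := by
  refine abs_sub_limit_le_of_dyadic hα (h₀ := 1) (fun h hh hh' => ?_)
    (tendsto_secondDiff_div h1 h2 hc x) hh hh'
  set η := h / 2 with hη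
  have hη0 : 0 < η := by positivity
  have e : h = 2 * η := by rw [hη]; ring
  have a := hT x η hη0 (by linarith)
  have b := hT (x - η) η hη0 (by linarith)
  rw [sub_add_cancel] at b
  have e1 : secondDiff w h x / h ^ 2 - secondDiff w η x / η ^ 2 =
      ((secondDiff w η (x + η) - secondDiff w η x) -
        (secondDiff w η x - secondDiff w η (x - η))) / (4 * η ^ 2) := by
    have : secondDiff w h x = 4 * secondDiff w η x + ((secondDiff w η (x + η) - secondDiff w η x) -
        (secondDiff w η x - secondDiff w η (x - η))) := by
      simp only [secondDiff, e]
      rw [show x + η + η = x + 2 * η by ring, show x + η - η = x by ring,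
        show x - η + η = x by ring, show x - η - η = x - 2 * η by ring]
      ring
    rw [this, e]
    field_simp
    ring
  have hpos : 0 < 4 * η ^ 2 := by positivity
  rw [e1, abs_div, abs_of_pos hpos, div_le_iff₀ hpos]
  refine (abs_sub _ _).trans ((add_le_add a b).trans ?_)
  have e2 : η ^ (2 + α) = η ^ 2 * η ^ α := by
    rw [Real.rpow_add hη0]; norm_num
  have hT0 : 0 ≤ T := by
    have := (abs_nonneg _).trans a
    exact nonneg_of_mul_nonneg_left this (Real.rpow_pos_of_pos hη0 _)
  have h3 : η ^ α ≤ h ^ α := Real.rpow_le_rpow hη0.le (by linarith) hα.le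
  rw [e2]
  have h4 : T * (η ^ 2 * η ^ α) ≤ T * (η ^ 2 * h ^ α) := by gcongr
  have h5 : 0 ≤ T * (η ^ 2 * h ^ α) := by positivity
  linarith

/-- Interpolation: the first derivative is controlled by one increment and the second derivative. -/
theorem abs_deriv_le_of_abs_second_deriv_le {w w' w'' : ℝ → ℝ} {x h M N : ℝ} (hh : 0 < h)
    (h1 : ∀ y, HasDerivAt w (w' y) y) (h2 : ∀ y, HasDerivAt w' (w'' y) y)
    (hM : ∀ y, |w'' y| ≤ M) (hN : |w (x + h) - w x| ≤ N) : |w' x| ≤ N / h + M * h := by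
  have key := abs_sub_le_of_hasDerivAt (u := fun y => w y - w' x * y)
    (u' := fun y => w' y - w' x) (a := x) (b := x + h) (M := M * h) (by linarith)
    (fun y _ => ((h1 y).sub ((hasDerivAt_id y).const_mul (w' x))).congr_deriv (by ring))
    (fun y hy => by
      have := abs_sub_le_of_hasDerivAt (u := w') (a := x) (b := y) hy.1 (fun z _ => h2 z)
        (fun z _ => hM z)
      have hM0 : 0 ≤ M := (abs_nonneg _).trans (hM x)
      exact this.trans (mul_le_mul_of_nonneg_left (by linarith [hy.2]) hM0))
  have e : w' x * h = (w (x + h) - w x) - (w (x + h) - w' x * (x + h) - (w x - w' x * x)) := by ring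
  have h3 : |w' x| * h ≤ N + M * h * h := by
    rw [← abs_of_pos hh, ← abs_mul, abs_of_pos hh, e]
    refine (abs_sub _ _).trans (add_le_add hN ?_)
    simpa using key
  have e2 : N / h + M * h = (N + M * h * h) / h := by field_simp
  rw [e2, le_div_iff₀ hh]
  exact h3

end

/-! ### The equation in logarithmic polar coordinates -/

/-- A solution of `f_ss + (2 - e^{2s}) f_s + f + f_θθ = g` on `s > s₀`, vanishing at `s = s₀`,
`2π`-periodic and odd in `θ`, with its derivatives.  The right-hand side is bounded by `A`; its
modulus of continuity in `θ` and `s` is that of a function of size `A` that is `α`-Hölder with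
constant `A` at scales up to `e^{-s}`.  For `v(e^s cos θ, e^s sin θ) = e^s f(s, θ)` the equation is
`Δ v - ξ·∇v + v = e^{-s} g`.  The boundedness of `f` and `f_s` is only qualitative. -/
structure PolarSolution (α s₀ A : ℝ) where
  (f fs fss fθ fθθ fsθ g : ℝ → ℝ → ℝ)
  hasDerivAt_s : ∀ {s}, s₀ < s → ∀ θ, HasDerivAt (fun t => f t θ) (fs s θ) s
  hasDerivAt_ss : ∀ {s}, s₀ < s → ∀ θ, HasDerivAt (fun t => fs t θ) (fss s θ) s
  hasDerivAt_θ : ∀ {s}, s₀ < s → ∀ θ, HasDerivAt (f s) (fθ s θ) θ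
  hasDerivAt_θθ : ∀ {s}, s₀ < s → ∀ θ, HasDerivAt (fθ s) (fθθ s θ) θ
  hasDerivAt_sθ : ∀ {s}, s₀ < s → ∀ θ, HasDerivAt (fs s) (fsθ s θ) θ
  continuousOn_f : ContinuousOn (fun p : ℝ × ℝ => f p.1 p.2) (Ici s₀ ×ˢ univ)
  continuousOn_fsθ : ContinuousOn (fun p : ℝ × ℝ => fsθ p.1 p.2) (Ioi s₀ ×ˢ univ)
  continuous_fθθ : ∀ {s}, s₀ < s → Continuous (fθθ s)
  f_init : ∀ θ, f s₀ θ = 0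
  f_periodic : ∀ {s}, s₀ ≤ s → ∀ θ, f s (θ + 2 * Real.pi) = f s θ
  f_odd : ∀ {s}, s₀ ≤ s → ∀ θ, f s (-θ) = -f s θ
  f_bdd : ∃ K, ∀ {s}, s₀ ≤ s → ∀ θ, |f s θ| ≤ K
  fs_bdd : ∃ K, ∀ {s}, s₀ < s → ∀ θ, |fs s θ| ≤ K
  eq : ∀ {s}, s₀ < s → ∀ θ,
    fss s θ + (2 - Real.exp (2 * s)) * fs s θ + f s θ + fθθ s θ = g s θ
  g_le : ∀ {s}, s₀ < s → ∀ θ, |g s θ| ≤ A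
  g_θ : ∀ {s}, s₀ < s → ∀ θ {d}, 0 ≤ d →
    |g s (θ + d) - g s θ| ≤ A * (d ^ α + d * Real.exp ((1 - α) * s))
  g_s : ∀ {s}, s₀ < s → ∀ θ {d}, 0 ≤ d → d ≤ Real.exp (-s) / 4 →
    |g (s + d) θ - g s θ| ≤ A * d ^ α

namespace PolarSolution

variable {α s₀ A : ℝ}

theorem A_nonneg (u : PolarSolution α s₀ A) : 0 ≤ A :=
  (abs_nonneg _).trans (u.g_le (lt_add_one s₀) 0)

/-- The solution `-f` for the right-hand side `-g`. -/
def neg (u : PolarSolution α s₀ A) : PolarSolution α s₀ A where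
  f s θ := -u.f s θ
  fs s θ := -u.fs s θ
  fss s θ := -u.fss s θ
  fθ s θ := -u.fθ s θ
  fθθ s θ := -u.fθθ s θ
  fsθ s θ := -u.fsθ s θ
  g s θ := -u.g s θ
  hasDerivAt_s hs θ := (u.hasDerivAt_s hs θ).neg
  hasDerivAt_ss hs θ := (u.hasDerivAt_ss hs θ).neg
  hasDerivAt_θ hs θ := (u.hasDerivAt_θ hs θ).neg
  hasDerivAt_θθ hs θ := (u.hasDerivAt_θθ hs θ).neg
  hasDerivAt_sθ hs θ := (u.hasDerivAt_sθ hs θ).neg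
  continuousOn_f := u.continuousOn_f.neg
  continuousOn_fsθ := u.continuousOn_fsθ.neg
  continuous_fθθ hs := (u.continuous_fθθ hs).neg
  f_init θ := by simp [u.f_init θ]
  f_periodic hs θ := by rw [u.f_periodic hs θ]
  f_odd hs θ := by rw [u.f_odd hs θ]
  f_bdd := by simpa using u.f_bdd
  fs_bdd := by simpa using u.fs_bdd
  eq hs θ := by linarith [u.eq hs θ]
  g_le hs θ := by simpa using u.g_le hs θ
  g_θ hs θ d hd := by
    rw [neg_sub_neg, abs_sub_comm]
    exact u.g_θ hs θ hd
  g_s hs θ d hd hd' := by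
    rw [neg_sub_neg, abs_sub_comm]
    exact u.g_s hs θ hd hd'

theorem f_pi (u : PolarSolution α s₀ A) {s : ℝ} (hs : s₀ ≤ s) : u.f s Real.pi = 0 := by
  have h1 := u.f_periodic hs (-Real.pi)
  rw [u.f_odd hs, show -Real.pi + 2 * Real.pi = Real.pi by ring] at h1
  linarith

theorem f_zero (u : PolarSolution α s₀ A) {s : ℝ} (hs : s₀ ≤ s) : u.f s 0 = 0 := by
  have h1 := u.f_odd hs 0
  rw [neg_zero] at h1
  linarith

/-- The hypothesis `e^{-s₀} ≤ 3/2` is what remains of `R > 1 / √2`, with `s₀ = log R`. -/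
theorem exp_neg_le (h₀ : Real.exp (-s₀) ≤ 3 / 2) {s : ℝ} (hs : s₀ ≤ s) :
    Real.exp (-s) ≤ 3 / 2 :=
  (Real.exp_le_exp.mpr (by linarith)).trans h₀

theorem exp_neg_two_le (h₀ : Real.exp (-s₀) ≤ 3 / 2) {s : ℝ} (hs : s₀ ≤ s) :
    Real.exp (-(2 * s)) ≤ 9 / 4 := by
  have h1 := exp_neg_le h₀ hs
  have h2 : Real.exp (-(2 * s)) = Real.exp (-s) ^ 2 := by
    rw [← Real.exp_nat_mul]; congr 1; push_cast; ring
  rw [h2]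
  nlinarith [Real.exp_pos (-s)]

theorem two_thirds_le_exp {α s₀ s : ℝ} (hα₀ : 0 < α) (hα₁ : α < 1)
    (h₀ : Real.exp (-s₀) ≤ 3 / 2) (hs : s₀ ≤ s) : 2 / 3 ≤ Real.exp ((1 - α) * s) := by
  have e1 : Real.exp ((1 - α) * -s) ≤ 3 / 2 := by
    have := exp_neg_le h₀ hs
    rcases le_total s 0 with h | h
    · refine le_trans (Real.exp_le_exp.mpr ?_) this
      nlinarith
    · refine le_trans (Real.exp_le_one_iff.mpr ?_) (by norm_num)
      nlinarith
  have e2 : Real.exp ((1 - α) * s) * Real.exp ((1 - α) * -s) = 1 := by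
    rw [← Real.exp_add]; simp
  nlinarith [Real.exp_pos ((1 - α) * s)]

/-! ### The supremum bound -/

/-- Comparison on the half plane `0 < θ < π` with multiples of the positive strict supersolution
`5 sin θ - sin² θ - (3/2) e^{-2s} sin θ`, perturbed by a multiple of the superlinear `e^s` that
controls the behaviour at infinity. -/
theorem f_le_of_mem_Icc (h₀ : Real.exp (-s₀) ≤ 3 / 2) (u : PolarSolution α s₀ A) {ε : ℝ}
    (hε : 0 < ε) {s : ℝ} (hs : s₀ ≤ s) {θ : ℝ} (hθ : θ ∈ Icc 0 Real.pi) :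
    u.f s θ ≤ (A / 2 + 3 * ε) * (5 * Real.sin θ - Real.sin θ ^ 2 -
      3 / 2 * Real.sin θ * Real.exp (-(2 * s))) + ε * Real.exp s := by
  have hA := u.A_nonneg
  set c : ℝ := A / 2 + 3 * ε with hc
  have hc0 : 0 < c := by positivity
  set P : ℝ → ℝ → ℝ := fun s θ => c * (5 * Real.sin θ - Real.sin θ ^ 2 -
      3 / 2 * Real.sin θ * Real.exp (-(2 * s))) + ε * Real.exp s with hP
  have hP1 : ∀ s ≥ s₀, ∀ θ ∈ Icc 0 Real.pi, ε * Real.exp s ≤ P s θ := by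
    intro s hs θ hθ
    have a := Real.sin_nonneg_of_mem_Icc hθ
    have b := Real.sin_le_one θ
    have e := exp_neg_two_le h₀ hs
    have : 0 ≤ 5 * Real.sin θ - Real.sin θ ^ 2 - 3 / 2 * Real.sin θ * Real.exp (-(2 * s)) := by
      nlinarith
    have := mul_nonneg hc0.le this
    simp only [hP]
    linarith
  have hP0 : ∀ s ≥ s₀, ∀ θ ∈ Icc 0 Real.pi, 0 < P s θ := fun s hs θ hθ =>
    lt_of_lt_of_le (mul_pos hε (Real.exp_pos s)) (hP1 s hs θ hθ)
  -- The zeroth order term has the wrong sign for the maximum principle, so the quotient `f / P` by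
  -- the supersolution is used.  At a maximum with value `l > 1` the function `f - l P` is maximal
  -- as well.
  have key := nonpos_of_no_positive_max (isCompact_Icc (a := (0 : ℝ)) (b := Real.pi))
    (u := fun s θ => u.f s θ / P s θ - 1) (s₀ := s₀) ?_ ?_ ?_ ?_ s hs θ hθ
  · have := hP0 s hs θ hθ
    rw [sub_nonpos, div_le_one this] at key
    exact key
  · refine ContinuousOn.sub (ContinuousOn.div (u.continuousOn_f.mono
      (prod_mono subset_rfl (subset_univ _))) ?_ ?_) continuousOn_const
    · simp only [hP]
      fun_prop
    · rintro ⟨s, θ⟩ ⟨hs, hθ⟩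
      exact (hP0 s hs θ hθ).ne'
  · intro θ _
    simp [u.f_init θ]
  · obtain ⟨K, hK⟩ := u.f_bdd
    refine ⟨max s₀ (K / ε), fun s hs θ hθ => ?_⟩
    have hs0 : s₀ ≤ s := (le_max_left _ _).trans hs
    have hs1 : K / ε ≤ s := (le_max_right _ _).trans hs
    rw [sub_nonpos, div_le_one (hP0 s hs0 θ hθ)]
    refine le_trans ?_ (hP1 s hs0 θ hθ)
    rw [div_le_iff₀ hε] at hs1
    have := (le_abs_self _).trans (hK hs0 θ)
    have := Real.add_one_le_exp s
    nlinarith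
  · intro s hs θ hθ hpos hmax
    set l : ℝ := u.f s θ / P s θ with hl
    have hl1 : 1 < l := by linarith
    have hPs := hP0 s hs.le θ hθ
    have hfl : u.f s θ = l * P s θ := by rw [hl]; field_simp
    have hf0 : 0 < u.f s θ := by rw [hfl]; positivity
    have hθ' : θ ∈ Ioo 0 Real.pi := by
      refine ⟨lt_of_le_of_ne hθ.1 ?_, lt_of_le_of_ne hθ.2 ?_⟩
      · rintro rfl; exact hf0.ne' (u.f_zero hs.le)
      · rintro rfl; exact hf0.ne' (u.f_pi hs.le)
    have hle : ∀ s' ≥ s₀, ∀ θ' ∈ Icc 0 Real.pi, u.f s' θ' - l * P s' θ' ≤ u.f s θ - l * P s θ := by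
      intro s' hs' θ' hθ'
      have h1 := hmax s' hs' θ' hθ'
      have h2 := hP0 s' hs' θ' hθ'
      have h3 : u.f s' θ' / P s' θ' ≤ l := by linarith
      rw [div_le_iff₀ h2] at h3
      linarith
    -- the derivatives of the comparison function
    have dPs : ∀ t : ℝ, HasDerivAt (fun t => P t θ)
        (c * (3 * Real.sin θ * Real.exp (-(2 * t))) + ε * Real.exp t) t := by
      intro t
      have h1 : HasDerivAt (fun t : ℝ => Real.exp (-(2 * t))) (Real.exp (-(2 * t)) * -(2 * 1)) t :=
        (((hasDerivAt_id t).const_mul 2).neg).exp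
      have := (((h1.const_mul (3 / 2 * Real.sin θ)).const_sub
        (5 * Real.sin θ - Real.sin θ ^ 2)).const_mul c).add ((Real.hasDerivAt_exp t).const_mul ε)
      refine this.congr_deriv ?_
      ring
    have dPss : HasDerivAt (fun t => c * (3 * Real.sin θ * Real.exp (-(2 * t))) + ε * Real.exp t)
        (c * (-6 * Real.sin θ * Real.exp (-(2 * s))) + ε * Real.exp s) s := by
      have h1 : HasDerivAt (fun t : ℝ => Real.exp (-(2 * t))) (Real.exp (-(2 * s)) * -(2 * 1)) s :=
        (((hasDerivAt_id s).const_mul 2).neg).exp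
      have := ((h1.const_mul (3 * Real.sin θ)).const_mul c).add
        ((Real.hasDerivAt_exp s).const_mul ε)
      refine this.congr_deriv ?_
      ring
    have dPθ : ∀ t : ℝ, HasDerivAt (P s) (c * (5 * Real.cos t - 2 * Real.sin t * Real.cos t -
        3 / 2 * Real.cos t * Real.exp (-(2 * s)))) t := by
      intro t
      have h1 := Real.hasDerivAt_sin t
      have := ((((h1.const_mul 5).sub (h1.pow 2)).sub
        ((h1.const_mul (3 / 2)).mul_const (Real.exp (-(2 * s))))).const_mul c).add_const
          (ε * Real.exp s)
      refine this.congr_deriv ?_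
      push_cast
      ring
    have dPθθ : HasDerivAt (fun t => c * (5 * Real.cos t - 2 * Real.sin t * Real.cos t -
        3 / 2 * Real.cos t * Real.exp (-(2 * s))))
        (c * (-5 * Real.sin θ - 2 * Real.cos θ ^ 2 + 2 * Real.sin θ ^ 2 +
          3 / 2 * Real.sin θ * Real.exp (-(2 * s)))) θ := by
      have h1 := Real.hasDerivAt_sin θ
      have h2 := Real.hasDerivAt_cos θ
      have := (((h2.const_mul 5).sub ((h1.const_mul 2).mul h2)).sub
        ((h2.const_mul (3 / 2)).mul_const (Real.exp (-(2 * s))))).const_mul c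
      refine this.congr_deriv ?_
      ring
    have ms : IsLocalMax (fun t => u.f t θ - l * P t θ) s := by
      filter_upwards [Ioi_mem_nhds hs] with t ht
      exact hle t (le_of_lt ht) θ hθ
    have mθ : IsLocalMax (fun t => u.f s t - l * P s t) θ := by
      filter_upwards [Ioo_mem_nhds hθ'.1 hθ'.2] with t ht
      exact hle s hs.le t ⟨ht.1.le, ht.2.le⟩
    have i1 := second_deriv_nonpos_of_isLocalMax
      (by filter_upwards [Ioi_mem_nhds hs] with t ht
          exact (u.hasDerivAt_s ht θ).sub ((dPs t).const_mul l))
      ((u.hasDerivAt_ss hs θ).sub (dPss.const_mul l)) ms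
    have i2 := second_deriv_nonpos_of_isLocalMax
      (Eventually.of_forall fun t => (u.hasDerivAt_θ hs t).sub ((dPθ t).const_mul l))
      ((u.hasDerivAt_θθ hs θ).sub (dPθθ.const_mul l)) mθ
    have i3 := ms.hasDerivAt_eq_zero ((u.hasDerivAt_s hs θ).sub ((dPs s).const_mul l))
    have i4 := u.eq hs θ
    have i5 := (abs_le.mp (u.g_le hs θ)).1
    set r := Real.exp s with hr
    have hr0 : 0 < r := Real.exp_pos s
    have e2 : Real.exp (2 * s) = r ^ 2 := by
      rw [hr, ← Real.exp_nat_mul]; push_cast; rfl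
    have e3 : Real.exp (-(2 * s)) = (r ^ 2)⁻¹ := by rw [Real.exp_neg, e2]
    have e4 : r ^ 2 * (r ^ 2)⁻¹ = 1 := mul_inv_cancel₀ (by positivity)
    have a := Real.sin_nonneg_of_mem_Icc hθ
    have b := Real.sin_le_one θ
    have hcos : Real.cos θ ^ 2 = 1 - Real.sin θ ^ 2 := by
      linarith [Real.sin_sq_add_cos_sq θ]
    have hPv : P s θ = c * (5 * Real.sin θ - Real.sin θ ^ 2 -
      3 / 2 * Real.sin θ * (r ^ 2)⁻¹) + ε * r := by simp only [hP, e3, ← hr]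
    rw [e3] at i1 i2 i3
    rw [e2] at i4
    rw [hcos] at i2
    have hfs : u.fs s θ = l * (c * (3 * Real.sin θ * (r ^ 2)⁻¹) + ε * r) := by linarith
    rw [hfs, hfl, hPv] at i4
    -- The operator maps `5 sin θ` to `0`, `-sin² θ` to `-2 + 3 sin² θ`, the term with `e^{-2s}` to
    -- `-3 sin θ`, and `e^s` to `4 e^s - e^{3s} ≤ 4`.
    have i6 : u.g s θ ≤ l * (c * (-2 + 3 * Real.sin θ ^ 2 - 3 * Real.sin θ) +
        ε * (4 * r - r ^ 3)) := by
      have e5 : (2 - r ^ 2) * (l * (c * (3 * Real.sin θ * (r ^ 2)⁻¹) + ε * r)) =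
          l * (c * (6 * Real.sin θ * (r ^ 2)⁻¹ - 3 * Real.sin θ) + ε * (2 * r - r ^ 3)) := by
        linear_combination (-3 * l * c * Real.sin θ) * e4
      rw [e5] at i4
      linear_combination i1 + i2 - i4
    have i7 : 4 * r - r ^ 3 ≤ 4 := by
      have : 0 ≤ r * (r - 3 / 2) ^ 2 := mul_nonneg hr0.le (sq_nonneg _)
      nlinarith only [this, sq_nonneg (r - 7 / 6)]
    have i8 : c * (-2 + 3 * Real.sin θ ^ 2 - 3 * Real.sin θ) ≤ c * (-2) := by
      apply mul_le_mul_of_nonneg_left _ hc0.le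
      nlinarith only [a, b]
    have i9 : c * (-2 + 3 * Real.sin θ ^ 2 - 3 * Real.sin θ) + ε * (4 * r - r ^ 3) ≤
        -A - 2 * ε := by
      have := mul_le_mul_of_nonneg_left i7 hε.le
      rw [hc] at i8 ⊢
      linarith
    have i10 := mul_le_mul_of_nonneg_left i9 (by linarith : 0 ≤ l)
    have i11 : A + 2 * ε ≤ l * (A + 2 * ε) := le_mul_of_one_le_left (by positivity) hl1.le
    linarith only [i5, i6, i10, i11, hε]

theorem f_le_of_mem_Icc' (h₀ : Real.exp (-s₀) ≤ 3 / 2) (u : PolarSolution α s₀ A)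
    {s : ℝ} (hs : s₀ ≤ s) {θ : ℝ} (hθ : θ ∈ Icc 0 Real.pi) : u.f s θ ≤ 5 / 2 * A := by
  have hA := u.A_nonneg
  have a := Real.sin_nonneg_of_mem_Icc hθ
  have b := Real.sin_le_one θ
  refine le_of_forall_pos_le_add fun δ hδ => ?_
  have hr := Real.exp_pos s
  have hden : 0 < 15 + Real.exp s := by positivity
  have h1 := u.f_le_of_mem_Icc h₀ (ε := δ / (15 + Real.exp s)) (by positivity) hs hθ
  have h2 : 5 * Real.sin θ - Real.sin θ ^ 2 - 3 / 2 * Real.sin θ * Real.exp (-(2 * s)) ≤ 5 := by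
    have := mul_nonneg a (Real.exp_pos (-(2 * s))).le
    nlinarith
  have h3 : 0 ≤ A / 2 + 3 * (δ / (15 + Real.exp s)) := by positivity
  have h4 := mul_le_mul_of_nonneg_left h2 h3
  have h5 : δ / (15 + Real.exp s) * (15 + Real.exp s) = δ := by field_simp
  nlinarith

/-- The supremum bound.  By oddness and periodicity it suffices to consider `0 ≤ θ ≤ π`. -/
theorem abs_f_le (h₀ : Real.exp (-s₀) ≤ 3 / 2) (u : PolarSolution α s₀ A)
    {s : ℝ} (hs : s₀ ≤ s) (θ : ℝ) : |u.f s θ| ≤ 5 / 2 * A := by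
  have h1 : ∀ θ ∈ Icc 0 Real.pi, |u.f s θ| ≤ 5 / 2 * A := fun θ hθ =>
    abs_le'.mpr ⟨u.f_le_of_mem_Icc' h₀ hs hθ, u.neg.f_le_of_mem_Icc' h₀ hs hθ⟩
  have hper : Function.Periodic (u.f s) (2 * Real.pi) := u.f_periodic hs
  obtain ⟨y, hy, hy'⟩ := hper.exists_mem_Ico Real.two_pi_pos θ (-Real.pi)
  rw [hy']
  rcases le_total 0 y with h | h
  · exact h1 y ⟨h, by linarith [hy.2]⟩
  · have := h1 (-y) ⟨by linarith, by linarith [hy.1]⟩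
    rwa [u.f_odd hs, abs_neg] at this

/-! ### The Lipschitz bound in the angle -/

theorem hasDerivAt_symm_sub {w w' : ℝ → ℝ} {c h : ℝ} (h1 : HasDerivAt w (w' (c + h)) (c + h))
    (h2 : HasDerivAt w (w' (c - h)) (c - h)) :
    HasDerivAt (fun h => w (c + h) - w (c - h)) (w' (c + h) + w' (c - h)) h := by
  refine ((h1.comp_const_add c h).sub (h2.comp_const_sub c h)).congr_deriv ?_
  ring

theorem hasDerivAt_symm_add {w w' : ℝ → ℝ} {c h : ℝ} (h1 : HasDerivAt w (w' (c + h)) (c + h))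
    (h2 : HasDerivAt w (w' (c - h)) (c - h)) :
    HasDerivAt (fun h => w (c + h) + w (c - h)) (w' (c + h) - w' (c - h)) h := by
  refine ((h1.comp_const_add c h).add (h2.comp_const_sub c h)).congr_deriv ?_
  ring

theorem f_add_pi (u : PolarSolution α s₀ A) {s : ℝ} (hs : s₀ ≤ s) (θ : ℝ) :
    u.f s (θ + Real.pi) = u.f s (θ - Real.pi) := by
  rw [← u.f_periodic hs (θ - Real.pi)]
  congr 1
  ring

/-- The symmetric difference `f(s, θ + h) - f(s, θ - h)` vanishes at `h = 0` and, by periodicity,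
at `h = π`; as a function of `(s, h)` it solves the equation without zeroth order term. -/
theorem symm_sub_le (h₀ : Real.exp (-s₀) ≤ 3 / 2) (u : PolarSolution α s₀ A) (θ : ℝ) {ε : ℝ}
    (hε : 0 < ε) {s : ℝ} (hs : s₀ ≤ s) {h : ℝ} (hh : h ∈ Icc 0 Real.pi) :
    u.f s (θ + h) - u.f s (θ - h) ≤
      (7 / 2 * A + 2 * ε) * (h * (Real.pi - h)) + ε * (s - s₀) := by
  have hA := u.A_nonneg
  set c : ℝ := 7 / 2 * A + 2 * ε with hc
  have hc0 : 0 < c := by positivity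
  have hB : ∀ s ≥ s₀, ∀ h ∈ Icc 0 Real.pi, ε * (s - s₀) ≤ c * (h * (Real.pi - h)) + ε * (s - s₀) :=
    fun s hs h hh => by
      have := mul_nonneg hc0.le (mul_nonneg hh.1 (sub_nonneg.mpr hh.2))
      linarith
  have key := nonpos_of_no_positive_max (isCompact_Icc (a := (0 : ℝ)) (b := Real.pi))
    (u := fun s h => (u.f s (θ + h) - u.f s (θ - h)) - (c * (h * (Real.pi - h)) + ε * (s - s₀)))
    (s₀ := s₀) ?_ ?_ ?_ ?_ s hs h hh
  · linarith
  · refine ContinuousOn.sub (ContinuousOn.sub ?_ ?_) (by fun_prop)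
    · exact u.continuousOn_f.comp (f := fun p : ℝ × ℝ => (p.1, θ + p.2)) (by fun_prop)
        fun p hp => ⟨hp.1, mem_univ _⟩
    · exact u.continuousOn_f.comp (f := fun p : ℝ × ℝ => (p.1, θ - p.2)) (by fun_prop)
        fun p hp => ⟨hp.1, mem_univ _⟩
  · intro h hh
    have := hB s₀ le_rfl h hh
    simp only [u.f_init]
    linarith
  · refine ⟨s₀ + 5 * A / ε, fun s hs h hh => ?_⟩
    have hs0 : s₀ ≤ s := le_trans (by have : 0 ≤ 5 * A / ε := by positivity
                                      linarith) hs
    have h1 : 5 * A ≤ ε * (s - s₀) := by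
      have : 5 * A / ε ≤ s - s₀ := by linarith
      rw [div_le_iff₀ hε] at this
      linarith
    have h2 := abs_le.mp (u.abs_f_le h₀ hs0 (θ + h))
    have h3 := abs_le.mp (u.abs_f_le h₀ hs0 (θ - h))
    have := hB s hs0 h hh
    linarith
  · intro s hs h hh hpos hmax
    have hs0 : 0 ≤ ε * (s - s₀) := mul_nonneg hε.le (by linarith)
    have hh' : h ∈ Ioo 0 Real.pi := by
      refine ⟨lt_of_le_of_ne hh.1 ?_, lt_of_le_of_ne hh.2 ?_⟩
      · rintro rfl
        simp only [add_zero, sub_zero, sub_self, zero_mul, mul_zero] at hpos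
        linarith
      · rintro rfl
        simp only [u.f_add_pi hs.le, sub_self, mul_zero] at hpos
        linarith
    have ms : IsLocalMax (fun t => (u.f t (θ + h) - u.f t (θ - h)) -
        (c * (h * (Real.pi - h)) + ε * (t - s₀))) s := by
      filter_upwards [Ioi_mem_nhds hs] with t ht
      exact hmax t (le_of_lt ht) h hh
    have mh : IsLocalMax (fun h => (u.f s (θ + h) - u.f s (θ - h)) -
        (c * (h * (Real.pi - h)) + ε * (s - s₀))) h := by
      filter_upwards [Ioo_mem_nhds hh'.1 hh'.2] with t ht
      exact hmax s hs.le t ⟨ht.1.le, ht.2.le⟩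
    have dBs : ∀ t : ℝ, HasDerivAt (fun t => c * (h * (Real.pi - h)) + ε * (t - s₀)) (ε * 1) t :=
      fun t => (((hasDerivAt_id t).sub_const s₀).const_mul ε).const_add _
    have dBh : ∀ t : ℝ, HasDerivAt (fun h => c * (h * (Real.pi - h)) + ε * (s - s₀))
        (c * (Real.pi - 2 * t)) t := by
      intro t
      have := (((hasDerivAt_id t).mul ((hasDerivAt_id t).const_sub Real.pi)).const_mul c).add_const
        (ε * (s - s₀))
      refine this.congr_deriv ?_
      simp only [id]
      ring
    have dBhh : HasDerivAt (fun t => c * (Real.pi - 2 * t)) (c * (-(2 * 1))) h :=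
      (((hasDerivAt_id h).const_mul 2).const_sub Real.pi).const_mul c
    have i1 := second_deriv_nonpos_of_isLocalMax
      (by filter_upwards [Ioi_mem_nhds hs] with t ht
          exact ((u.hasDerivAt_s ht (θ + h)).sub (u.hasDerivAt_s ht (θ - h))).sub (dBs t))
      (((u.hasDerivAt_ss hs (θ + h)).sub (u.hasDerivAt_ss hs (θ - h))).sub
        (hasDerivAt_const s (ε * 1))) ms
    have i3 := ms.hasDerivAt_eq_zero
      (((u.hasDerivAt_s hs (θ + h)).sub (u.hasDerivAt_s hs (θ - h))).sub (dBs s))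
    have i2 := second_deriv_nonpos_of_isLocalMax
      (Eventually.of_forall fun t => (hasDerivAt_symm_sub (u.hasDerivAt_θ hs (θ + t))
        (u.hasDerivAt_θ hs (θ - t))).sub (dBh t))
      ((hasDerivAt_symm_add (u.hasDerivAt_θθ hs (θ + h))
        (u.hasDerivAt_θθ hs (θ - h))).sub dBhh) mh
    have j1 := u.eq hs (θ + h)
    have j2 := u.eq hs (θ - h)
    have j3 := abs_le.mp (u.g_le hs (θ + h))
    have j4 := abs_le.mp (u.g_le hs (θ - h))
    have j5 := abs_le.mp (u.abs_f_le h₀ hs.le (θ + h))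
    have j6 := abs_le.mp (u.abs_f_le h₀ hs.le (θ - h))
    have j7 : (2 - Real.exp (2 * s)) * (u.fs s (θ + h) - u.fs s (θ - h)) =
        (2 - Real.exp (2 * s)) * ε := by
      congr 1; linarith
    have := mul_pos hε (Real.exp_pos (2 * s))
    rw [hc] at i2
    nlinarith

theorem symm_sub_le' (h₀ : Real.exp (-s₀) ≤ 3 / 2) (u : PolarSolution α s₀ A) (θ : ℝ)
    {s : ℝ} (hs : s₀ ≤ s) {h : ℝ} (hh : h ∈ Icc 0 Real.pi) :
    u.f s (θ + h) - u.f s (θ - h) ≤ 7 / 2 * A * (h * (Real.pi - h)) := by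
  refine le_of_forall_pos_le_add fun δ hδ => ?_
  have hw : 0 ≤ h * (Real.pi - h) := mul_nonneg hh.1 (sub_nonneg.mpr hh.2)
  have hss : 0 ≤ s - s₀ := by linarith
  have hden : 0 < 2 * (h * (Real.pi - h)) + (s - s₀) + 1 := by positivity
  have h1 := u.symm_sub_le h₀ θ (ε := δ / (2 * (h * (Real.pi - h)) + (s - s₀) + 1))
    (by positivity) hs hh
  have h5 : δ / (2 * (h * (Real.pi - h)) + (s - s₀) + 1) *
    (2 * (h * (Real.pi - h)) + (s - s₀) + 1) = δ := div_mul_cancel₀ _ hden.ne'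
  have h6 : 0 ≤ δ / (2 * (h * (Real.pi - h)) + (s - s₀) + 1) := by positivity
  nlinarith

theorem abs_f_sub_le (h₀ : Real.exp (-s₀) ≤ 3 / 2) (u : PolarSolution α s₀ A)
    {s : ℝ} (hs : s₀ ≤ s) (θ : ℝ) {d : ℝ} (hd : 0 ≤ d) :
    |u.f s (θ + d) - u.f s θ| ≤ 6 * A * d := by
  have hA := u.A_nonneg
  by_cases h : d ≤ 1
  · have hπ := Real.pi_gt_three
    have hπ' := Real.pi_lt_d2
    have hh : d / 2 ∈ Icc 0 Real.pi := ⟨by linarith, by linarith⟩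
    have a := u.symm_sub_le' h₀ (θ + d / 2) hs hh
    have b := u.neg.symm_sub_le' h₀ (θ + d / 2) hs hh
    have e1 : θ + d / 2 + d / 2 = θ + d := by ring
    have e2 : θ + d / 2 - d / 2 = θ := by ring
    rw [e1, e2] at a b
    have hb : 7 / 2 * A * (d / 2 * (Real.pi - d / 2)) ≤ 6 * A * d := by
      have : 0 ≤ A * d := mul_nonneg hA hd
      nlinarith
    refine abs_le'.mpr ⟨a.trans hb, ?_⟩
    have : -(u.f s (θ + d) - u.f s θ) = u.neg.f s (θ + d) - u.neg.f s θ := by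
      simp only [neg]; ring
    rw [this]
    exact b.trans hb
  · have h2 := abs_le.mp (u.abs_f_le h₀ hs (θ + d))
    have h3 := abs_le.mp (u.abs_f_le h₀ hs θ)
    push Not at h
    have : A ≤ A * d := le_mul_of_one_le_right hA h.le
    exact abs_le.mpr ⟨by linarith, by linarith⟩

end PolarSolution

noncomputable section

/-! ### Third differences in the angle -/

/-- The mixed second difference `δ_k δ_l w` at `x`, where `δ_k w (x) = w (x + k) - w (x - k)`. -/
def mixedDiff₂ (w : ℝ → ℝ) (k l x : ℝ) : ℝ :=
  w (x + k + l) - w (x + k - l) - w (x - k + l) + w (x - k - l)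

/-- The mixed third difference `δ_h δ_k δ_l w` at `x`, where `δ_k w (x) = w (x + k) - w (x - k)`. -/
def mixedDiff₃ (w : ℝ → ℝ) (x h k l : ℝ) : ℝ :=
  mixedDiff₂ w k l (x + h) - mixedDiff₂ w k l (x - h)

theorem mixedDiff₃_swap₁₂ (w : ℝ → ℝ) (x h k l : ℝ) :
    mixedDiff₃ w x h k l = mixedDiff₃ w x k h l := by
  simp only [mixedDiff₃, mixedDiff₂]
  rw [show x + h - k = x - k + h by ring, show x - h + k = x + k - h by ring,
    show x + h + k = x + k + h by ring, show x - h - k = x - k - h by ring]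
  ring

theorem mixedDiff₃_swap₁₃ (w : ℝ → ℝ) (x h k l : ℝ) :
    mixedDiff₃ w x h k l = mixedDiff₃ w x l h k := by
  simp only [mixedDiff₃, mixedDiff₂]
  rw [show x + h - k - l = x - l + h - k by ring, show x - h + k - l = x - l - h + k by ring,
    show x + h + k - l = x - l + h + k by ring, show x - h - k - l = x - l - h - k by ring,
    show x + h - k + l = x + l + h - k by ring, show x - h + k + l = x + l - h + k by ring,
    show x + h + k + l = x + l + h + k by ring, show x - h - k + l = x + l - h - k by ring]
  ring

theorem hasDerivAt_mixedDiff₂ {w w' : ℝ → ℝ} (hw : ∀ x, HasDerivAt w (w' x) x) (k l x : ℝ) :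
    HasDerivAt (mixedDiff₂ w k l) (mixedDiff₂ w' k l x) x := by
  have e : ∀ c d, HasDerivAt (fun y => w (y + c + d)) (w' (x + c + d)) x := fun c d =>
    ((hw (x + c + d)).comp_add_const (x + c) d).comp_add_const x c
  have := (((e k l).sub (e k (-l))).sub (e (-k) l)).add (e (-k) (-l))
  simp only [← sub_eq_add_neg] at this
  exact this

/-- The logistic profile `z / (1 + z)` at `z = e^s x^{1/3}`. -/
def logisticProfile (s x : ℝ) : ℝ :=
  Real.exp s * x ^ (1 / 3 : ℝ) / (1 + Real.exp s * x ^ (1 / 3 : ℝ))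

theorem logisticProfile_mem {s x : ℝ} (hx : 0 ≤ x) : logisticProfile s x ∈ Icc (0 : ℝ) 1 := by
  have : 0 ≤ Real.exp s * x ^ (1 / 3 : ℝ) := by positivity
  unfold logisticProfile
  exact ⟨by positivity, (div_le_one (by positivity)).mpr (by linarith)⟩

theorem hasDerivAt_div_one_add {y : ℝ → ℝ} {y' t : ℝ} (hy : HasDerivAt y y' t) (h0 : 0 ≤ y t) :
    HasDerivAt (fun t => y t / (1 + y t)) (y' / (1 + y t) ^ 2) t := by
  have h1 : 1 + y t ≠ 0 := by positivity
  refine (hy.div (hy.const_add 1) h1).congr_deriv ?_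
  congr 1
  ring

theorem hasDerivAt_rpow_of_pos {x : ℝ} (hx : 0 < x) (β : ℝ) :
    HasDerivAt (fun x : ℝ => x ^ β) (β * x ^ β / x) x := by
  refine (Real.hasDerivAt_rpow_const (Or.inl hx.ne')).congr_deriv ?_
  rw [Real.rpow_sub_one hx.ne']
  ring

theorem hasDerivAt_logisticProfile_right (s : ℝ) {x : ℝ} (hx : 0 < x) :
    HasDerivAt (logisticProfile s)
      (logisticProfile s x * (1 - logisticProfile s x) / (3 * x)) x := by
  have h0 : 0 ≤ Real.exp s * x ^ (1 / 3 : ℝ) := by positivity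
  have h1 := (hasDerivAt_rpow_of_pos hx (1 / 3)).const_mul (Real.exp s)
  refine (hasDerivAt_div_one_add h1 h0).congr_deriv ?_
  unfold logisticProfile
  field_simp
  ring

theorem hasDerivAt_logisticProfile_left (s : ℝ) {x : ℝ} (hx : 0 < x) :
    HasDerivAt (fun s => logisticProfile s x)
      (logisticProfile s x * (1 - logisticProfile s x)) s := by
  have h0 : 0 ≤ Real.exp s * x ^ (1 / 3 : ℝ) := by positivity
  have h1 := (Real.hasDerivAt_exp s).mul_const (x ^ (1 / 3 : ℝ))
  refine (hasDerivAt_div_one_add h1 h0).congr_deriv ?_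
  unfold logisticProfile
  field_simp
  ring

/-- The barrier `x^β (C + B z / (1 + z))`, `z = e^s x^{1/3}`, where `x` stands for the product
`h k l` of three increments.  The factor `x^β` is concave in each increment and compensates the
part of the right-hand side that is Hölder uniformly in `s`; the logistic factor uses the drift
`-e^{2s} ∂_s` to compensate the part that is Hölder at scales below `e^{-s}` only. -/
def tripleBarrier (β C B s x : ℝ) : ℝ :=
  x ^ β * (C + B * logisticProfile s x)

theorem hasDerivAt_tripleBarrier_s (β C B s : ℝ) {x : ℝ} (hx : 0 < x) :
    HasDerivAt (fun s => tripleBarrier β C B s x)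
      (x ^ β * (B * (logisticProfile s x * (1 - logisticProfile s x)))) s :=
  (((hasDerivAt_logisticProfile_left s hx).const_mul B).const_add C).const_mul _

theorem hasDerivAt_tripleBarrier_ss (β B s : ℝ) {x : ℝ} (hx : 0 < x) :
    HasDerivAt (fun s => x ^ β * (B * (logisticProfile s x * (1 - logisticProfile s x))))
      (x ^ β * (B * (logisticProfile s x * (1 - logisticProfile s x) *
        (1 - 2 * logisticProfile s x)))) s := by
  have h1 := hasDerivAt_logisticProfile_left s hx
  refine (((h1.mul (h1.const_sub 1)).const_mul B).const_mul (x ^ β)).congr_deriv ?_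
  ring

/-- `x ∂_x log` of the barrier, up to the factor `x^β`. -/
def tripleBarrierSlope (β C B s x : ℝ) : ℝ :=
  β * (C + B * logisticProfile s x) + B * (logisticProfile s x * (1 - logisticProfile s x)) / 3

theorem hasDerivAt_tripleBarrier_x (β C B s : ℝ) {x : ℝ} (hx : 0 < x) :
    HasDerivAt (tripleBarrier β C B s) (x ^ β / x * tripleBarrierSlope β C B s x) x := by
  refine ((hasDerivAt_rpow_of_pos hx β).mul
    (((hasDerivAt_logisticProfile_right s hx).const_mul B).const_add C)).congr_deriv ?_
  unfold tripleBarrierSlope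
  field_simp

/-- `x² ∂_x²` of the barrier, up to the factor `x^β`. -/
def tripleBarrierCurvature (β C B s x : ℝ) : ℝ :=
  (β - 1) * tripleBarrierSlope β C B s x + B * (β + (1 - 2 * logisticProfile s x) / 3) *
    (logisticProfile s x * (1 - logisticProfile s x)) / 3

theorem hasDerivAt_tripleBarrier_xx (β C B s : ℝ) {x : ℝ} (hx : 0 < x) :
    HasDerivAt (fun x => x ^ β / x * tripleBarrierSlope β C B s x)
      (x ^ β / x ^ 2 * tripleBarrierCurvature β C B s x) x := by
  have h1 := hasDerivAt_logisticProfile_right s hx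
  have h2 : HasDerivAt (tripleBarrierSlope β C B s)
      (B * (β + (1 - 2 * logisticProfile s x) / 3) *
        (logisticProfile s x * (1 - logisticProfile s x)) / (3 * x)) x := by
    refine ((((h1.const_mul B).const_add C).const_mul β).add
      (((h1.mul (h1.const_sub 1)).const_mul B).div_const 3)).congr_deriv ?_
    field_simp
    ring
  refine (((hasDerivAt_rpow_of_pos hx β).div (hasDerivAt_id x) hx.ne').mul h2).congr_deriv ?_
  unfold tripleBarrierCurvature
  simp only [Pi.div_apply, id]
  field_simp

theorem hasDerivAt_tripleBarrier_line (β C B s c : ℝ) {h : ℝ} (hh : 0 < h * c) :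
    HasDerivAt (fun h => tripleBarrier β C B s (h * c))
      ((h * c) ^ β / (h * c) * tripleBarrierSlope β C B s (h * c) * c) h := by
  refine ((hasDerivAt_tripleBarrier_x β C B s hh).comp h
    ((hasDerivAt_id h).mul_const c)).congr_deriv ?_
  ring

theorem hasDerivAt_tripleBarrier_line₂ (β C B s c : ℝ) {h : ℝ} (hh : 0 < h * c) :
    HasDerivAt (fun h => (h * c) ^ β / (h * c) * tripleBarrierSlope β C B s (h * c) * c)
      ((h * c) ^ β * tripleBarrierCurvature β C B s (h * c) * (1 / h ^ 2)) h := by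
  refine (((hasDerivAt_tripleBarrier_xx β C B s hh).comp h
    ((hasDerivAt_id h).mul_const c)).mul_const c).congr_deriv ?_
  have h1 : h ≠ 0 := left_ne_zero_of_mul hh.ne'
  have h2 : c ≠ 0 := right_ne_zero_of_mul hh.ne'
  field_simp

/-- The arithmetic-geometric mean inequality for `h⁻²`, `k⁻²`, `l⁻²`, where `p` is the geometric
mean of `h`, `k`, `l`. -/
theorem three_le_mul_sum_inv_sq {h k l p : ℝ} (hh : 0 < h) (hk : 0 < k) (hl : 0 < l)
    (hp : 0 < p) (hp3 : p ^ 3 = h * (k * l)) :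
    3 ≤ p ^ 2 * (1 / h ^ 2 + 1 / k ^ 2 + 1 / l ^ 2) := by
  by_contra! hlt
  set X := p ^ 2 / h ^ 2 with hX
  set Y := p ^ 2 / k ^ 2 with hY
  set Z := p ^ 2 / l ^ 2 with hZ
  have hX0 : 0 < X := by positivity
  have hY0 : 0 < Y := by positivity
  have hZ0 : 0 < Z := by positivity
  have hsum : X + Y + Z < 3 := by
    have : X + Y + Z = p ^ 2 * (1 / h ^ 2 + 1 / k ^ 2 + 1 / l ^ 2) := by
      rw [hX, hY, hZ]; ring
    rw [this]; exact hlt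
  have hprod : X * Y * Z = 1 := by
    have : X * Y * Z = (p ^ 3) ^ 2 / (h * (k * l)) ^ 2 := by
      rw [hX, hY, hZ]; field_simp
    rw [this, hp3]
    exact div_self (by positivity)
  have h1 : 27 * (X * Y * Z) ≤ (X + Y + Z) ^ 3 := by
    nlinarith [mul_nonneg hX0.le (sq_nonneg (Y - Z)), mul_nonneg hY0.le (sq_nonneg (X - Z)),
      mul_nonneg hZ0.le (sq_nonneg (X - Y)), mul_nonneg hX0.le (sq_nonneg (X - Y)),
      mul_nonneg hX0.le (sq_nonneg (X - Z)), mul_nonneg hY0.le (sq_nonneg (Y - Z)),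
      mul_nonneg hY0.le (sq_nonneg (X - Y)), mul_nonneg hZ0.le (sq_nonneg (Z - Y)),
      mul_nonneg hZ0.le (sq_nonneg (Z - X))]
  have h2 : (X + Y + Z) ^ 3 < 3 ^ 3 := pow_lt_pow_left₀ hsum (by positivity) (by norm_num)
  rw [hprod] at h1
  linarith

/-- The barrier is a supersolution.  The second derivative in `θ` of a third difference is
represented by the mean of the second derivatives in the three increments, which are negative of
order `C x^β (h⁻² + k⁻² + l⁻²)`.  This absorbs all terms of order `p^α`, where `p = x^{1/3}`.  The
source term `p e^{(1-α)s} = p^α y^{1-α}`, `y = e^s p`, may be larger; it is absorbed by the drift,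
because `y² κ (1 - κ)` grows linearly in `y` for `κ = y / (1 + y)`. -/
theorem tripleBarrier_supersolution {α A : ℝ} (hα₀ : 0 < α) (hα₁ : α < 1) (hA : 0 ≤ A)
    {β C B : ℝ} (hβ : β = (2 + α) / 3) (hC : C = 4080 * A / (1 - β)) (hB : B = 320 * A)
    (s : ℝ) {h k l : ℝ} (hh : h ∈ Ioo 0 Real.pi) (hk : k ∈ Ioo 0 Real.pi)
    (hl : l ∈ Ioo 0 Real.pi) {x p κ : ℝ} (hx : x = h * (k * l)) (hp : p = x ^ (1 / 3 : ℝ))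
    (hκ : κ = logisticProfile s x) :
    x ^ β * (B * (κ * (1 - κ) * (1 - 2 * κ))) +
      (2 - Real.exp (2 * s)) * (x ^ β * (B * (κ * (1 - κ)))) +
      1 / 3 * (x ^ β * tripleBarrierCurvature β C B s x * (1 / h ^ 2) +
        x ^ β * tripleBarrierCurvature β C B s x * (1 / k ^ 2) +
        x ^ β * tripleBarrierCurvature β C B s x * (1 / l ^ 2)) ≤
      -(80 * A * (p ^ α + p * Real.exp ((1 - α) * s))) := by
  obtain ⟨hh0, hhπ⟩ := hh
  obtain ⟨hk0, hkπ⟩ := hk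
  obtain ⟨hl0, hlπ⟩ := hl
  have hx0 : 0 < x := by rw [hx]; positivity
  have hp0 : 0 < p := by rw [hp]; positivity
  have hp3 : p ^ 3 = x := by
    rw [hp, ← Real.rpow_natCast, ← Real.rpow_mul hx0.le]; norm_num
  have hxβ : x ^ β = p ^ 2 * p ^ α := by
    rw [← hp3, ← Real.rpow_natCast p 3, ← Real.rpow_natCast p 2, ← Real.rpow_mul hp0.le,
      ← Real.rpow_add hp0, hβ]
    congr 1; push_cast; ring
  have hpπ : p ^ 2 ≤ 10 := by
    have h1 : p ≤ Real.pi := by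
      by_contra! hlt
      have h2 : Real.pi ^ 3 < p ^ 3 := pow_lt_pow_left₀ hlt Real.pi_pos.le (by norm_num)
      have h3 : h * (k * l) ≤ Real.pi * (Real.pi * Real.pi) := by gcongr
      rw [hp3, hx] at h2
      linarith
    nlinarith only [Real.pi_lt_d2, h1, hp0]
  have hS := three_le_mul_sum_inv_sq hh0 hk0 hl0 hp0 (hp3.trans hx)
  set S := 1 / h ^ 2 + 1 / k ^ 2 + 1 / l ^ 2 with hSdef
  set y := Real.exp s * p with hy
  have hy0 : 0 < y := by positivity
  have hκy : κ = y / (1 + y) := by rw [hκ, logisticProfile, ← hp]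
  have hκ0 : 0 ≤ κ := by rw [hκy]; positivity
  have hκ1 : κ ≤ 1 := by rw [hκy, div_le_one (by positivity)]; linarith
  have hpα : 0 < p ^ α := by positivity
  have hB0 : 0 ≤ B := by rw [hB]; positivity
  have hβ1 : 0 < 1 - β := by rw [hβ]; linarith
  have hβ2 : 2 / 3 ≤ β := by rw [hβ]; linarith
  have hC0 : 0 ≤ C := by rw [hC]; positivity
  have hCβ : 2720 * A ≤ (1 - β) * β * C := by
    have : (1 - β) * β * C = β * (4080 * A) := by rw [hC]; field_simp
    rw [this]; nlinarith only [hβ2, hA]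
  -- the curvature is bounded by a negative constant
  have hq : tripleBarrierCurvature β C B s x ≤ -(2720 * A) + B / 9 := by
    unfold tripleBarrierCurvature tripleBarrierSlope
    rw [← hκ]
    have k1 : κ * (1 - κ) ≤ 1 / 4 := by nlinarith only [sq_nonneg (κ - 1 / 2)]
    have k0 : 0 ≤ κ * (1 - κ) := mul_nonneg hκ0 (by linarith)
    have t1 : 0 ≤ (1 - β) * (β * (B * κ) + B * (κ * (1 - κ)) / 3) := by positivity
    have t2 : (β + (1 - 2 * κ) / 3) * (κ * (1 - κ)) ≤ 4 / 3 * (1 / 4) := by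
      calc _ ≤ 4 / 3 * (κ * (1 - κ)) := mul_le_mul_of_nonneg_right (by linarith) k0
        _ ≤ _ := by linarith
    have t3 := mul_le_mul_of_nonneg_left t2 hB0
    linarith
  have hq0 : -(2720 * A) + B / 9 ≤ 0 := by rw [hB]; linarith
  have hT : 1 / 3 * (x ^ β * tripleBarrierCurvature β C B s x * (1 / h ^ 2) +
        x ^ β * tripleBarrierCurvature β C B s x * (1 / k ^ 2) +
        x ^ β * tripleBarrierCurvature β C B s x * (1 / l ^ 2)) ≤
        p ^ α * (-(2720 * A) + B / 9) := by
    have e1 : 1 / 3 * (x ^ β * tripleBarrierCurvature β C B s x * (1 / h ^ 2) +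
        x ^ β * tripleBarrierCurvature β C B s x * (1 / k ^ 2) +
        x ^ β * tripleBarrierCurvature β C B s x * (1 / l ^ 2)) =
        p ^ α * (tripleBarrierCurvature β C B s x * (p ^ 2 * S / 3)) := by
      rw [hxβ, hSdef]; ring
    rw [e1]
    refine mul_le_mul_of_nonneg_left ?_ hpα.le
    have h3 : 1 ≤ p ^ 2 * S / 3 := by linarith
    nlinarith only [h3, hq, hq0]
  have hexp2 : Real.exp (2 * s) = Real.exp s ^ 2 := by
    rw [← Real.exp_nat_mul]; push_cast; rfl
  -- the drift term
  have hD : -(y ^ 2 * (κ * (1 - κ))) ≤ 1 / 4 - y / 4 := by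
    have e1 : y ^ 2 * (κ * (1 - κ)) = y ^ 3 / (1 + y) ^ 2 := by
      rw [hκy]; field_simp; ring
    have e2 : y / 4 - 1 / 4 ≤ y ^ 3 / (1 + y) ^ 2 := by
      rw [le_div_iff₀ (by positivity)]
      have := mul_nonneg hy0.le (sq_nonneg (y - 1))
      have := pow_pos hy0 3
      linarith
    rw [e1]; linarith
  have hdrift : x ^ β * (B * (κ * (1 - κ) * (1 - 2 * κ))) +
      (2 - Real.exp (2 * s)) * (x ^ β * (B * (κ * (1 - κ)))) ≤
      p ^ α * (B * (7.5 + 1 / 4 - y / 4)) := by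
    have e1 : x ^ β * (B * (κ * (1 - κ) * (1 - 2 * κ))) +
      (2 - Real.exp (2 * s)) * (x ^ β * (B * (κ * (1 - κ)))) =
      p ^ α * (B * (p ^ 2 * (κ * (1 - κ) * (3 - 2 * κ)) + -(y ^ 2 * (κ * (1 - κ))))) := by
      rw [hxβ, hexp2, hy]; ring
    rw [e1]
    refine mul_le_mul_of_nonneg_left (mul_le_mul_of_nonneg_left ?_ hB0) hpα.le
    have k1 : κ * (1 - κ) * (3 - 2 * κ) ≤ 3 / 4 := by
      have k0 : 0 ≤ κ * (1 - κ) := mul_nonneg hκ0 (by linarith)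
      have k2 : κ * (1 - κ) ≤ 1 / 4 := by nlinarith only [sq_nonneg (κ - 1 / 2)]
      nlinarith only [k0, k2, hκ0]
    have k3 : p ^ 2 * (κ * (1 - κ) * (3 - 2 * κ)) ≤ 10 * (3 / 4) :=
      mul_le_mul hpπ k1 (mul_nonneg (mul_nonneg hκ0 (by linarith)) (by linarith)) (by norm_num)
    linarith
  -- the right-hand side
  have hsrc : p * Real.exp ((1 - α) * s) ≤ p ^ α * (1 + y) := by
    have e1 : p * Real.exp ((1 - α) * s) = p ^ α * y ^ (1 - α) := by
      have e2 : p = p ^ α * p ^ (1 - α) := by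
        rw [← Real.rpow_add hp0]; simp
      have e3 : Real.exp ((1 - α) * s) = Real.exp s ^ (1 - α) := by
        rw [← Real.exp_mul]; ring_nf
      rw [hy, Real.mul_rpow (Real.exp_pos s).le hp0.le, e3]
      nth_rw 1 [e2]
      ring
    rw [e1]
    refine mul_le_mul_of_nonneg_left ?_ hpα.le
    rcases le_total y 1 with h1 | h1
    · have := Real.rpow_le_one hy0.le h1 (by linarith : 0 ≤ 1 - α)
      linarith
    · have := Real.rpow_le_rpow_of_exponent_le h1 (by linarith : 1 - α ≤ 1)
      rw [Real.rpow_one] at this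
      linarith
  have hsrc' : 80 * A * (p ^ α + p * Real.exp ((1 - α) * s)) ≤ p ^ α * (80 * A * (2 + y)) := by
    have := mul_le_mul_of_nonneg_left hsrc (by positivity : 0 ≤ 80 * A)
    linarith
  have hfin : p ^ α * (B * (7.5 + 1 / 4 - y / 4)) + p ^ α * (-(2720 * A) + B / 9) +
      p ^ α * (80 * A * (2 + y)) ≤ 0 := by
    rw [← mul_add, ← mul_add]
    refine mul_nonpos_of_nonneg_of_nonpos hpα.le ?_
    rw [hB]
    linarith
  linarith

end

noncomputable section

namespace PolarSolution

variable {α s₀ A : ℝ}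

/-- The right-hand side `g - f` of the equation without zeroth order term. -/
def G (u : PolarSolution α s₀ A) (s θ : ℝ) : ℝ := u.g s θ - u.f s θ

theorem abs_G_sub_le (hα₀ : 0 < α) (hα₁ : α < 1) (h₀ : Real.exp (-s₀) ≤ 3 / 2)
    (u : PolarSolution α s₀ A) {s : ℝ} (hs : s₀ < s) (θ : ℝ) {d : ℝ} (hd : 0 ≤ d) :
    |u.G s (θ + d) - u.G s θ| ≤ 10 * A * (d ^ α + d * Real.exp ((1 - α) * s)) := by
  have hA := u.A_nonneg
  have h1 := u.g_θ hs θ hd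
  have h2 := u.abs_f_sub_le h₀ hs.le θ hd
  have h3 := two_thirds_le_exp hα₀ hα₁ h₀ hs.le
  have h4 : 0 ≤ A * d ^ α := mul_nonneg hA (Real.rpow_nonneg hd _)
  have h5 : A * d * (2 / 3) ≤ A * d * Real.exp ((1 - α) * s) :=
    mul_le_mul_of_nonneg_left h3 (mul_nonneg hA hd)
  have e : u.G s (θ + d) - u.G s θ = (u.g s (θ + d) - u.g s θ) - (u.f s (θ + d) - u.f s θ) := by
    simp only [G]; ring
  rw [e]
  refine (abs_sub _ _).trans ?_
  linarith

theorem abs_mixedDiff₂_le {w : ℝ → ℝ} {K : ℝ} (hw : ∀ x, |w x| ≤ K) (k l x : ℝ) :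
    |mixedDiff₂ w k l x| ≤ 4 * K := by
  have h1 := abs_le.mp (hw (x + k + l))
  have h2 := abs_le.mp (hw (x + k - l))
  have h3 := abs_le.mp (hw (x - k + l))
  have h4 := abs_le.mp (hw (x - k - l))
  unfold mixedDiff₂
  exact abs_le.mpr ⟨by linarith, by linarith⟩

/-- The third difference of the right-hand side is controlled by any one of the three increments. -/
theorem neg_le_mixedDiff₃_G (hα₀ : 0 < α) (hα₁ : α < 1) (h₀ : Real.exp (-s₀) ≤ 3 / 2)
    (u : PolarSolution α s₀ A) {s : ℝ} (hs : s₀ < s) (θ : ℝ) {h : ℝ} (hh : 0 ≤ h) (k l : ℝ) :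
    -(80 * A * (h ^ α + h * Real.exp ((1 - α) * s))) ≤ mixedDiff₃ (u.G s) θ h k l := by
  have hA := u.A_nonneg
  have e : mixedDiff₃ (u.G s) θ h k l =
      mixedDiff₂ (fun x => u.G s (x + h) - u.G s (x - h)) k l θ := by
    rw [mixedDiff₃, mixedDiff₂, mixedDiff₂, mixedDiff₂]
    rw [show θ + h + k + l = θ + k + l + h by ring, show θ + h + k - l = θ + k - l + h by ring,
      show θ + h - k + l = θ - k + l + h by ring, show θ + h - k - l = θ - k - l + h by ring,
      show θ - h + k + l = θ + k + l - h by ring, show θ - h + k - l = θ + k - l - h by ring,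
      show θ - h - k + l = θ - k + l - h by ring, show θ - h - k - l = θ - k - l - h by ring]
    ring
  rw [e]
  have key : ∀ x, |u.G s (x + h) - u.G s (x - h)| ≤
      20 * A * (h ^ α + h * Real.exp ((1 - α) * s)) := by
    intro x
    have h1 := u.abs_G_sub_le hα₀ hα₁ h₀ hs (x - h) (d := 2 * h) (by linarith)
    rw [show x - h + 2 * h = x + h by ring, Real.mul_rpow two_pos.le hh] at h1
    have h2 : (2 : ℝ) ^ α ≤ 2 := by
      simpa using Real.rpow_le_rpow_of_exponent_le one_le_two hα₁.le
    have h3 : (2 : ℝ) ^ α * h ^ α ≤ 2 * h ^ α :=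
      mul_le_mul_of_nonneg_right h2 (Real.rpow_nonneg hh _)
    have h4 := mul_le_mul_of_nonneg_left h3 hA
    linarith
  have := (abs_le.mp (abs_mixedDiff₂_le key k l θ)).1
  linarith

theorem hasDerivAt_mixedDiff₃_s {F F' : ℝ → ℝ → ℝ} {s : ℝ}
    (hF : ∀ θ, HasDerivAt (fun t => F t θ) (F' s θ) s) (θ h k l : ℝ) :
    HasDerivAt (fun t => mixedDiff₃ (F t) θ h k l) (mixedDiff₃ (F' s) θ h k l) s := by
  simp only [mixedDiff₃, mixedDiff₂]
  exact ((((hF _).sub (hF _)).sub (hF _)).add (hF _)).sub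
    ((((hF _).sub (hF _)).sub (hF _)).add (hF _))

/-- Third differences vanish when one increment is `π`, by periodicity. -/
theorem mixedDiff₃_f_pi (u : PolarSolution α s₀ A) {s : ℝ} (hs : s₀ ≤ s) (θ k l : ℝ) :
    mixedDiff₃ (u.f s) θ Real.pi k l = 0 := by
  have e : ∀ c d, u.f s (θ + Real.pi + c + d) = u.f s (θ - Real.pi + c + d) := by
    intro c d
    have := u.f_add_pi hs (θ + c + d)
    rw [show θ + Real.pi + c + d = θ + c + d + Real.pi by ring, this]
    congr 1; ring
  simp only [mixedDiff₃, mixedDiff₂, sub_eq_add_neg] at e ⊢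
  simp only [e]
  ring

theorem mixedDiff₃_zero (w : ℝ → ℝ) (θ k l : ℝ) : mixedDiff₃ w θ 0 k l = 0 := by
  simp [mixedDiff₃]

/-- At an interior maximum in one of the increments, the second derivative of the third difference
is controlled by that of the barrier. -/
theorem mixedDiff₃_fθθ_le (u : PolarSolution α s₀ A) {s : ℝ} (hs : s₀ < s)
    {θ h k l β C B ε c : ℝ} (hh : h ∈ Ioo 0 Real.pi) (hkl : 0 < k * l)
    (hmax : ∀ t ∈ Icc 0 Real.pi, mixedDiff₃ (u.f s) θ t k l -
      (tripleBarrier β C B s (t * (k * l)) + ε * (t * (Real.pi - t)) + c) ≤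
      mixedDiff₃ (u.f s) θ h k l -
      (tripleBarrier β C B s (h * (k * l)) + ε * (h * (Real.pi - h)) + c)) :
    mixedDiff₃ (u.fθθ s) θ h k l ≤
      (h * (k * l)) ^ β * tripleBarrierCurvature β C B s (h * (k * l)) * (1 / h ^ 2) - 2 * ε := by
  have hm : IsLocalMax (fun t => mixedDiff₃ (u.f s) θ t k l -
      (tripleBarrier β C B s (t * (k * l)) + ε * (t * (Real.pi - t)) + c)) h := by
    filter_upwards [Ioo_mem_nhds hh.1 hh.2] with t ht
    exact hmax t ⟨ht.1.le, ht.2.le⟩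
  have dq : ∀ t : ℝ, HasDerivAt (fun t => ε * (t * (Real.pi - t))) (ε * (Real.pi - 2 * t)) t := by
    intro t
    refine (((hasDerivAt_id t).mul ((hasDerivAt_id t).const_sub Real.pi)).const_mul
      ε).congr_deriv ?_
    simp only [id]
    ring
  have dq2 : HasDerivAt (fun t => ε * (Real.pi - 2 * t)) (ε * (-(2 * 1))) h :=
    (((hasDerivAt_id h).const_mul 2).const_sub Real.pi).const_mul ε
  have h1 := hasDerivAt_mixedDiff₂ (u.hasDerivAt_θ hs) k l
  have h2 := hasDerivAt_mixedDiff₂ (u.hasDerivAt_θθ hs) k l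
  have key := second_deriv_nonpos_of_isLocalMax
    (by filter_upwards [Ioo_mem_nhds hh.1 hh.2] with t ht
        exact (hasDerivAt_symm_sub (h1 (θ + t)) (h1 (θ - t))).sub
          (((hasDerivAt_tripleBarrier_line β C B s (k * l) (mul_pos ht.1 hkl)).add
            (dq t)).add_const c))
    ((hasDerivAt_symm_add (h2 (θ + h)) (h2 (θ - h))).sub
      ((hasDerivAt_tripleBarrier_line₂ β C B s (k * l) (mul_pos hh.1 hkl)).add dq2)) hm
  simp only [mixedDiff₃]
  linarith

theorem continuousOn_mixedDiff₃ (u : PolarSolution α s₀ A) (θ : ℝ) :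
    ContinuousOn (fun p : ℝ × ℝ × ℝ × ℝ => mixedDiff₃ (u.f p.1) θ p.2.1 p.2.2.1 p.2.2.2)
      (Ici s₀ ×ˢ univ) := by
  have e : ∀ F : ℝ × ℝ × ℝ × ℝ → ℝ, Continuous F →
      ContinuousOn (fun p : ℝ × ℝ × ℝ × ℝ => u.f p.1 (F p)) (Ici s₀ ×ˢ univ) := fun F hF =>
    u.continuousOn_f.comp (f := fun p : ℝ × ℝ × ℝ × ℝ => (p.1, F p)) (by fun_prop)
      fun p hp => ⟨hp.1, mem_univ _⟩
  simp only [mixedDiff₃, mixedDiff₂]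
  refine ContinuousOn.sub (ContinuousOn.add (ContinuousOn.sub (ContinuousOn.sub ?_ ?_) ?_) ?_)
    (ContinuousOn.add (ContinuousOn.sub (ContinuousOn.sub ?_ ?_) ?_) ?_) <;>
  exact e _ (by fun_prop)

theorem continuousOn_tripleBarrier {β : ℝ} (hβ : 0 ≤ β) (C B : ℝ) :
    ContinuousOn (fun p : ℝ × ℝ × ℝ × ℝ => tripleBarrier β C B p.1 (p.2.1 * (p.2.2.1 * p.2.2.2)))
      {p | 0 ≤ p.2.1 * (p.2.2.1 * p.2.2.2)} := by
  have hx : Continuous fun p : ℝ × ℝ × ℝ × ℝ => p.2.1 * (p.2.2.1 * p.2.2.2) := by fun_prop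
  have h1 : Continuous fun p : ℝ × ℝ × ℝ × ℝ =>
      (p.2.1 * (p.2.2.1 * p.2.2.2)) ^ β := (Real.continuous_rpow_const hβ).comp hx
  have h2 : Continuous fun p : ℝ × ℝ × ℝ × ℝ => Real.exp p.1 *
      (p.2.1 * (p.2.2.1 * p.2.2.2)) ^ (1 / 3 : ℝ) :=
    (Real.continuous_exp.comp continuous_fst).mul
      ((Real.continuous_rpow_const (by norm_num)).comp hx)
  unfold tripleBarrier logisticProfile
  refine h1.continuousOn.mul (continuousOn_const.add (continuousOn_const.mul
    (h2.continuousOn.div (continuous_const.add h2).continuousOn fun p hp => ?_)))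
  have hp' : (0 : ℝ) ≤ p.2.1 * (p.2.2.1 * p.2.2.2) := hp
  have : 0 ≤ Real.exp p.1 * (p.2.1 * (p.2.2.1 * p.2.2.2)) ^ (1 / 3 : ℝ) := by positivity
  positivity

/-- The constant in the third difference bound. -/
def thirdDiffConst (α : ℝ) : ℝ := 4080 / (1 - (2 + α) / 3) + 320

/-- Comparison of the third difference, as a function of `s` and the three increments, with the
barrier.  The equation for the third difference contains `f_θθ`, which at an interior maximum is
estimated by the second derivatives of the barrier in each of the three increments; the mean of the
three estimates is used.  The terms with `ε` make the inequalities strict and enforce the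
comparison at infinity. -/
theorem mixedDiff₃_le_add (hα₀ : 0 < α) (hα₁ : α < 1) (h₀ : Real.exp (-s₀) ≤ 3 / 2)
    (u : PolarSolution α s₀ A) (θ : ℝ) {ε : ℝ} (hε : 0 < ε) {s : ℝ} (hs : s₀ ≤ s)
    {h k l : ℝ} (hh : h ∈ Icc 0 Real.pi) (hk : k ∈ Icc 0 Real.pi) (hl : l ∈ Icc 0 Real.pi)
    {β C B : ℝ} (hβ : β = (2 + α) / 3) (hC : C = 4080 * A / (1 - β)) (hB : B = 320 * A) :
    mixedDiff₃ (u.f s) θ h k l ≤ tripleBarrier β C B s (h * (k * l)) + (ε * (s - s₀) +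
      2 * ε * (h * (Real.pi - h) + k * (Real.pi - k) + l * (Real.pi - l))) := by
  have hA := u.A_nonneg
  have hβ1 : 0 < 1 - β := by rw [hβ]; linarith
  have hβ0 : 0 ≤ β := by rw [hβ]; linarith
  have hC0 : 0 ≤ C := by rw [hC]; positivity
  have hB0 : 0 ≤ B := by rw [hB]; positivity
  set Q : Set (ℝ × ℝ × ℝ) := Icc 0 Real.pi ×ˢ (Icc 0 Real.pi ×ˢ Icc 0 Real.pi) with hQ
  set V : ℝ → ℝ × ℝ × ℝ → ℝ := fun s p => mixedDiff₃ (u.f s) θ p.1 p.2.1 p.2.2 -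
    (tripleBarrier β C B s (p.1 * (p.2.1 * p.2.2)) + (ε * (s - s₀) +
      2 * ε * (p.1 * (Real.pi - p.1) + p.2.1 * (Real.pi - p.2.1) + p.2.2 * (Real.pi - p.2.2))))
    with hV
  have hqn : ∀ t ∈ Icc 0 Real.pi, 0 ≤ t * (Real.pi - t) := fun t ht =>
    mul_nonneg ht.1 (sub_nonneg.mpr ht.2)
  have hxn : ∀ p ∈ Q, 0 ≤ p.1 * (p.2.1 * p.2.2) := fun p hp =>
    mul_nonneg hp.1.1 (mul_nonneg hp.2.1.1 hp.2.2.1)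
  have hΨ : ∀ s ≥ s₀, ∀ p ∈ Q, ε * (s - s₀) ≤
      tripleBarrier β C B s (p.1 * (p.2.1 * p.2.2)) + (ε * (s - s₀) +
      2 * ε * (p.1 * (Real.pi - p.1) + p.2.1 * (Real.pi - p.2.1) +
        p.2.2 * (Real.pi - p.2.2))) := by
    intro s _ p hp
    have h1 := hxn p hp
    have h2 : 0 ≤ tripleBarrier β C B s (p.1 * (p.2.1 * p.2.2)) := by
      have := (logisticProfile_mem (s := s) h1).1
      unfold tripleBarrier
      positivity
    have h3 := hqn _ hp.1
    have h4 := hqn _ hp.2.1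
    have h5 := hqn _ hp.2.2
    have : 0 ≤ 2 * ε * (p.1 * (Real.pi - p.1) + p.2.1 * (Real.pi - p.2.1) +
        p.2.2 * (Real.pi - p.2.2)) := by positivity
    linarith
  have key := nonpos_of_no_positive_max (K := Q) (u := V) (s₀ := s₀)
    (isCompact_Icc.prod (isCompact_Icc.prod isCompact_Icc)) ?_ ?_ ?_ ?_ s hs (h, k, l) ⟨hh, hk, hl⟩
  · simp only [hV] at key
    linarith
  · refine ContinuousOn.sub ((u.continuousOn_mixedDiff₃ θ).mono
      (prod_mono subset_rfl (subset_univ _))) (ContinuousOn.add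
      ((continuousOn_tripleBarrier hβ0 C B).mono fun p hp => hxn p.2 hp.2) ?_)
    fun_prop
  · intro p hp
    have := hΨ s₀ le_rfl p hp
    simp only [hV, mixedDiff₃, mixedDiff₂, u.f_init]
    linarith
  · refine ⟨s₀ + 20 * A / ε, fun s hs p hp => ?_⟩
    have hs0 : s₀ ≤ s := le_trans (by have : 0 ≤ 20 * A / ε := by positivity
                                      linarith) hs
    have h1 : 20 * A ≤ ε * (s - s₀) := by
      have : 20 * A / ε ≤ s - s₀ := by linarith
      rw [div_le_iff₀ hε] at this
      linarith
    have h2 := abs_le.mp (abs_mixedDiff₂_le (u.abs_f_le h₀ hs0) p.2.1 p.2.2 (θ + p.1))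
    have h3 := abs_le.mp (abs_mixedDiff₂_le (u.abs_f_le h₀ hs0) p.2.1 p.2.2 (θ - p.1))
    have := hΨ s hs0 p hp
    simp only [hV]
    rw [mixedDiff₃]
    linarith
  · rintro s hs ⟨h, k, l⟩ ⟨hh, hk, hl⟩ hpos hmax
    simp only at hh hk hl
    have hΨs := hΨ s hs.le (h, k, l) ⟨hh, hk, hl⟩
    have hTpos : 0 < mixedDiff₃ (u.f s) θ h k l := by
      have : 0 ≤ ε * (s - s₀) := mul_nonneg hε.le (by linarith)
      simp only [hV] at hpos hΨs
      linarith
    have hint : ∀ t ∈ Icc 0 Real.pi, ∀ a b, 0 < mixedDiff₃ (u.f s) θ t a b →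
        t ∈ Ioo 0 Real.pi := by
      intro t ht a b hp
      refine ⟨lt_of_le_of_ne ht.1 ?_, lt_of_le_of_ne ht.2 ?_⟩
      · rintro rfl; exact hp.ne' (mixedDiff₃_zero _ _ _ _)
      · rintro rfl; exact hp.ne' (u.mixedDiff₃_f_pi hs.le _ _ _)
    have hh' := hint h hh k l hTpos
    have hk' := hint k hk h l (by rwa [mixedDiff₃_swap₁₂])
    have hl' := hint l hl h k (by rwa [← mixedDiff₃_swap₁₃])
    have i1 := u.mixedDiff₃_fθθ_le hs (θ := θ) (β := β) (C := C) (B := B) (ε := 2 * ε)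
      (c := ε * (s - s₀) + 2 * ε * (k * (Real.pi - k) + l * (Real.pi - l))) hh'
      (mul_pos hk'.1 hl'.1) (fun t ht => by
        have := hmax s hs.le (t, k, l) ⟨ht, hk, hl⟩
        simp only [hV] at this
        linarith)
    have i2 := u.mixedDiff₃_fθθ_le hs (θ := θ) (β := β) (C := C) (B := B) (ε := 2 * ε)
      (c := ε * (s - s₀) + 2 * ε * (h * (Real.pi - h) + l * (Real.pi - l))) hk'
      (mul_pos hh'.1 hl'.1) (fun t ht => by
        have := hmax s hs.le (h, t, l) ⟨hh, ht, hl⟩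
        simp only [hV] at this
        rw [mixedDiff₃_swap₁₂ _ _ t h l, mixedDiff₃_swap₁₂ _ _ k h l, mul_left_comm t,
          mul_left_comm k]
        linarith)
    have i3 := u.mixedDiff₃_fθθ_le hs (θ := θ) (β := β) (C := C) (B := B) (ε := 2 * ε)
      (c := ε * (s - s₀) + 2 * ε * (h * (Real.pi - h) + k * (Real.pi - k))) hl'
      (mul_pos hh'.1 hk'.1) (fun t ht => by
        have := hmax s hs.le (h, k, t) ⟨hh, hk, ht⟩
        simp only [hV] at this
        rw [← mixedDiff₃_swap₁₃ _ _ h k t, ← mixedDiff₃_swap₁₃ _ _ h k l,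
          show t * (h * k) = h * (k * t) by ring, show l * (h * k) = h * (k * l) by ring]
        linarith)
    rw [mixedDiff₃_swap₁₂ _ _ k h l, mul_left_comm k] at i2
    rw [← mixedDiff₃_swap₁₃ _ _ h k l, show l * (h * k) = h * (k * l) by ring] at i3
    have hx0 : 0 < h * (k * l) := mul_pos hh'.1 (mul_pos hk'.1 hl'.1)
    have ms : IsLocalMax (fun t => V t (h, k, l)) s := by
      filter_upwards [Ioi_mem_nhds hs] with t ht
      exact hmax t (le_of_lt ht) (h, k, l) ⟨hh, hk, hl⟩
    have dV : ∀ t > s₀, HasDerivAt (fun t => V t (h, k, l))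
        (mixedDiff₃ (u.fs t) θ h k l - ((h * (k * l)) ^ β * (B * (logisticProfile t (h * (k * l)) *
          (1 - logisticProfile t (h * (k * l))))) + ε * 1)) t := fun t ht =>
      (hasDerivAt_mixedDiff₃_s (u.hasDerivAt_s ht) θ h k l).sub
        ((hasDerivAt_tripleBarrier_s β C B t hx0).add
          ((((hasDerivAt_id t).sub_const s₀).const_mul ε).add_const _))
    have j1 := ms.hasDerivAt_eq_zero (dV s hs)
    have j2 := second_deriv_nonpos_of_isLocalMax
      (by filter_upwards [Ioi_mem_nhds hs] with t ht using dV t ht)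
      ((hasDerivAt_mixedDiff₃_s (u.hasDerivAt_ss hs) θ h k l).sub
        ((hasDerivAt_tripleBarrier_ss β B s hx0).add_const (ε * 1))) ms
    have j3 := tripleBarrier_supersolution hα₀ hα₁ hA hβ hC hB s hh' hk' hl' rfl rfl rfl
    have j4 : mixedDiff₃ (u.fss s) θ h k l + (2 - Real.exp (2 * s)) *
        mixedDiff₃ (u.fs s) θ h k l + mixedDiff₃ (u.fθθ s) θ h k l =
        mixedDiff₃ (u.G s) θ h k l := by
      have e : u.G s = fun θ => u.fss s θ + (2 - Real.exp (2 * s)) * u.fs s θ + u.fθθ s θ := by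
        funext t
        have := u.eq hs t
        simp only [G]
        linarith
      rw [e]
      simp only [mixedDiff₃, mixedDiff₂]
      ring
    -- the smallest of the three increments is at most the cube root of the product
    have j5 : -(80 * A * (((h * (k * l)) ^ (1 / 3 : ℝ)) ^ α + (h * (k * l)) ^ (1 / 3 : ℝ) *
        Real.exp ((1 - α) * s))) ≤ mixedDiff₃ (u.G s) θ h k l := by
      have hmono : ∀ t, 0 < t → t ^ 3 ≤ h * (k * l) →
          -(80 * A * (((h * (k * l)) ^ (1 / 3 : ℝ)) ^ α + (h * (k * l)) ^ (1 / 3 : ℝ) *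
            Real.exp ((1 - α) * s))) ≤ -(80 * A * (t ^ α + t * Real.exp ((1 - α) * s))) := by
        intro t ht htx
        have h1 : t ≤ (h * (k * l)) ^ (1 / 3 : ℝ) := by
          have := Real.rpow_le_rpow (by positivity) htx (by norm_num : (0 : ℝ) ≤ 1 / 3)
          rwa [← Real.rpow_natCast, ← Real.rpow_mul ht.le, show ((3 : ℕ) : ℝ) * (1 / 3) = 1 by
            norm_num, Real.rpow_one] at this
        gcongr
      have hh0 := hh'.1
      have hk0 := hk'.1
      have hl0 := hl'.1
      rcases le_total h k with a | a
      · rcases le_total h l with b | b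
        · refine (hmono h hh0 ?_).trans (u.neg_le_mixedDiff₃_G hα₀ hα₁ h₀ hs θ hh0.le k l)
          rw [show h ^ 3 = h * (h * h) by ring]; gcongr
        · rw [mixedDiff₃_swap₁₃]
          refine (hmono l hl0 ?_).trans (u.neg_le_mixedDiff₃_G hα₀ hα₁ h₀ hs θ hl0.le h k)
          rw [show l ^ 3 = l * (l * l) by ring]; gcongr; exact b.trans a
      · rcases le_total k l with b | b
        · rw [mixedDiff₃_swap₁₂]
          refine (hmono k hk0 ?_).trans (u.neg_le_mixedDiff₃_G hα₀ hα₁ h₀ hs θ hk0.le h l)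
          rw [show k ^ 3 = k * (k * k) by ring]; gcongr
        · rw [mixedDiff₃_swap₁₃]
          refine (hmono l hl0 ?_).trans (u.neg_le_mixedDiff₃_G hα₀ hα₁ h₀ hs θ hl0.le h k)
          rw [show l ^ 3 = l * (l * l) by ring]; gcongr; exact b.trans a
    have j6 : (2 - Real.exp (2 * s)) * mixedDiff₃ (u.fs s) θ h k l =
        (2 - Real.exp (2 * s)) * ((h * (k * l)) ^ β * (B * (logisticProfile s (h * (k * l)) *
          (1 - logisticProfile s (h * (k * l)))))) + (2 - Real.exp (2 * s)) * ε := by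
      rw [← mul_add]; congr 1; linarith
    have j7 := mul_pos hε (Real.exp_pos (2 * s))
    linarith

/-- The third difference bound, the core estimate: `f(s, ·)` is `C^{2,α}` uniformly in `s`. -/
theorem abs_third_difference_le (hα₀ : 0 < α) (hα₁ : α < 1) (h₀ : Real.exp (-s₀) ≤ 3 / 2)
    (u : PolarSolution α s₀ A) {s : ℝ} (hs : s₀ ≤ s) (θ : ℝ) {h : ℝ} (hh : h ∈ Icc 0 Real.pi) :
    |mixedDiff₃ (u.f s) θ h h h| ≤ thirdDiffConst α * A * h ^ (2 + α) := by
  have main : ∀ u : PolarSolution α s₀ A, mixedDiff₃ (u.f s) θ h h h ≤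
      thirdDiffConst α * A * h ^ (2 + α) := by
    intro u
    have hA := u.A_nonneg
    have hx : 0 ≤ h * (h * h) := mul_nonneg hh.1 (mul_nonneg hh.1 hh.1)
    have e1 : (h * (h * h)) ^ ((2 + α) / 3) = h ^ (2 + α) := by
      rw [show h * (h * h) = h ^ (3 : ℕ) by ring, ← Real.rpow_natCast, ← Real.rpow_mul hh.1]
      congr 1; push_cast; ring
    have h1 : tripleBarrier ((2 + α) / 3) (4080 * A / (1 - (2 + α) / 3)) (320 * A) s
        (h * (h * h)) ≤ thirdDiffConst α * A * h ^ (2 + α) := by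
      have := (logisticProfile_mem (s := s) hx).2
      rw [tripleBarrier, e1, thirdDiffConst]
      have e2 : (4080 / (1 - (2 + α) / 3) + 320) * A * h ^ (2 + α) =
        h ^ (2 + α) * (4080 * A / (1 - (2 + α) / 3) + 320 * A * 1) := by ring
      rw [e2]
      have := Real.rpow_nonneg hh.1 (2 + α)
      gcongr
    refine le_trans ?_ h1
    refine le_of_forall_pos_le_add fun δ hδ => ?_
    have hw : 0 ≤ h * (Real.pi - h) := mul_nonneg hh.1 (sub_nonneg.mpr hh.2)
    have hss : 0 ≤ s - s₀ := by linarith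
    have hden : 0 < (s - s₀) + 6 * (h * (Real.pi - h)) + 1 := by positivity
    have key := u.mixedDiff₃_le_add hα₀ hα₁ h₀ θ
      (ε := δ / ((s - s₀) + 6 * (h * (Real.pi - h)) + 1)) (by positivity) hs hh hh hh rfl rfl rfl
    have h5 : δ / ((s - s₀) + 6 * (h * (Real.pi - h)) + 1) *
      ((s - s₀) + 6 * (h * (Real.pi - h)) + 1) = δ := div_mul_cancel₀ _ hden.ne'
    have h6 : 0 ≤ δ / ((s - s₀) + 6 * (h * (Real.pi - h)) + 1) := by positivity
    nlinarith
  refine abs_le'.mpr ⟨main u, ?_⟩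
  have := main u.neg
  have e : mixedDiff₃ (u.neg.f s) θ h h h = -mixedDiff₃ (u.f s) θ h h h := by
    simp only [mixedDiff₃, mixedDiff₂, neg]; ring
  rwa [e] at this

end PolarSolution

end

noncomputable section

namespace PolarSolution

variable {α s₀ A : ℝ}

/-! ### Second derivatives in the angle -/

/-- An increment of second differences is a third difference with three equal increments. -/
theorem abs_secondDiff_add_sub_le (hα₀ : 0 < α) (hα₁ : α < 1) (h₀ : Real.exp (-s₀) ≤ 3 / 2)
    (u : PolarSolution α s₀ A) {s : ℝ} (hs : s₀ ≤ s) (θ : ℝ) {h : ℝ} (hh : 0 < h) (hh' : h ≤ 1) :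
    |secondDiff (u.f s) h (θ + h) - secondDiff (u.f s) h θ| ≤
      thirdDiffConst α * A * h ^ (2 + α) := by
  have hπ := Real.pi_gt_three
  have key := u.abs_third_difference_le hα₀ hα₁ h₀ hs (θ + h / 2) (h := h / 2)
    ⟨by linarith, by linarith⟩
  have e : secondDiff (u.f s) h (θ + h) - secondDiff (u.f s) h θ =
      mixedDiff₃ (u.f s) (θ + h / 2) (h / 2) (h / 2) (h / 2) := by
    simp only [secondDiff, mixedDiff₃, mixedDiff₂]
    rw [show θ + h / 2 + h / 2 + h / 2 + h / 2 = θ + h + h by ring,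
      show θ + h / 2 + h / 2 + h / 2 - h / 2 = θ + h by ring,
      show θ + h / 2 + h / 2 - h / 2 + h / 2 = θ + h by ring,
      show θ + h / 2 + h / 2 - h / 2 - h / 2 = θ by ring,
      show θ + h / 2 - h / 2 + h / 2 + h / 2 = θ + h by ring,
      show θ + h / 2 - h / 2 + h / 2 - h / 2 = θ by ring,
      show θ + h / 2 - h / 2 - h / 2 + h / 2 = θ by ring,
      show θ + h / 2 - h / 2 - h / 2 - h / 2 = θ - h by ring,
      show θ + h - h = θ by ring]
    ring
  rw [e]
  have hc : 0 ≤ thirdDiffConst α * A := by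
    have hA := u.A_nonneg
    have : 0 < 1 - (2 + α) / 3 := by linarith
    unfold thirdDiffConst
    positivity
  exact key.trans (mul_le_mul_of_nonneg_left
    (Real.rpow_le_rpow (by linarith) (by linarith) (by linarith)) hc)

/-- Consequences of the third difference bound: `f_θθ` is bounded and `α`-Hölder in `θ`, and is
approximated by second difference quotients at the rate `h^α`, uniformly in `s`. -/
theorem exists_fθθ_bounds (hα₀ : 0 < α) (hα₁ : α < 1) : ∃ C, 1 ≤ C ∧ ∀ {s₀ A : ℝ},
    Real.exp (-s₀) ≤ 3 / 2 → ∀ (u : PolarSolution α s₀ A) {s : ℝ}, s₀ < s → ∀ θ : ℝ,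
      |u.fθθ s θ| ≤ C * A ∧
      (∀ d, 0 ≤ d → |u.fθθ s (θ + d) - u.fθθ s θ| ≤ C * A * d ^ α) ∧
      ∀ h, 0 < h → h ≤ 1 → |secondDiff (u.f s) h θ / h ^ 2 - u.fθθ s θ| ≤ C * A * h ^ α := by
  set T := thirdDiffConst α with hT
  have hT0 : 0 ≤ T := by
    have : 0 < 1 - (2 + α) / 3 := by linarith
    rw [hT]; unfold thirdDiffConst
    positivity
  have ht1 : (2 : ℝ) ^ (-α) < 1 := Real.rpow_lt_one_of_one_lt_of_neg one_lt_two (by linarith)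
  set c := T / (1 - 2 ^ (-α)) with hc
  have hc0 : 0 ≤ c := div_nonneg hT0 (by linarith)
  refine ⟨20 + 4 * c + T, by linarith, fun {s₀ A} h₀ u {s} hs => ?_⟩
  have hA := u.A_nonneg
  have h1 : ∀ θ h, 0 < h → h ≤ 1 →
      |secondDiff (u.f s) h θ / h ^ 2 - u.fθθ s θ| ≤ c * A * h ^ α := by
    intro θ h hh hh'
    have := abs_secondDiff_div_sub_le hα₀ (u.hasDerivAt_θ hs) (u.hasDerivAt_θθ hs)
      (u.continuous_fθθ hs) (fun x h => u.abs_secondDiff_add_sub_le hα₀ hα₁ h₀ hs.le x) (x := θ)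
      hh hh'
    refine this.trans (le_of_eq ?_)
    rw [hc]; ring
  have h2 : ∀ θ, |u.fθθ s θ| ≤ (10 + c) * A := by
    intro θ
    have a := h1 θ 1 one_pos le_rfl
    simp only [one_pow, div_one, Real.one_rpow, mul_one] at a
    have b : |secondDiff (u.f s) 1 θ| ≤ 10 * A := by
      have b1 := abs_le.mp (u.abs_f_le h₀ hs.le (θ + 1))
      have b2 := abs_le.mp (u.abs_f_le h₀ hs.le θ)
      have b3 := abs_le.mp (u.abs_f_le h₀ hs.le (θ - 1))
      unfold secondDiff
      exact abs_le.mpr ⟨by linarith, by linarith⟩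
    have a' := abs_le.mp a
    have b' := abs_le.mp b
    exact abs_le.mpr ⟨by linarith, by linarith⟩
  have hcA : 0 ≤ c * A := mul_nonneg hc0 hA
  have hTA : 0 ≤ T * A := mul_nonneg hT0 hA
  refine fun θ => ⟨(h2 θ).trans (by nlinarith), fun d hd => ?_, fun h hh hh' =>
    (h1 θ h hh hh').trans ?_⟩
  · rcases hd.eq_or_lt with rfl | hd
    · simp [Real.zero_rpow hα₀.ne']
    rcases le_total d 1 with h | h
    · have a := h1 θ d hd h
      have b := h1 (θ + d) d hd h
      have e := u.abs_secondDiff_add_sub_le hα₀ hα₁ h₀ hs.le θ hd h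
      have hd2 : 0 < d ^ 2 := pow_pos hd 2
      have e2 : d ^ (2 + α) = d ^ 2 * d ^ α := by rw [Real.rpow_add hd]; norm_num
      have e3 : |secondDiff (u.f s) d (θ + d) / d ^ 2 - secondDiff (u.f s) d θ / d ^ 2| ≤
          T * A * d ^ α := by
        rw [← sub_div, abs_div, abs_of_pos hd2, div_le_iff₀ hd2]
        refine e.trans (le_of_eq ?_)
        rw [e2]; ring
      have a' := abs_le.mp a
      have b' := abs_le.mp b
      have e' := abs_le.mp e3
      have p := Real.rpow_nonneg hd.le α
      have p1 := mul_nonneg hcA p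
      have p2 := mul_nonneg hA p
      exact abs_le.mpr ⟨by nlinarith, by nlinarith⟩
    · have a := abs_le.mp (h2 θ)
      have b := abs_le.mp (h2 (θ + d))
      have p : 1 ≤ d ^ α := Real.one_le_rpow h hα₀.le
      have h3 : 2 * ((10 + c) * A) ≤ (20 + 4 * c + T) * A * d ^ α := by
        calc _ ≤ (20 + 4 * c + T) * A * 1 := by nlinarith
          _ ≤ _ := by gcongr
      exact abs_le.mpr ⟨by linarith, by linarith⟩
  · have p := Real.rpow_nonneg hh.le α
    gcongr
    linarith

end PolarSolution

/-! ### Functions that are Hölder at scales up to `e^{-s}` -/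

/-- `q` is bounded by `C` on `s > s₀` and `α`-Hölder with constant `C` in both variables at scales
up to `e^{-s}`, which correspond to unit distances in the plane.  In the angle the bound is stated
for all increments, in the form that chaining gives. -/
structure ShortHolder (α s₀ C : ℝ) (q : ℝ → ℝ → ℝ) : Prop where
  bdd : ∀ {s}, s₀ < s → ∀ θ, |q s θ| ≤ C
  angle : ∀ {s}, s₀ < s → ∀ θ {d}, 0 ≤ d →
    |q s (θ + d) - q s θ| ≤ C * (d ^ α + d * Real.exp ((1 - α) * s))
  radial : ∀ {s}, s₀ < s → ∀ θ {d}, 0 ≤ d → d ≤ Real.exp (-s) / 16 →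
    |q (s + d) θ - q s θ| ≤ C * d ^ α

namespace ShortHolder

variable {α s₀ C C' : ℝ} {q q' : ℝ → ℝ → ℝ}

theorem nonneg (h : ShortHolder α s₀ C q) : 0 ≤ C :=
  (abs_nonneg _).trans (h.bdd (lt_add_one s₀) 0)

theorem mono (h : ShortHolder α s₀ C q) (hC : C ≤ C') : ShortHolder α s₀ C' q where
  bdd hs θ := (h.bdd hs θ).trans hC
  angle hs θ d hd := (h.angle hs θ hd).trans (mul_le_mul_of_nonneg_right hC (by positivity))
  radial hs θ d hd hd' := (h.radial hs θ hd hd').trans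
    (mul_le_mul_of_nonneg_right hC (by positivity))

theorem congr (h : ShortHolder α s₀ C q) (he : ∀ {s}, s₀ < s → ∀ θ, q' s θ = q s θ) :
    ShortHolder α s₀ C q' where
  bdd hs θ := by rw [he hs]; exact h.bdd hs θ
  angle hs θ d hd := by rw [he hs, he hs]; exact h.angle hs θ hd
  radial hs θ d hd hd' := by
    rw [he hs, he (by linarith)]; exact h.radial hs θ hd hd'

theorem add (h : ShortHolder α s₀ C q) (h' : ShortHolder α s₀ C' q') :
    ShortHolder α s₀ (C + C') fun s θ => q s θ + q' s θ where
  bdd hs θ := (abs_add_le _ _).trans (add_le_add (h.bdd hs θ) (h'.bdd hs θ))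
  angle hs θ d hd := by
    rw [add_sub_add_comm, add_mul]
    exact (abs_add_le _ _).trans (add_le_add (h.angle hs θ hd) (h'.angle hs θ hd))
  radial hs θ d hd hd' := by
    rw [add_sub_add_comm, add_mul]
    exact (abs_add_le _ _).trans (add_le_add (h.radial hs θ hd hd') (h'.radial hs θ hd hd'))

theorem const_mul (h : ShortHolder α s₀ C q) (a : ℝ) :
    ShortHolder α s₀ (|a| * C) fun s θ => a * q s θ where
  bdd hs θ := by
    rw [abs_mul]; exact mul_le_mul_of_nonneg_left (h.bdd hs θ) (abs_nonneg a)
  angle hs θ d hd := by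
    rw [← mul_sub, abs_mul, mul_assoc]
    exact mul_le_mul_of_nonneg_left (h.angle hs θ hd) (abs_nonneg a)
  radial hs θ d hd hd' := by
    rw [← mul_sub, abs_mul, mul_assoc]
    exact mul_le_mul_of_nonneg_left (h.radial hs θ hd hd') (abs_nonneg a)

theorem neg (h : ShortHolder α s₀ C q) : ShortHolder α s₀ C fun s θ => -q s θ := by
  simpa using h.const_mul (-1)

theorem sub (h : ShortHolder α s₀ C q) (h' : ShortHolder α s₀ C' q') :
    ShortHolder α s₀ (C + C') fun s θ => q s θ - q' s θ := by
  simpa only [sub_eq_add_neg] using h.add h'.neg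

theorem mul (h : ShortHolder α s₀ C q) (h' : ShortHolder α s₀ C' q') :
    ShortHolder α s₀ (2 * (C * C')) fun s θ => q s θ * q' s θ := by
  have hC := h.nonneg
  have hC' := h'.nonneg
  have key : ∀ a b a' b' w : ℝ, 0 ≤ w → |a| ≤ C → |b'| ≤ C' → |a - b| ≤ C * w → |a' - b'| ≤ C' * w →
      |a * a' - b * b'| ≤ 2 * (C * C') * w := by
    intro a b a' b' w hw h1 h2 h3 h4
    have e : a * a' - b * b' = a * (a' - b') + (a - b) * b' := by ring
    rw [e]
    refine (abs_add_le _ _).trans ?_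
    rw [abs_mul, abs_mul]
    have := mul_le_mul h1 h4 (abs_nonneg _) hC
    have := mul_le_mul h3 h2 (abs_nonneg _) (mul_nonneg hC hw)
    linarith
  refine ⟨fun hs θ => ?_, fun hs θ d hd => ?_, fun hs θ d hd hd' => ?_⟩
  · rw [abs_mul]
    have := mul_le_mul (h.bdd hs θ) (h'.bdd hs θ) (abs_nonneg _) hC
    have := mul_nonneg hC hC'
    linarith
  · exact key _ _ _ _ _ (by positivity) (h.bdd hs _) (h'.bdd hs _) (h.angle hs θ hd)
      (h'.angle hs θ hd)
  · exact key _ _ _ _ _ (by positivity) (h.bdd (by linarith) _) (h'.bdd hs _)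
      (h.radial hs θ hd hd') (h'.radial hs θ hd hd')

/-- A bounded Lipschitz function of the angle alone. -/
theorem of_angle_lipschitz (hα₀ : 0 < α) (hα₁ : α < 1) (h₀ : Real.exp (-s₀) ≤ 3 / 2)
    {t : ℝ → ℝ} (h1 : ∀ θ, |t θ| ≤ 1) (h2 : ∀ θ d, 0 ≤ d → |t (θ + d) - t θ| ≤ d) :
    ShortHolder α s₀ 2 fun _ θ => t θ where
  bdd hs θ := (h1 θ).trans one_le_two
  angle hs θ d hd := by
    have a := h2 θ d hd
    have b := PolarSolution.two_thirds_le_exp hα₀ hα₁ h₀ hs.le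
    have c := Real.rpow_nonneg hd α
    nlinarith
  radial hs θ d hd hd' := by
    simp only [sub_self, abs_zero]
    positivity

theorem cos (hα₀ : 0 < α) (hα₁ : α < 1) (h₀ : Real.exp (-s₀) ≤ 3 / 2) :
    ShortHolder α s₀ 2 fun _ θ => Real.cos θ :=
  of_angle_lipschitz hα₀ hα₁ h₀ Real.abs_cos_le_one fun θ d hd => by
    have := abs_sub_le_of_hasDerivAt (a := θ) (b := θ + d) (M := 1) (by linarith)
      (fun y _ => Real.hasDerivAt_cos y) (fun y _ => by simpa using Real.abs_sin_le_one y)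
    simpa using this

theorem sin (hα₀ : 0 < α) (hα₁ : α < 1) (h₀ : Real.exp (-s₀) ≤ 3 / 2) :
    ShortHolder α s₀ 2 fun _ θ => Real.sin θ :=
  of_angle_lipschitz hα₀ hα₁ h₀ Real.abs_sin_le_one fun θ d hd => by
    have := abs_sub_le_of_hasDerivAt (a := θ) (b := θ + d) (M := 1) (by linarith)
      (fun y _ => Real.hasDerivAt_sin y) (fun y _ => Real.abs_cos_le_one y)
    simpa using this

/-- The radial condition need only be checked at smaller increments. -/
theorem of_radial_short (hα₀ : 0 < α) (h₀ : Real.exp (-s₀) ≤ 3 / 2) (hC : 0 ≤ C)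
    (h1 : ∀ {s}, s₀ < s → ∀ θ, |q s θ| ≤ C)
    (h2 : ∀ {s}, s₀ < s → ∀ θ {d}, 0 ≤ d →
      |q s (θ + d) - q s θ| ≤ C * (d ^ α + d * Real.exp ((1 - α) * s)))
    (h3 : ∀ {s}, s₀ < s → ∀ θ {d}, 0 < d → d ≤ Real.exp (-s) / 32 →
      |q (s + d) θ - q s θ| ≤ C * d ^ α) : ShortHolder α s₀ (4 * C) q where
  bdd hs θ := (h1 hs θ).trans (by linarith)
  angle hs θ d hd := (h2 hs θ hd).trans
    (mul_le_mul_of_nonneg_right (by linarith) (by positivity))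
  radial {s} hs θ d hd hd' := by
    rcases hd.eq_or_lt with rfl | hd
    · simp [Real.zero_rpow hα₀.ne']
    have hes := PolarSolution.exp_neg_le h₀ hs.le
    have key := abs_sub_le_of_steps (u := fun t => q t θ) (x := s) (d := d / 4)
      (B := C * d ^ α) 4 (by positivity) (fun y hy hy' => by
        refine (h3 (hs.trans_le hy) θ (by positivity) ?_).trans
          (mul_le_mul_of_nonneg_left (Real.rpow_le_rpow (by positivity) (by linarith) hα₀.le) hC)
        have e1 : Real.exp (-s) ≤ 2 * Real.exp (-y) := by
          have e2 : Real.exp (-s) = Real.exp (y - s) * Real.exp (-y) := by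
            rw [← Real.exp_add]; congr 1; ring
          rw [e2]
          refine mul_le_mul_of_nonneg_right ?_ (Real.exp_pos _).le
          have e3 : y - s ≤ 1 / 2 := by push_cast at hy'; linarith
          have e4 : 1 - 1 / 2 ≤ Real.exp (-(1 / 2)) := Real.one_sub_le_exp_neg _
          have e5 : Real.exp (1 / 2) * Real.exp (-(1 / 2)) = 1 := by rw [← Real.exp_add]; simp
          have e6 := Real.exp_le_exp.mpr e3
          nlinarith [Real.exp_pos (1 / 2)]
        linarith)
    have e : s + (4 : ℕ) * (d / 4) = s + d := by push_cast; ring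
    rw [e] at key
    refine key.trans (le_of_eq ?_)
    push_cast; ring

end ShortHolder

end

noncomputable section

theorem mul_exp_le_rpow {α s d : ℝ} (hα₁ : α < 1) (hd : 0 < d) (hd' : d ≤ Real.exp (-s)) :
    d * Real.exp ((1 - α) * s) ≤ d ^ α := by
  have h1 : d ^ (1 - α) ≤ Real.exp (-s) ^ (1 - α) := Real.rpow_le_rpow hd.le hd' (by linarith)
  rw [← Real.exp_mul] at h1
  have h2 : d = d ^ α * d ^ (1 - α) := by rw [← Real.rpow_add hd]; simp
  have h3 : Real.exp (-s * (1 - α)) * Real.exp ((1 - α) * s) = 1 := by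
    rw [← Real.exp_add, show -s * (1 - α) + (1 - α) * s = 0 by ring, Real.exp_zero]
  have h4 : 0 ≤ d ^ α := Real.rpow_nonneg hd.le _
  calc d * Real.exp ((1 - α) * s) = d ^ α * d ^ (1 - α) * Real.exp ((1 - α) * s) := by rw [← h2]
    _ ≤ d ^ α * Real.exp (-s * (1 - α)) * Real.exp ((1 - α) * s) := by gcongr
    _ = d ^ α := by rw [mul_assoc, h3, mul_one]

theorem self_le_rpow_of_le_one {α d : ℝ} (hα₁ : α < 1) (hd : 0 < d) (hd' : d ≤ 1) :
    d ≤ d ^ α := by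
  simpa using Real.rpow_le_rpow_of_exponent_ge hd hd' hα₁.le

theorem exp_le_four {x : ℝ} (hx : x ≤ 3 / 4) : Real.exp x ≤ 4 := by
  have h1 := Real.one_sub_le_exp_neg (3 / 4 : ℝ)
  have h2 : Real.exp (3 / 4) * Real.exp (-(3 / 4)) = 1 := by rw [← Real.exp_add]; simp
  have h3 := Real.exp_le_exp.mpr hx
  nlinarith [Real.exp_pos (3 / 4)]

theorem exp_sub_one_le {x : ℝ} (hx : 0 ≤ x) (hx' : x ≤ 1 / 2) : Real.exp x - 1 ≤ 2 * x := by
  have h1 := Real.one_sub_le_exp_neg x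
  have h2 : Real.exp x * Real.exp (-x) = 1 := by rw [← Real.exp_add]; simp
  nlinarith [Real.exp_pos x]

theorem ShortHolder.exp_neg_two {α s₀ : ℝ} (hα₁ : α < 1)
    (h₀ : Real.exp (-s₀) ≤ 3 / 2) : ShortHolder α s₀ 5 fun s _ => Real.exp (-(2 * s)) where
  bdd hs θ := by
    rw [abs_of_pos (Real.exp_pos _)]
    exact (PolarSolution.exp_neg_two_le h₀ hs.le).trans (by norm_num)
  angle hs θ d hd := by
    simp only [sub_self, abs_zero]
    positivity
  radial {s} hs θ d hd hd' := by
    rcases hd.eq_or_lt with rfl | hd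
    · simp only [add_zero, sub_self, abs_zero]; positivity
    have hes := PolarSolution.exp_neg_le h₀ hs.le
    have key := abs_sub_le_of_hasDerivAt (u := fun t => Real.exp (-(2 * t))) (a := s) (b := s + d)
      (M := 5) (by linarith) (fun y _ => (((hasDerivAt_id y).const_mul 2).neg).exp)
      (fun y hy => by
        have h1 := PolarSolution.exp_neg_two_le h₀ (hs.le.trans hy.1)
        simp only [id, Pi.neg_apply]
        rw [abs_mul, abs_of_pos (Real.exp_pos _)]
        norm_num
        linarith)
    refine key.trans (mul_le_mul_of_nonneg_left ?_ (by norm_num))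
    rw [add_sub_cancel_left]
    exact self_le_rpow_of_le_one hα₁ hd (by linarith)

namespace PolarSolution

variable {α s₀ A : ℝ}

/-! ### Radial derivatives -/

/-- The rescaled radial derivative `e^{2s} f_s`. -/
def y (u : PolarSolution α s₀ A) (s θ : ℝ) : ℝ := Real.exp (2 * s) * u.fs s θ

/-- The right-hand side `g - f - f_θθ` of the radial equation `f_ss + (2 - e^{2s}) f_s = H`. -/
def H (u : PolarSolution α s₀ A) (s θ : ℝ) : ℝ := u.G s θ - u.fθθ s θ

theorem fs_eq (u : PolarSolution α s₀ A) (s θ : ℝ) :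
    u.fs s θ = Real.exp (-(2 * s)) * u.y s θ := by
  rw [y, ← mul_assoc, ← Real.exp_add]; simp

theorem fss_eq (u : PolarSolution α s₀ A) {s : ℝ} (hs : s₀ < s) (θ : ℝ) :
    u.fss s θ = u.H s θ - 2 * u.fs s θ + u.y s θ := by
  have := u.eq hs θ
  simp only [H, G, y]
  linarith

theorem hasDerivAt_y (u : PolarSolution α s₀ A) {s : ℝ} (hs : s₀ < s) (θ : ℝ) :
    HasDerivAt (fun s => u.y s θ) (Real.exp (2 * s) * (u.y s θ + u.H s θ)) s := by
  have h1 : HasDerivAt (fun s : ℝ => Real.exp (2 * s)) (Real.exp (2 * s) * (2 * 1)) s :=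
    ((hasDerivAt_id s).const_mul 2).exp
  refine (h1.mul (u.hasDerivAt_ss hs θ)).congr_deriv ?_
  rw [u.fss_eq hs θ]
  ring

theorem exists_y_le_exp (u : PolarSolution α s₀ A) :
    ∃ K, ∀ s > s₀, ∀ θ, |u.y s θ| ≤ K * Real.exp (2 * s) := by
  obtain ⟨K, hK⟩ := u.fs_bdd
  refine ⟨K, fun s hs θ => ?_⟩
  rw [y, abs_mul, abs_of_pos (Real.exp_pos _), mul_comm]
  exact mul_le_mul_of_nonneg_right (hK hs θ) (Real.exp_pos _).le

theorem one_le_mul_exp_two (h₀ : Real.exp (-s₀) ≤ 3 / 2) {s : ℝ} (hs : s₀ ≤ s) :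
    1 ≤ 9 / 4 * Real.exp (2 * s) := by
  have h1 := exp_neg_two_le h₀ hs
  have h2 : Real.exp (2 * s) * Real.exp (-(2 * s)) = 1 := by rw [← Real.exp_add]; simp
  nlinarith [Real.exp_pos (2 * s)]

/-- The drift equation gains two powers of `e^s`: `f_s = O(e^{-2s})`. -/
theorem abs_y_le (h₀ : Real.exp (-s₀) ≤ 3 / 2) (u : PolarSolution α s₀ A) {M : ℝ}
    (hH : ∀ s > s₀, ∀ θ, |u.H s θ| ≤ M) {s : ℝ} (hs : s₀ < s) (θ : ℝ) : |u.y s θ| ≤ M := by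
  obtain ⟨K, hK⟩ := u.exists_y_le_exp
  have hM : 0 ≤ M := (abs_nonneg _).trans (hH s hs θ)
  refine abs_le_of_hasDerivAt_drift (M := fun _ => M) (M' := fun _ => 0) (K' := M * (9 / 4))
    (fun t ht => u.hasDerivAt_y ht θ)
    (fun t _ => hasDerivAt_const t M) (fun t ht => by simpa using hH t ht θ)
    (fun t ht => hK t ht θ) (fun t ht => ?_) hs
  have := one_le_mul_exp_two h₀ (le_of_lt ht)
  rw [abs_of_nonneg hM]
  nlinarith

/-- The drift equation preserves the modulus of continuity in `θ`. -/
theorem abs_y_sub_le (hα₀ : 0 < α) (hα₁ : α < 1) (h₀ : Real.exp (-s₀) ≤ 3 / 2)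
    (u : PolarSolution α s₀ A) {M : ℝ} (hM : 0 ≤ M)
    (hH : ∀ s > s₀, ∀ θ d, 0 ≤ d →
      |u.H s (θ + d) - u.H s θ| ≤ M * (d ^ α + d * Real.exp ((1 - α) * s)))
    {s : ℝ} (hs : s₀ < s) (θ : ℝ) {d : ℝ} (hd : 0 ≤ d) :
    |u.y s (θ + d) - u.y s θ| ≤ 13 / 4 * M * (d ^ α + d * Real.exp ((1 - α) * s)) := by
  obtain ⟨K, hK⟩ := u.exists_y_le_exp
  have hp : 0 ≤ d ^ α := Real.rpow_nonneg hd α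
  have e1 : ∀ t : ℝ, Real.exp (-(1 + α) * t) = Real.exp (-(2 * t)) * Real.exp ((1 - α) * t) := by
    intro t; rw [← Real.exp_add]; congr 1; ring
  have e2 : ∀ t > s₀, Real.exp (-(1 + α) * t) ≤ 9 / 4 := by
    intro t ht
    have h1 := exp_neg_two_le h₀ (le_of_lt ht)
    rcases le_total t 0 with h | h
    · refine le_trans (Real.exp_le_exp.mpr ?_) h1
      nlinarith
    · refine le_trans (Real.exp_le_one_iff.mpr ?_) (by norm_num)
      nlinarith
  -- The modulus of continuity grows in `s`; the additional term `e^{-(1+α)s}` in the bound absorbs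
  -- the contribution of its derivative.
  have key := abs_le_of_hasDerivAt_drift (y := fun s => u.y s (θ + d) - u.y s θ)
    (H := fun s => u.H s (θ + d) - u.H s θ)
    (M := fun s => M * (d ^ α + d * (Real.exp ((1 - α) * s) + Real.exp (-(1 + α) * s))))
    (M' := fun s => M * (d * ((1 - α) * Real.exp ((1 - α) * s) -
      (1 + α) * Real.exp (-(1 + α) * s)))) (K := 2 * K)
    (K' := M * (d ^ α * (9 / 4) + d * (9 / 4 + 81 / 16)))
    (fun t ht => ((u.hasDerivAt_y ht (θ + d)).sub (u.hasDerivAt_y ht θ)).congr_deriv (by ring))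
    (fun t _ => by
      have h1 := ((hasDerivAt_id t).const_mul (1 - α)).exp
      have h2 := ((hasDerivAt_id t).const_mul (-(1 + α))).exp
      refine ((((h1.add h2).const_mul d).const_add (d ^ α)).const_mul M).congr_deriv ?_
      simp only [id]
      ring)
    (fun t ht => by
      refine (hH t ht θ d hd).trans ?_
      have h3 : Real.exp (-(2 * t)) * (M * (d * ((1 - α) * Real.exp ((1 - α) * t) -
          (1 + α) * Real.exp (-(1 + α) * t)))) ≤ M * (d * Real.exp (-(1 + α) * t)) := by
        have : Real.exp (-(2 * t)) * (M * (d * ((1 - α) * Real.exp ((1 - α) * t) -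
          (1 + α) * Real.exp (-(1 + α) * t)))) = M * (d * ((1 - α) * Real.exp (-(1 + α) * t) -
          (1 + α) * (Real.exp (-(2 * t)) * Real.exp (-(1 + α) * t)))) := by
          rw [e1 t]; ring
        rw [this]
        refine mul_le_mul_of_nonneg_left (mul_le_mul_of_nonneg_left ?_ hd) hM
        have p1 := Real.exp_pos (-(1 + α) * t)
        have p2 := mul_pos (Real.exp_pos (-(2 * t))) p1
        nlinarith
      linarith)
    (fun t ht => by
      have a := abs_le.mp (hK t ht (θ + d))
      have b := abs_le.mp (hK t ht θ)
      exact abs_le.mpr ⟨by linarith, by linarith⟩)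
    (fun t ht => by
      have h1 := one_le_mul_exp_two h₀ (le_of_lt ht)
      have h2 := e2 t ht
      have h3 : Real.exp ((1 - α) * t) ≤ 9 / 4 * Real.exp (2 * t) := by
        have : Real.exp ((1 - α) * t) = Real.exp (-(1 + α) * t) * Real.exp (2 * t) := by
          rw [← Real.exp_add]; congr 1; ring
        rw [this]
        exact mul_le_mul_of_nonneg_right h2 (Real.exp_pos _).le
      rw [abs_of_nonneg (by positivity), mul_assoc]
      refine mul_le_mul_of_nonneg_left ?_ hM
      have h4 : d ^ α * 1 ≤ d ^ α * (9 / 4 * Real.exp (2 * t)) := mul_le_mul_of_nonneg_left h1 hp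
      have h5 : d * (Real.exp ((1 - α) * t) + Real.exp (-(1 + α) * t)) ≤
          d * (9 / 4 * Real.exp (2 * t) + 9 / 4 * (9 / 4 * Real.exp (2 * t))) := by
        gcongr
        linarith
      linarith) hs
  refine key.trans ?_
  have h6 : Real.exp (-(1 + α) * s) ≤ 9 / 4 * Real.exp ((1 - α) * s) := by
    rw [e1]
    exact mul_le_mul_of_nonneg_right (exp_neg_two_le h₀ hs.le) (Real.exp_pos _).le
  rw [mul_comm (13 / 4) M, mul_assoc]
  refine mul_le_mul_of_nonneg_left ?_ hM
  have := mul_le_mul_of_nonneg_left h6 hd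
  linarith

/-- Bounds for the derivatives in `s`, which follow from the drift equation once `f_θθ` is known to
be `α`-Hölder in `θ`. -/
theorem exists_radial_bounds (hα₀ : 0 < α) (hα₁ : α < 1) : ∃ C, 1 ≤ C ∧ ∀ {s₀ A : ℝ},
    Real.exp (-s₀) ≤ 3 / 2 → ∀ (u : PolarSolution α s₀ A) {s : ℝ}, s₀ < s → ∀ θ : ℝ,
      |u.y s θ| ≤ C * A ∧ |u.fs s θ| ≤ C * A ∧ |u.fss s θ| ≤ C * A ∧
      (∀ d, 0 ≤ d → |u.y s (θ + d) - u.y s θ| ≤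
        C * A * (d ^ α + d * Real.exp ((1 - α) * s))) ∧
      (∀ d, 0 ≤ d → |u.fss s (θ + d) - u.fss s θ| ≤
        C * A * (d ^ α + d * Real.exp ((1 - α) * s))) := by
  obtain ⟨C, hC, hb⟩ := exists_fθθ_bounds hα₀ hα₁
  refine ⟨100 * (C + 10), by linarith, fun {s₀ A} h₀ u {s} hs θ => ?_⟩
  have hA := u.A_nonneg
  have hCA : 0 ≤ C * A := mul_nonneg (by linarith) hA
  have hH : ∀ s > s₀, ∀ θ, |u.H s θ| ≤ (C + 10) * A := by
    intro s hs θ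
    have a := abs_le.mp (hb h₀ u hs θ).1
    have b := abs_le.mp (u.g_le hs θ)
    have c := abs_le.mp (u.abs_f_le h₀ hs.le θ)
    simp only [H, G]
    exact abs_le.mpr ⟨by linarith, by linarith⟩
  have hH' : ∀ s > s₀, ∀ θ d, 0 ≤ d →
      |u.H s (θ + d) - u.H s θ| ≤ (C + 10) * A * (d ^ α + d * Real.exp ((1 - α) * s)) := by
    intro s hs θ d hd
    have a := abs_le.mp ((hb h₀ u hs θ).2.1 d hd)
    have b := abs_le.mp (u.abs_G_sub_le hα₀ hα₁ h₀ hs θ hd)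
    have p : 0 ≤ C * A * (d * Real.exp ((1 - α) * s)) := by positivity
    simp only [H]
    exact abs_le.mpr ⟨by linarith, by linarith⟩
  have hy := fun θ => u.abs_y_le h₀ hH hs θ
  have hfs : ∀ θ, |u.fs s θ| ≤ 9 / 4 * ((C + 10) * A) := by
    intro θ
    rw [u.fs_eq, abs_mul, abs_of_pos (Real.exp_pos _)]
    exact mul_le_mul (exp_neg_two_le h₀ hs.le) (hy θ) (abs_nonneg _) (by norm_num)
  have hyd := fun d (hd : 0 ≤ d) => u.abs_y_sub_le hα₀ hα₁ h₀ (M := (C + 10) * A)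
    (by positivity) hH' hs θ hd
  have hfsd : ∀ d, 0 ≤ d → |u.fs s (θ + d) - u.fs s θ| ≤
      9 / 4 * (13 / 4 * ((C + 10) * A) * (d ^ α + d * Real.exp ((1 - α) * s))) := by
    intro d hd
    rw [u.fs_eq, u.fs_eq, ← mul_sub, abs_mul, abs_of_pos (Real.exp_pos _)]
    exact mul_le_mul (exp_neg_two_le h₀ hs.le) (hyd d hd) (abs_nonneg _) (by norm_num)
  have hN : 0 ≤ (C + 10) * A := by positivity
  refine ⟨(hy θ).trans (by linarith), (hfs θ).trans (by linarith), ?_, fun d hd => ?_,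
    fun d hd => ?_⟩
  · rw [u.fss_eq hs]
    have a := abs_le.mp (hH s hs θ)
    have b := abs_le.mp (hfs θ)
    have c := abs_le.mp (hy θ)
    exact abs_le.mpr ⟨by linarith, by linarith⟩
  · have p : 0 ≤ (C + 10) * A * (d ^ α + d * Real.exp ((1 - α) * s)) := by positivity
    refine (hyd d hd).trans ?_
    linarith
  · have p : 0 ≤ (C + 10) * A * (d ^ α + d * Real.exp ((1 - α) * s)) := by positivity
    rw [u.fss_eq hs, u.fss_eq hs]
    have a := abs_le.mp (hH' s hs θ d hd)
    have b := abs_le.mp (hfsd d hd)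
    have c := abs_le.mp (hyd d hd)
    exact abs_le.mpr ⟨by linarith, by linarith⟩

theorem hasDerivAt_secondDiff_s {F F' : ℝ → ℝ → ℝ} {s : ℝ}
    (hF : ∀ θ, HasDerivAt (fun t => F t θ) (F' s θ) s) (h θ : ℝ) :
    HasDerivAt (fun t => secondDiff (F t) h θ) (secondDiff (F' s) h θ) s :=
  ((hF _).sub ((hF _).const_mul 2)).add (hF _)

/-- `f_θθ` is Hölder in `s`: its second differences in `s` with step `d` are controlled because
`f_ss` is Hölder in `θ`, after replacing `f_θθ` by a difference quotient of step `d`. -/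
theorem exists_fθθ_radial (hα₀ : 0 < α) (hα₁ : α < 1) : ∃ C, 1 ≤ C ∧ ∀ {s₀ A : ℝ},
    Real.exp (-s₀) ≤ 3 / 2 → ∀ (u : PolarSolution α s₀ A) {s : ℝ}, s₀ < s → ∀ θ d : ℝ, 0 < d →
      d ≤ Real.exp (-s) / 2 → |u.fθθ (s + d) θ - u.fθθ s θ| ≤ C * A * d ^ α := by
  obtain ⟨C₁, hC₁, hb⟩ := exists_fθθ_bounds hα₀ hα₁
  obtain ⟨C₂, hC₂, hr⟩ := exists_radial_bounds hα₀ hα₁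
  have ht : (2 : ℝ) ^ α / 2 < 1 := by
    have : (2 : ℝ) ^ α < 2 := by
      simpa using Real.rpow_lt_rpow_of_exponent_lt one_lt_two hα₁
    linarith
  have hD : 0 ≤ (4 * C₁ + 10 * C₂) / (1 - 2 ^ α / 2) :=
    div_nonneg (by linarith) (by linarith)
  refine ⟨(2 * C₁ + 64 * C₂) + (4 * C₁ + 10 * C₂) / (1 - 2 ^ α / 2), by linarith,
    fun {s₀ A} h₀ u {s} hs θ d hd hd' => ?_⟩
  have hA := u.A_nonneg
  have hes := exp_neg_le h₀ hs.le
  have hquot : ∀ t ≥ s, ∀ δ, 0 < δ → δ ≤ 1 →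
      |secondDiff (u.f t) δ θ / δ ^ 2 - u.fθθ t θ| ≤ C₁ * A * δ ^ α :=
    fun t ht δ hδ hδ' => (hb h₀ u (hs.trans_le ht) θ).2.2 δ hδ hδ'
  have key := holder_of_doubling (D := fun d => |u.fθθ (s + d) θ - u.fθθ s θ|)
    (K := (2 * C₁ + 64 * C₂) * A) (C := (4 * C₁ + 10 * C₂) * A) (ℓ := Real.exp (-s) / 2)
    hα₁ (by positivity) (by positivity) ?_ ?_ hd hd'
  · refine key.trans (le_of_eq ?_)
    ring
  -- At the largest scale, `δ` of order `e^{-s}`, the bound `f_s = O(e^{-2s})` suffices: the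
  -- difference quotient of step `δ` changes by at most a multiple of `e^{-2s} δ / δ² ≤ 16 δ`.
  · intro δ hδ hδ1 hδ2
    have a := abs_le.mp (hquot s le_rfl δ hδ (by linarith))
    have b := abs_le.mp (hquot (s + δ) (by linarith) δ hδ (by linarith))
    have hf : ∀ ϑ, |u.f (s + δ) ϑ - u.f s ϑ| ≤ C₂ * A * Real.exp (-(2 * s)) * δ := by
      intro ϑ
      have := abs_sub_le_of_hasDerivAt (u := fun t => u.f t ϑ) (a := s) (b := s + δ)
        (M := C₂ * A * Real.exp (-(2 * s))) (by linarith)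
        (fun t ht => u.hasDerivAt_s (hs.trans_le ht.1) ϑ) (fun t ht => by
          rw [u.fs_eq, abs_mul, abs_of_pos (Real.exp_pos _), mul_comm]
          exact mul_le_mul ((hr h₀ u (hs.trans_le ht.1) ϑ).1)
            (Real.exp_le_exp.mpr (by linarith [ht.1])) (Real.exp_pos _).le (by positivity))
      simpa using this
    have e1 : |secondDiff (u.f (s + δ)) δ θ / δ ^ 2 - secondDiff (u.f s) δ θ / δ ^ 2| ≤
        64 * C₂ * A * δ := by
      have hδ2' : 0 < δ ^ 2 := pow_pos hδ 2
      rw [← sub_div, abs_div, abs_of_pos hδ2', div_le_iff₀ hδ2']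
      have c1 := abs_le.mp (hf (θ + δ))
      have c2 := abs_le.mp (hf θ)
      have c3 := abs_le.mp (hf (θ - δ))
      have e2 : Real.exp (-(2 * s)) ≤ 16 * δ ^ 2 := by
        have : Real.exp (-(2 * s)) = Real.exp (-s) ^ 2 := by
          rw [← Real.exp_nat_mul]; congr 1; push_cast; ring
        rw [this]
        have : Real.exp (-s) ≤ 4 * δ := by linarith
        calc _ ≤ (4 * δ) ^ 2 := by gcongr
          _ = _ := by ring
      have e3 : C₂ * A * Real.exp (-(2 * s)) * δ ≤ C₂ * A * (16 * δ ^ 2) * δ := by gcongr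
      unfold secondDiff
      exact abs_le.mpr ⟨by linarith, by linarith⟩
    have e4 := self_le_rpow_of_le_one hα₁ hδ (by linarith)
    have e5 : 64 * C₂ * A * δ ≤ 64 * C₂ * A * δ ^ α :=
      mul_le_mul_of_nonneg_left e4 (by positivity)
    have c := abs_le.mp e1
    exact abs_le.mpr ⟨by linarith, by linarith⟩
  -- At smaller scales a second difference in `s` gives a doubling inequality.
  · intro δ hδ hδ1
    have a := abs_le.mp (hquot s le_rfl δ hδ (by linarith))
    have b := abs_le.mp (hquot (s + δ) (by linarith) δ hδ (by linarith))
    have c := abs_le.mp (hquot (s + 2 * δ) (by linarith) δ hδ (by linarith))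
    have hp := abs_second_difference_le (u := fun t => secondDiff (u.f t) δ θ) (x := s) (h := δ)
      (M := 10 * C₂ * A * δ ^ α) hδ.le
      (fun t ht => hasDerivAt_secondDiff_s (u.hasDerivAt_s (hs.trans_le ht.1)) δ θ)
      (fun t ht => hasDerivAt_secondDiff_s (u.hasDerivAt_ss (hs.trans_le ht.1)) δ θ)
      (fun t ht => by
        have h1 := (hr h₀ u (hs.trans_le ht.1) θ).2.2.2.2 δ hδ.le
        have h2 := (hr h₀ u (hs.trans_le ht.1) (θ - δ)).2.2.2.2 δ hδ.le
        rw [sub_add_cancel] at h2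
        have h3 : δ ^ α + δ * Real.exp ((1 - α) * t) ≤ 5 * δ ^ α := by
          have h4 : Real.exp ((1 - α) * t) ≤ Real.exp ((1 - α) * s) * 4 := by
            have : Real.exp ((1 - α) * t) =
                Real.exp ((1 - α) * s) * Real.exp ((1 - α) * (t - s)) := by
              rw [← Real.exp_add]; congr 1; ring
            rw [this]
            refine mul_le_mul_of_nonneg_left (exp_le_four ?_) (Real.exp_pos _).le
            have := ht.1
            have := ht.2
            nlinarith
          have h5 := mul_exp_le_rpow (s := s) hα₁ hδ (by linarith)
          have h6 := mul_le_mul_of_nonneg_left h4 hδ.le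
          linarith
        have h7 := mul_le_mul_of_nonneg_left h3 (by positivity : 0 ≤ C₂ * A)
        have h1' := abs_le.mp h1
        have h2' := abs_le.mp h2
        unfold secondDiff
        exact abs_le.mpr ⟨by linarith, by linarith⟩)
    have hδ2' : 0 < δ ^ 2 := pow_pos hδ 2
    have hp2 : |secondDiff (u.f (s + 2 * δ)) δ θ / δ ^ 2 -
        2 * (secondDiff (u.f (s + δ)) δ θ / δ ^ 2) + secondDiff (u.f s) δ θ / δ ^ 2| ≤
        10 * C₂ * A * δ ^ α := by
      have e : secondDiff (u.f (s + 2 * δ)) δ θ / δ ^ 2 -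
        2 * (secondDiff (u.f (s + δ)) δ θ / δ ^ 2) + secondDiff (u.f s) δ θ / δ ^ 2 =
        (secondDiff (u.f (s + 2 * δ)) δ θ - 2 * secondDiff (u.f (s + δ)) δ θ +
          secondDiff (u.f s) δ θ) / δ ^ 2 := by ring
      rw [e, abs_div, abs_of_pos hδ2', div_le_iff₀ hδ2']
      exact hp
    have hq : |u.fθθ (s + 2 * δ) θ - 2 * u.fθθ (s + δ) θ + u.fθθ s θ| ≤
        (4 * C₁ + 10 * C₂) * A * δ ^ α := by
      have := abs_le.mp hp2
      exact abs_le.mpr ⟨by linarith, by linarith⟩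
    have e : u.fθθ (s + δ) θ - u.fθθ s θ = (u.fθθ (s + 2 * δ) θ - u.fθθ s θ) / 2 -
        (u.fθθ (s + 2 * δ) θ - 2 * u.fθθ (s + δ) θ + u.fθθ s θ) / 2 := by ring
    have e2 := abs_sub ((u.fθθ (s + 2 * δ) θ - u.fθθ s θ) / 2)
      ((u.fθθ (s + 2 * δ) θ - 2 * u.fθθ (s + δ) θ + u.fθθ s θ) / 2)
    rw [← e, abs_div, abs_div, abs_two] at e2
    linarith

end PolarSolution

end

noncomputable section

namespace PolarSolution

variable {α s₀ A : ℝ}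

/-- `y = e^{2s} f_s` is Hölder in `s`: in the variable `e^{2s}` the drift equation is translation
invariant, so that the increment of `y` under a translation solves it with the increment of `H` as
right-hand side. -/
theorem abs_y_radial_sub_le (hα₀ : 0 < α) (hα₁ : α < 1) (h₀ : Real.exp (-s₀) ≤ 3 / 2)
    (u : PolarSolution α s₀ A) {M : ℝ} (hM : 0 ≤ M)
    (hH : ∀ s > s₀, ∀ θ d, 0 < d → d ≤ Real.exp (-s) / 4 →
      |u.H (s + d) θ - u.H s θ| ≤ M * d ^ α)
    {s : ℝ} (hs : s₀ < s) (θ : ℝ) {d : ℝ} (hd : 0 < d) (hd' : d ≤ Real.exp (-s) / 16) :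
    |u.y (s + d) θ - u.y s θ| ≤ 2 * M * d ^ α := by
  obtain ⟨K, hK⟩ := u.exists_y_le_exp
  have hes := exp_neg_le h₀ hs.le
  set a : ℝ := Real.exp (2 * (s + d)) - Real.exp (2 * s) with ha
  have ha0 : 0 < a := by
    rw [ha, sub_pos]; exact Real.exp_lt_exp.mpr (by linarith)
  have hea : ∀ t, 0 < Real.exp (2 * t) + a := fun t => add_pos (Real.exp_pos _) ha0
  set τ : ℝ → ℝ := fun t => Real.log (Real.exp (2 * t) + a) / 2 with hτ
  have hτe : ∀ t, Real.exp (2 * τ t) = Real.exp (2 * t) + a := by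
    intro t
    rw [hτ]
    simp only [mul_div_cancel₀ _ (two_ne_zero' ℝ)]
    exact Real.exp_log (hea t)
  have hτs : τ s = s + d := by
    have h1 := hτe s
    rw [ha, add_sub_cancel] at h1
    have := Real.exp_injective h1
    linarith
  have hτt : ∀ t, t < τ t := by
    intro t
    have h1 := hτe t
    have : Real.exp (2 * t) < Real.exp (2 * τ t) := by linarith
    have := Real.exp_lt_exp.mp this
    linarith
  -- the translation moves points by at most `2 d`, and by at most `e^{-t} / 4`
  have hτd : ∀ t ≥ s, τ t - t ≤ d * (2 * Real.exp (2 * (s - t))) := by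
    intro t _
    have h1 : Real.exp (2 * (τ t - t)) = 1 + a * Real.exp (-(2 * t)) := by
      have e1 : Real.exp (2 * (τ t - t)) = Real.exp (2 * τ t) * Real.exp (-(2 * t)) := by
        rw [← Real.exp_add]; congr 1; ring
      have e2 : Real.exp (2 * t) * Real.exp (-(2 * t)) = 1 := by rw [← Real.exp_add]; simp
      rw [e1, hτe, add_mul, e2]
    have h2 := Real.add_one_le_exp (2 * (τ t - t))
    have h3 : a = Real.exp (2 * s) * (Real.exp (2 * d) - 1) := by
      rw [ha, mul_sub, ← Real.exp_add, mul_one]; congr 2; ring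
    have h4 : Real.exp (2 * d) - 1 ≤ 2 * (2 * d) := exp_sub_one_le (by linarith) (by linarith)
    have h5 : a * Real.exp (-(2 * t)) = Real.exp (2 * (s - t)) * (Real.exp (2 * d) - 1) := by
      rw [h3, mul_right_comm, ← Real.exp_add]; congr 2; ring
    have h6 := mul_le_mul_of_nonneg_left h4 (Real.exp_pos (2 * (s - t))).le
    linarith
  have hshort : ∀ t ≥ s, |u.H (τ t) θ - u.H t θ| ≤ 2 * M * d ^ α := by
    intro t ht
    have h1 := hτd t ht
    have h2 : Real.exp (2 * (s - t)) ≤ Real.exp (s - t) := Real.exp_le_exp.mpr (by linarith)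
    have h3 : Real.exp (s - t) ≤ 1 := Real.exp_le_one_iff.mpr (by linarith)
    have h4 : Real.exp (-s) * Real.exp (s - t) = Real.exp (-t) := by
      rw [← Real.exp_add]; congr 1; ring
    have h5 : τ t - t ≤ Real.exp (-t) / 4 := by
      have : d * (2 * Real.exp (2 * (s - t))) ≤ Real.exp (-s) / 16 * (2 * Real.exp (s - t)) := by
        gcongr
      have := Real.exp_pos (-t)
      linarith
    have h6 : τ t - t ≤ 2 * d := by nlinarith
    have h7 := hH t (hs.trans_le ht) θ (τ t - t) (by linarith [hτt t]) h5
    rw [add_sub_cancel] at h7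
    refine h7.trans ?_
    have h8 : (τ t - t) ^ α ≤ (2 * d) ^ α :=
      Real.rpow_le_rpow (by linarith [hτt t]) h6 hα₀.le
    have h9 : (2 : ℝ) ^ α ≤ 2 := by
      simpa using Real.rpow_le_rpow_of_exponent_le one_le_two hα₁.le
    rw [Real.mul_rpow two_pos.le hd.le] at h8
    have h10 : (2 : ℝ) ^ α * d ^ α ≤ 2 * d ^ α :=
      mul_le_mul_of_nonneg_right h9 (Real.rpow_nonneg hd.le _)
    have := mul_le_mul_of_nonneg_left (h8.trans h10) hM
    linarith
  have hdτ : ∀ t, HasDerivAt τ (Real.exp (2 * t) / Real.exp (2 * τ t)) t := by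
    intro t
    have h1 := ((((hasDerivAt_id t).const_mul 2).exp.add_const a).log (hea t).ne').div_const 2
    refine h1.congr_deriv ?_
    rw [hτe]
    simp only [id]
    field_simp
  have hdY : ∀ t > s₀, HasDerivAt (fun t => u.y (τ t) θ - u.y t θ)
      (Real.exp (2 * t) * (u.y (τ t) θ - u.y t θ + (u.H (τ t) θ - u.H t θ))) t := by
    intro t ht
    have h1 := (u.hasDerivAt_y (ht.trans (hτt t)) θ).comp t (hdτ t)
    refine (h1.sub (u.hasDerivAt_y ht θ)).congr_deriv ?_
    have := (Real.exp_pos (2 * τ t)).ne'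
    field_simp
    ring
  have hMd : 0 ≤ 2 * M * d ^ α := by positivity
  have hlt : ∀ t > s, |u.y (τ t) θ - u.y t θ| ≤ 2 * M * d ^ α := by
    intro t ht
    refine abs_le_of_hasDerivAt_drift (s₀ := s) (M := fun _ => 2 * M * d ^ α) (M' := fun _ => 0)
      (K := (K * (1 + a * (9 / 4)) + K)) (K' := 2 * M * d ^ α * (9 / 4))
      (fun t ht => hdY t (hs.trans ht)) (fun t _ => hasDerivAt_const t _)
      (fun t ht => by simpa using hshort t (le_of_lt ht)) (fun t ht => ?_) (fun t ht => ?_) ht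
    · have ht0 : s₀ < t := hs.trans ht
      have h1 := abs_le.mp (hK (τ t) (ht0.trans (hτt t)) θ)
      have h2 := abs_le.mp (hK t ht0 θ)
      rw [hτe] at h1
      have hK0 : 0 ≤ K := by
        have := (abs_nonneg _).trans (hK t ht0 θ)
        exact nonneg_of_mul_nonneg_left this (Real.exp_pos _)
      have h3 := one_le_mul_exp_two h₀ ht0.le
      have h4 : K * a * 1 ≤ K * a * (9 / 4 * Real.exp (2 * t)) :=
        mul_le_mul_of_nonneg_left h3 (by positivity)
      exact abs_le.mpr ⟨by linarith, by linarith⟩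
    · have := one_le_mul_exp_two h₀ (hs.trans ht).le
      rw [abs_of_nonneg hMd]
      nlinarith
  have hcont := (hdY s hs).continuousAt.abs
  have hlim : Tendsto (fun t => |u.y (τ t) θ - u.y t θ|) (𝓝[>] s)
      (𝓝 |u.y (τ s) θ - u.y s θ|) := hcont.tendsto.mono_left nhdsWithin_le_nhds
  rw [← hτs]
  exact le_of_tendsto hlim (eventually_nhdsWithin_of_forall hlt)

/-- Hölder bounds for `f`, for its pure derivatives of second order, and for `e^{2s} f_s`. -/
theorem exists_shortHolder_pure (hα₀ : 0 < α) (hα₁ : α < 1) : ∃ C, 1 ≤ C ∧ ∀ {s₀ A : ℝ},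
    Real.exp (-s₀) ≤ 3 / 2 → ∀ u : PolarSolution α s₀ A,
      ShortHolder α s₀ (C * A) u.f ∧ ShortHolder α s₀ (C * A) u.y ∧
      ShortHolder α s₀ (C * A) u.fs ∧ ShortHolder α s₀ (C * A) u.fss ∧
      ShortHolder α s₀ (C * A) u.fθθ := by
  obtain ⟨C₁, hC₁, hb⟩ := exists_fθθ_bounds hα₀ hα₁
  obtain ⟨C₂, hC₂, hr⟩ := exists_radial_bounds hα₀ hα₁
  obtain ⟨C₃, hC₃, hc⟩ := exists_fθθ_radial hα₀ hα₁
  refine ⟨100 * (C₁ + C₂ + C₃ + 20), by linarith, fun {s₀ A} h₀ u => ?_⟩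
  have hA := u.A_nonneg
  have hes : ∀ {s}, s₀ < s → Real.exp (-s) ≤ 3 / 2 := fun hs => exp_neg_le h₀ (le_of_lt hs)
  have hf : ShortHolder α s₀ ((C₂ + 20) * A) u.f := by
    refine ⟨fun {s} hs θ => (u.abs_f_le h₀ hs.le θ).trans (by nlinarith),
      fun {s} hs θ d hd => ?_, fun {s} hs θ d hd hd' => ?_⟩
    · have h1 := u.abs_f_sub_le h₀ hs.le θ hd
      have h2 := two_thirds_le_exp hα₀ hα₁ h₀ hs.le
      have h3 : A * d * (2 / 3) ≤ A * d * Real.exp ((1 - α) * s) :=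
        mul_le_mul_of_nonneg_left h2 (by positivity)
      have h4 : 0 ≤ A * d ^ α := by positivity
      have h6 : 0 ≤ A * d * Real.exp ((1 - α) * s) := by positivity
      have h5 : 0 ≤ C₂ * (A * (d ^ α + d * Real.exp ((1 - α) * s))) := by positivity
      linarith
    · rcases hd.eq_or_lt with rfl | hd
      · simp only [add_zero, sub_self, abs_zero]; positivity
      have key := abs_sub_le_of_hasDerivAt (u := fun t => u.f t θ) (a := s) (b := s + d)
        (M := C₂ * A) (by linarith) (fun t ht => u.hasDerivAt_s (hs.trans_le ht.1) θ)
        (fun t ht => (hr h₀ u (hs.trans_le ht.1) θ).2.1)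
      rw [add_sub_cancel_left] at key
      have h1 := self_le_rpow_of_le_one hα₁ hd (by linarith [hes hs])
      refine key.trans ?_
      have : C₂ * A * d ≤ C₂ * A * d ^ α := mul_le_mul_of_nonneg_left h1 (by positivity)
      have : 0 ≤ A * d ^ α := by positivity
      linarith
  have hθθ : ShortHolder α s₀ ((C₁ + C₃) * A) u.fθθ := by
    refine ⟨fun {s} hs θ => (hb h₀ u hs θ).1.trans (by nlinarith),
      fun {s} hs θ d hd => ((hb h₀ u hs θ).2.1 d hd).trans ?_, fun {s} hs θ d hd hd' => ?_⟩
    · have h1 : 0 ≤ C₁ * A * (d * Real.exp ((1 - α) * s)) := by positivity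
      have h2 : 0 ≤ C₃ * A * (d ^ α + d * Real.exp ((1 - α) * s)) := by positivity
      linarith
    · rcases hd.eq_or_lt with rfl | hd
      · simp only [add_zero, sub_self, abs_zero]; positivity
      refine (hc h₀ u hs θ d hd (by linarith [Real.exp_pos (-s)])).trans ?_
      have : 0 ≤ C₁ * A * d ^ α := by positivity
      linarith
  have hH : ∀ s > s₀, ∀ θ d, 0 < d → d ≤ Real.exp (-s) / 4 →
      |u.H (s + d) θ - u.H s θ| ≤ (C₂ + C₃ + 21) * A * d ^ α := by
    intro s hs θ d hd hd'
    have h1 := abs_le.mp (hc h₀ u hs θ d hd (by linarith [Real.exp_pos (-s)]))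
    have h2 := abs_le.mp (u.g_s hs θ hd.le hd')
    have key := abs_sub_le_of_hasDerivAt (u := fun t => u.f t θ) (a := s) (b := s + d)
      (M := C₂ * A) (by linarith) (fun t ht => u.hasDerivAt_s (lt_of_lt_of_le hs ht.1) θ)
      (fun t ht => (hr h₀ u (lt_of_lt_of_le hs ht.1) θ).2.1)
    rw [add_sub_cancel_left] at key
    have h3 := self_le_rpow_of_le_one hα₁ hd (by linarith [hes hs])
    have h4 : C₂ * A * d ≤ C₂ * A * d ^ α := mul_le_mul_of_nonneg_left h3 (by positivity)
    have h5 := abs_le.mp key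
    have h6 : 0 ≤ A * d ^ α := by positivity
    simp only [H, G]
    exact abs_le.mpr ⟨by linarith, by linarith⟩
  have hy : ShortHolder α s₀ (2 * (C₂ + C₃ + 21) * A) u.y := by
    refine ⟨fun {s} hs θ => (hr h₀ u hs θ).1.trans (by nlinarith),
      fun {s} hs θ d hd => ((hr h₀ u hs θ).2.2.2.1 d hd).trans ?_, fun {s} hs θ d hd hd' => ?_⟩
    · have h1 : 0 ≤ A * (d ^ α + d * Real.exp ((1 - α) * s)) := by positivity
      have : 0 ≤ C₂ * (A * (d ^ α + d * Real.exp ((1 - α) * s))) := by positivity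
      have : 0 ≤ C₃ * (A * (d ^ α + d * Real.exp ((1 - α) * s))) := by positivity
      linarith
    · rcases hd.eq_or_lt with rfl | hd
      · simp only [add_zero, sub_self, abs_zero]; positivity
      refine (u.abs_y_radial_sub_le hα₀ hα₁ h₀ (M := (C₂ + C₃ + 21) * A) (by positivity) hH hs θ
        hd hd').trans (le_of_eq ?_)
      ring
  have hfs : ShortHolder α s₀ (20 * (C₂ + C₃ + 21) * A) u.fs :=
    (((ShortHolder.exp_neg_two hα₁ h₀).mul hy).congr fun _ _ => u.fs_eq _ _).mono
      (le_of_eq (by ring))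
  have hp1 : 0 ≤ C₁ * A := by positivity
  have hp2 : 0 ≤ C₂ * A := by positivity
  have hp3 : 0 ≤ C₃ * A := by positivity
  refine ⟨hf.mono (by linarith), hy.mono (by linarith), hfs.mono (by linarith), ?_,
    hθθ.mono (by linarith)⟩
  refine ⟨fun {s} hs θ => (hr h₀ u hs θ).2.2.1.trans (by linarith),
    fun {s} hs θ d hd => ((hr h₀ u hs θ).2.2.2.2 d hd).trans
      (mul_le_mul_of_nonneg_right (by linarith) (by positivity)), fun {s} hs θ d hd hd' => ?_⟩
  rcases hd.eq_or_lt with rfl | hd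
  · simp only [add_zero, sub_self, abs_zero]; positivity
  rw [u.fss_eq hs, u.fss_eq (by linarith)]
  have h1 := abs_le.mp (hH s hs θ d hd (by linarith [Real.exp_pos (-s)]))
  have h2 := abs_le.mp (hy.radial hs θ hd.le hd')
  have h3 := abs_le.mp (hfs.radial hs θ hd.le hd')
  have p : 0 ≤ A * d ^ α := by positivity
  have p1 : 0 ≤ C₁ * (A * d ^ α) := by positivity
  have p2 : 0 ≤ C₂ * (A * d ^ α) := by positivity
  have p3 : 0 ≤ C₃ * (A * d ^ α) := by positivity
  exact abs_le.mpr ⟨by linarith, by linarith⟩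

/-! ### The mixed derivative -/

/-- The mixed difference `f(s+d, θ+d) - f(s+d, θ) - f(s, θ+d) + f(s, θ)`. -/
def crossDiff (u : PolarSolution α s₀ A) (d s θ : ℝ) : ℝ :=
  (u.f (s + d) (θ + d) - u.f (s + d) θ) - (u.f s (θ + d) - u.f s θ)

/-- The increment of the mixed difference in `s` is controlled by the Hölder bound of `f_ss` in `θ`.
-/
theorem abs_crossDiff_sub_radial (hα₀ : 0 < α) (hα₁ : α < 1) (h₀ : Real.exp (-s₀) ≤ 3 / 2)
    (u : PolarSolution α s₀ A) {M : ℝ} (h : ShortHolder α s₀ M u.fss) {s : ℝ} (hs : s₀ < s)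
    (θ : ℝ) {d : ℝ} (hd : 0 < d) (hd' : d ≤ Real.exp (-s) / 16) :
    |u.crossDiff d (s + d) θ - u.crossDiff d s θ| ≤ 5 * M * d ^ α * d ^ 2 := by
  have hes := exp_neg_le h₀ hs.le
  have hp := abs_second_difference_le (u := fun t => u.f t (θ + d) - u.f t θ) (x := s) (h := d)
      (M := 5 * M * d ^ α) hd.le
      (fun t ht => (u.hasDerivAt_s (hs.trans_le ht.1) (θ + d)).sub
        (u.hasDerivAt_s (hs.trans_le ht.1) θ))
      (fun t ht => (u.hasDerivAt_ss (hs.trans_le ht.1) (θ + d)).sub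
        (u.hasDerivAt_ss (hs.trans_le ht.1) θ))
      (fun t ht => by
        have h1 := h.angle (hs.trans_le ht.1) θ hd.le
        have h3 : d ^ α + d * Real.exp ((1 - α) * t) ≤ 5 * d ^ α := by
          have h4 : Real.exp ((1 - α) * t) ≤ Real.exp ((1 - α) * s) * 4 := by
            have : Real.exp ((1 - α) * t) =
                Real.exp ((1 - α) * s) * Real.exp ((1 - α) * (t - s)) := by
              rw [← Real.exp_add]; congr 1; ring
            rw [this]
            refine mul_le_mul_of_nonneg_left (exp_le_four ?_) (Real.exp_pos _).le
            have a1 := ht.1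
            have a2 := ht.2
            nlinarith
          have h5 := mul_exp_le_rpow (s := s) hα₁ hd (by linarith [Real.exp_pos (-s)])
          have h6 := mul_le_mul_of_nonneg_left h4 hd.le
          linarith
        have h7 := mul_le_mul_of_nonneg_left h3 h.nonneg
        linarith)
  refine le_of_eq_of_le ?_ hp
  simp only [crossDiff]
  rw [show s + d + d = s + 2 * d by ring]
  congr 1
  ring

/-- The increment of the mixed difference in `θ` is controlled by the Hölder bound of `f_θθ` in `s`.
-/
theorem abs_crossDiff_sub_angle (u : PolarSolution α s₀ A) {M : ℝ}
    (h : ShortHolder α s₀ M u.fθθ) {s : ℝ} (hs : s₀ < s)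
    (θ : ℝ) {d : ℝ} (hd : 0 < d) (hd' : d ≤ Real.exp (-s) / 16) :
    |u.crossDiff d s (θ + d) - u.crossDiff d s θ| ≤ M * d ^ α * d ^ 2 := by
  have hs' : s₀ < s + d := by linarith
  have hp := abs_second_difference_le (u := fun t => u.f (s + d) t - u.f s t) (x := θ) (h := d)
      (M := M * d ^ α) hd.le
      (fun t _ => (u.hasDerivAt_θ hs' t).sub (u.hasDerivAt_θ hs t))
      (fun t _ => (u.hasDerivAt_θθ hs' t).sub (u.hasDerivAt_θθ hs t))
      (fun t _ => h.radial hs t hd.le hd')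
  refine le_of_eq_of_le ?_ hp
  simp only [crossDiff]
  rw [show θ + d + d = θ + 2 * d by ring]
  congr 1
  ring

theorem exists_crossDiff_eq (u : PolarSolution α s₀ A) {s : ℝ} (hs : s₀ < s) (θ : ℝ) {d : ℝ}
    (hd : 0 < d) : ∃ t ∈ Ioo s (s + d), ∃ ϑ ∈ Ioo θ (θ + d),
      u.crossDiff d s θ / d ^ 2 = u.fsθ t ϑ := by
  have h1 : ∀ t ∈ Icc s (s + d), HasDerivAt (fun t => u.f t (θ + d) - u.f t θ)
      (u.fs t (θ + d) - u.fs t θ) t := fun t ht =>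
    (u.hasDerivAt_s (hs.trans_le ht.1) (θ + d)).sub (u.hasDerivAt_s (hs.trans_le ht.1) θ)
  obtain ⟨t, ht, ht'⟩ := exists_hasDerivAt_eq_slope _ _ (by linarith : s < s + d)
    (fun t ht => (h1 t ht).continuousAt.continuousWithinAt)
    fun t ht => h1 t ⟨ht.1.le, ht.2.le⟩
  have hst : s₀ < t := hs.trans ht.1
  obtain ⟨ϑ, hϑ, hϑ'⟩ := exists_hasDerivAt_eq_slope _ _ (by linarith : θ < θ + d)
    (fun x _ => (u.hasDerivAt_sθ hst x).continuousAt.continuousWithinAt)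
    fun x _ => u.hasDerivAt_sθ hst x
  refine ⟨t, ht, ϑ, hϑ, ?_⟩
  rw [hϑ', ht', crossDiff, add_sub_cancel_left, add_sub_cancel_left]
  field_simp

theorem tendsto_crossDiff_div (u : PolarSolution α s₀ A) {s : ℝ} (hs : s₀ < s) (θ : ℝ) :
    Tendsto (fun d => u.crossDiff d s θ / d ^ 2) (𝓝[>] 0) (𝓝 (u.fsθ s θ)) := by
  have hc : ContinuousAt (fun p : ℝ × ℝ => u.fsθ p.1 p.2) (s, θ) :=
    u.continuousOn_fsθ.continuousAt (prod_mem_nhds (Ioi_mem_nhds hs) univ_mem)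
  rw [Metric.tendsto_nhds]
  intro ε hε
  obtain ⟨δ, hδ, hδ'⟩ := Metric.continuousAt_iff.mp hc ε hε
  filter_upwards [Ioo_mem_nhdsGT hδ] with d hd
  obtain ⟨t, ht, ϑ, hϑ, e⟩ := u.exists_crossDiff_eq hs θ hd.1
  rw [e]
  refine hδ' (x := (t, ϑ)) ?_
  rw [Prod.dist_eq, Real.dist_eq, Real.dist_eq]
  refine max_lt ?_ ?_
  · rw [abs_of_pos (by linarith [ht.1])]; linarith [ht.2, hd.2]
  · rw [abs_of_pos (by linarith [hϑ.1])]; linarith [hϑ.2, hd.2]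

/-- The mixed derivative inherits its Hölder bound from the pure second derivatives: both increments
of the mixed difference are `O(d^{2+α})`, so that its quotients by `d²` converge at the rate `d^α`.
-/
theorem exists_shortHolder_mixed (hα₀ : 0 < α) (hα₁ : α < 1) : ∃ C, 1 ≤ C ∧ ∀ {s₀ A : ℝ},
    Real.exp (-s₀) ≤ 3 / 2 → ∀ u : PolarSolution α s₀ A, ShortHolder α s₀ (C * A) u.fsθ := by
  obtain ⟨C₁, hC₁, hb⟩ := exists_shortHolder_pure hα₀ hα₁
  have ht1 : (2 : ℝ) ^ (-α) < 1 := Real.rpow_lt_one_of_one_lt_of_neg one_lt_two (by linarith)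
  set c := 5 * C₁ / (1 - 2 ^ (-α)) with hc
  have hc0 : 0 ≤ c := div_nonneg (by linarith) (by linarith)
  refine ⟨4 * (32 * (3 * c + 50 * C₁)), by linarith, fun {s₀ A} h₀ u => ?_⟩
  obtain ⟨-, -, hfs, hfss, hfθθ⟩ := hb h₀ u
  have hA := u.A_nonneg
  have hes : ∀ {s}, s₀ < s → Real.exp (-s) ≤ 3 / 2 := fun hs => exp_neg_le h₀ (le_of_lt hs)
  have hhalf : ∀ {s d : ℝ}, s₀ < s → 0 < d → d ≤ Real.exp (-s) / 32 →
      d ≤ Real.exp (-(s + d)) / 16 := by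
    intro s d hs hd hd'
    have h1 : Real.exp (-(s + d)) = Real.exp (-s) * Real.exp (-d) := by
      rw [← Real.exp_add]; congr 1; ring
    have h2 := Real.one_sub_le_exp_neg d
    have h3 := hes hs
    rw [h1]
    nlinarith [Real.exp_pos (-s)]
  -- the difference quotients form a Cauchy sequence under halving of the step
  have hquot : ∀ {s}, s₀ < s → ∀ θ {d}, 0 < d → d ≤ Real.exp (-s) / 16 →
      |u.crossDiff d s θ / d ^ 2 - u.fsθ s θ| ≤ c * A * d ^ α := by
    intro s hs θ d hd hd'
    have key := abs_sub_limit_le_of_dyadic (q := fun d => u.crossDiff d s θ / d ^ 2)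
      (C := 5 * C₁ * A) (h₀ := Real.exp (-s) / 16) hα₀ (fun h hh hh' => ?_)
      (u.tendsto_crossDiff_div hs θ) hd hd'
    · refine key.trans (le_of_eq ?_)
      rw [hc]; ring
    · set η := h / 2 with hη
      have hη0 : 0 < η := by positivity
      have hη1 : η ≤ Real.exp (-s) / 32 := by rw [hη]; linarith
      have hη2 : η ≤ Real.exp (-s) / 16 := by linarith
      have e : h = 2 * η := by rw [hη]; ring
      have a1 := abs_le.mp (u.abs_crossDiff_sub_radial hα₀ hα₁ h₀ hfss hs θ hη0 hη2)
      have a2 := abs_le.mp (u.abs_crossDiff_sub_angle hfθθ hs θ hη0 hη2)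
      have a3 := abs_le.mp (u.abs_crossDiff_sub_angle hfθθ (s := s + η) (by linarith) θ hη0
        (hhalf hs hη0 hη1))
      have e1 : u.crossDiff h s θ = u.crossDiff η s θ + u.crossDiff η (s + η) θ +
          u.crossDiff η s (θ + η) + u.crossDiff η (s + η) (θ + η) := by
        simp only [crossDiff, e]
        rw [show s + η + η = s + 2 * η by ring, show θ + η + η = θ + 2 * η by ring]
        ring
      have e2 : u.crossDiff h s θ / h ^ 2 - u.crossDiff η s θ / η ^ 2 =
          (2 * (u.crossDiff η (s + η) θ - u.crossDiff η s θ) +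
            (u.crossDiff η s (θ + η) - u.crossDiff η s θ) +
            (u.crossDiff η (s + η) (θ + η) - u.crossDiff η (s + η) θ)) / (4 * η ^ 2) := by
        rw [e1, e]
        field_simp
        ring
      have hpos : 0 < 4 * η ^ 2 := by positivity
      rw [e2, abs_div, abs_of_pos hpos, div_le_iff₀ hpos]
      have h3 : η ^ α ≤ h ^ α := Real.rpow_le_rpow hη0.le (by linarith) hα₀.le
      have h4 : C₁ * A * η ^ α * η ^ 2 ≤ C₁ * A * h ^ α * η ^ 2 := by gcongr
      have h5 : 0 ≤ C₁ * A * h ^ α * η ^ 2 := by positivity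
      exact abs_le.mpr ⟨by linarith, by linarith⟩
  have hcA : 0 ≤ c * A := by positivity
  have hCA : 0 ≤ C₁ * A := by positivity
  refine (ShortHolder.of_radial_short (C := 32 * (3 * c + 50 * C₁) * A) hα₀ h₀ (by positivity)
    (fun {s} hs θ => ?_) (fun {s} hs θ d hd => ?_) fun {s} hs θ d hd hd' => ?_).mono
    (le_of_eq (by ring))
  · -- at step `e^{-s} / 16` the difference quotient is bounded through `f_s`
    set δ := Real.exp (-s) / 16 with hδ
    have hes' := hes hs
    have hδ0 : 0 < δ := by positivity
    have h1 := abs_le.mp (hquot hs θ hδ0 le_rfl)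
    have h2 : δ ^ α ≤ 1 := Real.rpow_le_one hδ0.le (by linarith) hα₀.le
    have h3 : c * A * δ ^ α ≤ c * A * 1 := mul_le_mul_of_nonneg_left h2 hcA
    have h4 : ∀ ϑ, |u.f (s + δ) ϑ - u.f s ϑ| ≤ C₁ * A * Real.exp (-(2 * s)) * δ := by
      intro ϑ
      have := abs_sub_le_of_hasDerivAt (u := fun t => u.f t ϑ) (a := s) (b := s + δ)
        (M := C₁ * A * Real.exp (-(2 * s))) (by linarith)
        (fun t ht => u.hasDerivAt_s (hs.trans_le ht.1) ϑ) (fun t ht => by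
          rw [u.fs_eq, abs_mul, abs_of_pos (Real.exp_pos _), mul_comm]
          exact mul_le_mul ((hb h₀ u).2.1.bdd (hs.trans_le ht.1) ϑ)
            (Real.exp_le_exp.mpr (by linarith [ht.1])) (Real.exp_pos _).le (by positivity))
      simpa using this
    have h5 : |u.crossDiff δ s θ / δ ^ 2| ≤ 48 * C₁ * A := by
      have hδ2 : 0 < δ ^ 2 := by positivity
      have a := abs_le.mp (h4 θ)
      have b := abs_le.mp (h4 (θ + δ))
      rw [abs_div, abs_of_pos hδ2, div_le_iff₀ hδ2]
      have e1 : Real.exp (-(2 * s)) = (16 * δ) ^ 2 := by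
        rw [hδ, show 16 * (Real.exp (-s) / 16) = Real.exp (-s) by ring, ← Real.exp_nat_mul]
        congr 1; push_cast; ring
      have e2 : C₁ * A * Real.exp (-(2 * s)) * δ ≤ 24 * (C₁ * A) * δ ^ 2 := by
        rw [e1]
        have : 16 * δ ≤ 3 / 2 := by rw [hδ]; linarith
        have : C₁ * A * δ ^ 2 * (16 * (16 * δ)) ≤ C₁ * A * δ ^ 2 * (16 * (3 / 2)) := by gcongr
        linarith
      unfold crossDiff
      exact abs_le.mpr ⟨by linarith, by linarith⟩
    have h5' := abs_le.mp h5
    exact abs_le.mpr ⟨by linarith, by linarith⟩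
  · have key := abs_sub_le_of_holder_short (u := u.fsθ s) (C := (3 * c + 50 * C₁) * A)
      (ℓ := Real.exp (-s) / 16) (by positivity) hα₀ (by positivity) (fun ϑ δ hδ hδ' => ?_) (x := θ)
      hd
    · refine key.trans ?_
      have e1 : (Real.exp (-s) / 16) ^ (α - 1) ≤ 16 * Real.exp ((1 - α) * s) := by
        rw [Real.div_rpow (Real.exp_pos _).le (by norm_num), ← Real.exp_mul,
          show -s * (α - 1) = (1 - α) * s by ring, div_eq_mul_inv, ← Real.rpow_neg (by norm_num),
          mul_comm]
        refine mul_le_mul_of_nonneg_right ?_ (Real.exp_pos _).le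
        simpa using Real.rpow_le_rpow_of_exponent_le (by norm_num : (1 : ℝ) ≤ 16)
          (by linarith : -(α - 1) ≤ 1)
      have e2 := mul_le_mul_of_nonneg_left e1 hd
      have e3 : d ^ α + d * (Real.exp (-s) / 16) ^ (α - 1) ≤
          16 * (d ^ α + d * Real.exp ((1 - α) * s)) := by
        have := Real.rpow_nonneg hd α
        linarith
      have e4 := mul_le_mul_of_nonneg_left e3 (by positivity : 0 ≤ 2 * ((3 * c + 50 * C₁) * A))
      linarith
    · rcases hδ.eq_or_lt with rfl | hδ
      · simp only [add_zero, sub_self, abs_zero]; positivity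
      have a := abs_le.mp (hquot hs ϑ hδ hδ')
      have b := abs_le.mp (hquot hs (ϑ + δ) hδ hδ')
      have hδ2 : 0 < δ ^ 2 := by positivity
      have e : |u.crossDiff δ s (ϑ + δ) / δ ^ 2 - u.crossDiff δ s ϑ / δ ^ 2| ≤
          C₁ * A * δ ^ α := by
        rw [← sub_div, abs_div, abs_of_pos hδ2, div_le_iff₀ hδ2]
        exact u.abs_crossDiff_sub_angle hfθθ hs ϑ hδ hδ'
      have e' := abs_le.mp e
      have p : 0 ≤ c * A * δ ^ α := by positivity
      have p' : 0 ≤ C₁ * A * δ ^ α := by positivity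
      exact abs_le.mpr ⟨by linarith, by linarith⟩
  · have hd16 : d ≤ Real.exp (-s) / 16 := by linarith
    have a := abs_le.mp (hquot hs θ hd hd16)
    have b := abs_le.mp (hquot (s := s + d) (by linarith) θ hd (hhalf hs hd hd'))
    have hδ2 : 0 < d ^ 2 := by positivity
    have e : |u.crossDiff d (s + d) θ / d ^ 2 - u.crossDiff d s θ / d ^ 2| ≤
        5 * (C₁ * A) * d ^ α := by
      rw [← sub_div, abs_div, abs_of_pos hδ2, div_le_iff₀ hδ2]
      exact u.abs_crossDiff_sub_radial hα₀ hα₁ h₀ hfss hs θ hd hd16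
    have e' := abs_le.mp e
    have p : 0 ≤ c * A * d ^ α := by positivity
    have p' : 0 ≤ C₁ * A * d ^ α := by positivity
    exact abs_le.mpr ⟨by linarith, by linarith⟩

end PolarSolution

end

noncomputable section

theorem abs_sub_le_sub_of_abs_hasDerivAt_le {D D' B B' : ℝ → ℝ} {a b : ℝ} (hab : a ≤ b)
    (h1 : ∀ x ∈ Icc a b, HasDerivAt D (D' x) x) (h2 : ∀ x ∈ Icc a b, HasDerivAt B (B' x) x)
    (h3 : ∀ x ∈ Icc a b, |D' x| ≤ B' x) : |D b - D a| ≤ B b - B a := by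
  have mono : ∀ z z' : ℝ → ℝ, (∀ x ∈ Icc a b, HasDerivAt z (z' x) x) →
      (∀ x ∈ Icc a b, 0 ≤ z' x) → z a ≤ z b := by
    intro z z' hz hz'
    have : MonotoneOn z (Icc a b) := by
      refine monotoneOn_of_deriv_nonneg (convex_Icc a b)
        (fun x hx => (hz x hx).continuousAt.continuousWithinAt)
        (fun x hx => (hz x (interior_subset hx)).differentiableAt.differentiableWithinAt)
        fun x hx => ?_
      rw [(hz x (interior_subset hx)).deriv]
      exact hz' x (interior_subset hx)
    exact this (left_mem_Icc.mpr hab) (right_mem_Icc.mpr hab) hab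
  have e1 := mono (fun x => B x - D x) _ (fun x hx => (h2 x hx).sub (h1 x hx))
    fun x hx => by linarith [le_abs_self (D' x), h3 x hx]
  have e2 := mono (fun x => B x + D x) _ (fun x hx => (h2 x hx).add (h1 x hx))
    fun x hx => by linarith [neg_abs_le (D' x), h3 x hx]
  exact abs_le.mpr ⟨by linarith, by linarith⟩

theorem exists_uniform_limit {F : ℝ → ℝ → ℝ} {ρ : ℝ → ℝ} {s₁ : ℝ}
    (hF : ∀ s ≥ s₁, ∀ t ≥ s, ∀ θ, |F t θ - F s θ| ≤ ρ s) (hρ : Tendsto ρ atTop (𝓝 0)) :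
    ∃ L : ℝ → ℝ, TendstoUniformly F L atTop ∧ ∀ s ≥ s₁, ∀ θ, |F s θ - L θ| ≤ ρ s := by
  have hex : ∀ θ, ∃ l, Tendsto (fun s => F s θ) atTop (𝓝 l) := by
    intro θ
    refine cauchySeq_tendsto_of_complete (Metric.cauchySeq_iff'.mpr fun ε hε => ?_)
    obtain ⟨N, hN⟩ := ((hρ.eventually (gt_mem_nhds hε)).and (eventually_ge_atTop s₁)).exists
    refine ⟨N, fun n hn => ?_⟩
    rw [Real.dist_eq]
    exact (hF N hN.2 n hn θ).trans_lt hN.1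
  choose L hL using hex
  have hb : ∀ s ≥ s₁, ∀ θ, |F s θ - L θ| ≤ ρ s := by
    intro s hs θ
    rw [abs_sub_comm]
    exact le_of_tendsto ((hL θ).sub_const _).abs
      ((eventually_ge_atTop s).mono fun t ht => hF s hs t ht θ)
  refine ⟨L, ?_, hb⟩
  rw [Metric.tendstoUniformly_iff]
  intro ε hε
  filter_upwards [hρ.eventually (gt_mem_nhds hε), eventually_ge_atTop s₁] with s hs hs' θ
  rw [dist_comm, Real.dist_eq]
  exact (hb s hs' θ).trans_lt hs

theorem tendsto_exp_neg_mul {a : ℝ} (ha : 0 < a) :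
    Tendsto (fun s : ℝ => Real.exp (-(a * s))) atTop (𝓝 0) :=
  Real.tendsto_exp_neg_atTop_nhds_zero.comp (tendsto_id.const_mul_atTop ha)

theorem hasDerivAt_exp_neg_mul (a s : ℝ) :
    HasDerivAt (fun s : ℝ => Real.exp (-(a * s))) (-(a * Real.exp (-(a * s)))) s := by
  refine ((hasDerivAt_id s).const_mul a).neg.exp.congr_deriv ?_
  simp only [id, Pi.neg_apply]
  ring

namespace PolarSolution

variable {α s₀ A : ℝ}

/-! ### The asymptotic cone -/

/-- The limit `φ` of `f(s, ·)` as `s → ∞`, with its derivatives and the rates of convergence. -/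
structure Profile (u : PolarSolution α s₀ A) (C : ℝ) where
  (φ φ' φ'' : ℝ → ℝ)
  hasDerivAt : ∀ θ, HasDerivAt φ (φ' θ) θ
  hasDerivAt' : ∀ θ, HasDerivAt φ' (φ'' θ) θ
  periodic : ∀ θ, φ (θ + 2 * Real.pi) = φ θ
  φ_le : ∀ θ, |φ θ| ≤ C * A
  φ'_le : ∀ θ, |φ' θ| ≤ C * A
  φ''_le : ∀ θ, |φ'' θ| ≤ C * A
  φ''_holder : ∀ θ d, 0 ≤ d → |φ'' (θ + d) - φ'' θ| ≤ C * A * d ^ α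
  diff : ShortHolder α s₀ (C * A) fun s θ => Real.exp (2 * s) * (u.f s θ - φ θ)
  diff_θ : ∀ {s}, s₀ < s → ∀ θ, |u.fθ s θ - φ' θ| ≤ C * A * Real.exp (-s)
  diff_θθ : ShortHolder α s₀ (C * A) fun s θ => u.fθθ s θ - φ'' θ

/-- The profile exists and is twice differentiable: `f` converges at the rate `e^{-2s}`, which
carries over to `f_θθ` through difference quotients and to `f_θ` by interpolation. -/
theorem exists_profile_aux (hα₀ : 0 < α)
    (u : PolarSolution α s₀ A) {K : ℝ} (hK : 0 ≤ K)
    (hy : ∀ s > s₀, ∀ θ, |u.y s θ| ≤ K)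
    (hq : ∀ s > s₀, ∀ θ h, 0 < h → h ≤ 1 →
      |secondDiff (u.f s) h θ / h ^ 2 - u.fθθ s θ| ≤ K * h ^ α) :
    ∃ φ φ' φ'' : ℝ → ℝ, (∀ θ, HasDerivAt φ (φ' θ) θ) ∧ (∀ θ, HasDerivAt φ' (φ'' θ) θ) ∧
      (∀ s > s₀, ∀ θ, |u.f s θ - φ θ| ≤ K * Real.exp (-(2 * s))) ∧
      ∀ θ, Tendsto (fun s => u.fθθ s θ) atTop (𝓝 (φ'' θ)) := by
  have hf : ∀ s > s₀, ∀ t ≥ s, ∀ θ, |u.f t θ - u.f s θ| ≤ K * Real.exp (-(2 * s)) := by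
    intro s hs t ht θ
    have key := abs_sub_le_sub_of_abs_hasDerivAt_le (D := fun t => u.f t θ)
      (B := fun t => -(K / 2) * Real.exp (-(2 * t))) ht
      (fun x hx => u.hasDerivAt_s (lt_of_lt_of_le hs hx.1) θ)
      (fun x _ => (hasDerivAt_exp_neg_mul 2 x).const_mul (-(K / 2))) (fun x hx => by
        rw [u.fs_eq, abs_mul, abs_of_pos (Real.exp_pos _)]
        have := mul_le_mul_of_nonneg_left (hy x (lt_of_lt_of_le hs hx.1) θ)
          (Real.exp_pos (-(2 * x))).le
        linarith)
    have p1 : 0 ≤ K * Real.exp (-(2 * t)) := by positivity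
    have p2 : 0 ≤ K * Real.exp (-(2 * s)) := by positivity
    linarith
  set s₁ : ℝ := max 0 (s₀ + 1) with hs₁
  have hs₁0 : ∀ s ≥ s₁, 0 ≤ s := fun s hs => (le_max_left _ _).trans hs
  have hs₁1 : ∀ s ≥ s₁, s₀ < s := fun s hs =>
    lt_of_lt_of_le (lt_add_one s₀) ((le_max_right _ _).trans hs)
  -- the comparison of second derivatives through difference quotients of step `e^{-s/2}`
  have hθθ : ∀ s ≥ s₁, ∀ t ≥ s, ∀ θ, |u.fθθ t θ - u.fθθ s θ| ≤
      2 * K * Real.exp (-(α / 2 * s)) + 4 * K * Real.exp (-(1 * s)) := by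
    intro s hs t ht θ
    have hs0 := hs₁1 s hs
    set h := Real.exp (-(1 / 2 * s)) with hh
    have hh0 : 0 < h := Real.exp_pos _
    have hh1 : h ≤ 1 := Real.exp_le_one_iff.mpr (by linarith [hs₁0 s hs])
    have a := abs_le.mp (hq s hs0 θ h hh0 hh1)
    have b := abs_le.mp (hq t (lt_of_lt_of_le hs0 ht) θ h hh0 hh1)
    have e1 : h ^ α = Real.exp (-(α / 2 * s)) := by
      rw [hh, ← Real.exp_mul]; congr 1; ring
    have e2 : |secondDiff (u.f t) h θ / h ^ 2 - secondDiff (u.f s) h θ / h ^ 2| ≤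
        4 * K * Real.exp (-(1 * s)) := by
      have hpos : 0 < h ^ 2 := pow_pos hh0 2
      have c1 := abs_le.mp (hf s hs0 t ht (θ + h))
      have c2 := abs_le.mp (hf s hs0 t ht θ)
      have c3 := abs_le.mp (hf s hs0 t ht (θ - h))
      have e3 : Real.exp (-(2 * s)) = Real.exp (-(1 * s)) * h ^ 2 := by
        rw [hh, ← Real.exp_nat_mul, ← Real.exp_add]; congr 1; push_cast; ring
      rw [← sub_div, abs_div, abs_of_pos hpos, div_le_iff₀ hpos]
      have e4 : 4 * K * Real.exp (-(1 * s)) * h ^ 2 = 4 * (K * Real.exp (-(2 * s))) := by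
        rw [e3]; ring
      rw [e4]
      unfold secondDiff
      exact abs_le.mpr ⟨by linarith, by linarith⟩
    have e2' := abs_le.mp e2
    rw [e1] at a b
    exact abs_le.mpr ⟨by linarith, by linarith⟩
  have hθ : ∀ s ≥ s₁, ∀ t ≥ s, ∀ θ, |u.fθ t θ - u.fθ s θ| ≤
      2 * K * Real.exp (-(2 * s)) +
        (2 * K * Real.exp (-(α / 2 * s)) + 4 * K * Real.exp (-(1 * s))) := by
    intro s hs t ht θ
    have hs0 := hs₁1 s hs
    have ht0 := lt_of_lt_of_le hs0 ht
    have a := abs_le.mp (hf s hs0 t ht (θ + 1))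
    have b := abs_le.mp (hf s hs0 t ht θ)
    have key := abs_deriv_le_of_abs_second_deriv_le (w := fun x => u.f t x - u.f s x) (x := θ)
      (N := 2 * K * Real.exp (-(2 * s))) one_pos
      (fun y => (u.hasDerivAt_θ ht0 y).sub (u.hasDerivAt_θ hs0 y))
      (fun y => (u.hasDerivAt_θθ ht0 y).sub (u.hasDerivAt_θθ hs0 y)) (hθθ s hs t ht)
      (abs_le.mpr ⟨by linarith, by linarith⟩)
    simpa using key
  have l1 : Tendsto (fun s => K * Real.exp (-(2 * s))) atTop (𝓝 0) := by
    simpa using (tendsto_exp_neg_mul two_pos).const_mul K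
  have l2 : Tendsto (fun s => 2 * K * Real.exp (-(α / 2 * s)) + 4 * K * Real.exp (-(1 * s)))
      atTop (𝓝 0) := by
    simpa using ((tendsto_exp_neg_mul (half_pos hα₀)).const_mul (2 * K)).add
      ((tendsto_exp_neg_mul one_pos).const_mul (4 * K))
  have l3 : Tendsto (fun s => 2 * K * Real.exp (-(2 * s)) +
      (2 * K * Real.exp (-(α / 2 * s)) + 4 * K * Real.exp (-(1 * s)))) atTop (𝓝 0) := by
    simpa using ((tendsto_exp_neg_mul two_pos).const_mul (2 * K)).add l2
  obtain ⟨φ, hφ, -⟩ := exists_uniform_limit (fun s hs => hf s (hs₁1 s hs)) l1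
  obtain ⟨φ', hφ', -⟩ := exists_uniform_limit hθ l3
  obtain ⟨φ'', hφ'', -⟩ := exists_uniform_limit hθθ l2
  refine ⟨φ, φ', φ'', ?_, ?_, fun s hs θ => ?_, fun θ => hφ''.tendsto_at θ⟩
  · exact hasDerivAt_of_tendstoUniformly hφ'
      ((eventually_gt_atTop s₀).mono fun s hs x => u.hasDerivAt_θ hs x)
      fun x => hφ.tendsto_at x
  · exact hasDerivAt_of_tendstoUniformly hφ''
      ((eventually_gt_atTop s₀).mono fun s hs x => u.hasDerivAt_θθ hs x)
      fun x => hφ'.tendsto_at x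
  · rw [abs_sub_comm]
    exact le_of_tendsto ((hφ.tendsto_at θ).sub_const _).abs
      ((eventually_ge_atTop s).mono fun t ht => hf s hs t ht θ)

/-- The profile exists, with bounds for the rates of convergence in which `A` enters linearly. -/
theorem exists_profile (hα₀ : 0 < α) (hα₁ : α < 1) : ∃ C, 1 ≤ C ∧ ∀ {s₀ A : ℝ},
    Real.exp (-s₀) ≤ 3 / 2 → ∀ u : PolarSolution α s₀ A, Nonempty (u.Profile C) := by
  obtain ⟨C₁, hC₁, hb⟩ := exists_shortHolder_pure hα₀ hα₁
  obtain ⟨C₂, hC₂, hc⟩ := exists_fθθ_bounds hα₀ hα₁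
  refine ⟨100 * (C₁ + C₂), by linarith, fun {s₀ A} h₀ u => ?_⟩
  have hA := u.A_nonneg
  obtain ⟨hf, hy, -, -, hθθ⟩ := hb h₀ u
  set K := (C₁ + C₂) * A with hKdef
  have hK0 : 0 ≤ K := by positivity
  have k1 : C₁ * A ≤ K := by rw [hKdef]; nlinarith
  have k2 : C₂ * A ≤ K := by rw [hKdef]; nlinarith
  have hC : 100 * (C₁ + C₂) * A = 100 * K := by rw [hKdef]; ring
  have hf := hf.mono k1
  have hy := hy.mono k1
  have hθθ := hθθ.mono k1
  have hes : ∀ {s}, s₀ < s → Real.exp (-s) ≤ 3 / 2 := fun hs => exp_neg_le h₀ (le_of_lt hs)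
  obtain ⟨φ, φ', φ'', h1, h2, h3, h4⟩ := u.exists_profile_aux hα₀ (K := K) hK0
    (fun s hs θ => hy.bdd hs θ) (fun s hs θ h hh hh' => ((hc h₀ u hs θ).2.2 h hh hh').trans
      (mul_le_mul_of_nonneg_right k2 (Real.rpow_nonneg hh.le _)))
  have hφ0 : ∀ θ, Tendsto (fun s => u.f s θ) atTop (𝓝 (φ θ)) := by
    intro θ
    rw [tendsto_iff_norm_sub_tendsto_zero]
    refine squeeze_zero' (Eventually.of_forall fun _ => norm_nonneg _)
      ((eventually_gt_atTop s₀).mono fun s hs => h3 s hs θ) ?_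
    simpa using (tendsto_exp_neg_mul two_pos).const_mul K
  have hφ : ∀ θ, |φ θ| ≤ K := fun θ => le_of_tendsto (hφ0 θ).abs
    ((eventually_gt_atTop s₀).mono fun s hs => hf.bdd hs θ)
  have hφ'' : ∀ θ, |φ'' θ| ≤ K := fun θ => le_of_tendsto (h4 θ).abs
    ((eventually_gt_atTop s₀).mono fun s hs => hθθ.bdd hs θ)
  have hφ''h : ∀ θ d, 0 ≤ d → |φ'' (θ + d) - φ'' θ| ≤ K * d ^ α := fun θ d hd =>
    le_of_tendsto ((h4 (θ + d)).sub (h4 θ)).abs ((eventually_gt_atTop s₀).mono fun s hs =>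
      ((hc h₀ u hs θ).2.1 d hd).trans (mul_le_mul_of_nonneg_right k2 (Real.rpow_nonneg hd _)))
  have hφ' : ∀ θ, |φ' θ| ≤ 3 * K := by
    intro θ
    have a := abs_le.mp (hφ (θ + 1))
    have b := abs_le.mp (hφ θ)
    have := abs_deriv_le_of_abs_second_deriv_le (x := θ) (N := 2 * K) one_pos h1 h2 hφ''
      (abs_le.mpr ⟨by linarith, by linarith⟩)
    linarith
  -- the convergence is faster in differences: integrate the modulus of continuity of `f_s`
  have hp : ∀ s > s₀, ∀ θ d, 0 ≤ d → |(u.f s (θ + d) - φ (θ + d)) - (u.f s θ - φ θ)| ≤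
      K * (Real.exp (-(2 * s)) * (d ^ α + d * Real.exp ((1 - α) * s))) := by
    intro s hs θ d hd
    have e1 : ∀ t : ℝ, Real.exp (-((1 + α) * t)) =
        Real.exp (-(2 * t)) * Real.exp ((1 - α) * t) := by
      intro t; rw [← Real.exp_add]; congr 1; ring
    have hα1 : 0 < 1 + α := by linarith
    have key := abs_le_of_abs_hasDerivAt_le (x₀ := s₀)
      (D := fun s => (u.f s (θ + d) - φ (θ + d)) - (u.f s θ - φ θ))
      (B := fun s => K * (d ^ α / 2 * Real.exp (-(2 * s)) +
        d / (1 + α) * Real.exp (-((1 + α) * s))))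
      (fun t ht => ((u.hasDerivAt_s ht (θ + d)).sub_const _).sub
        ((u.hasDerivAt_s ht θ).sub_const _))
      (fun t _ => (((hasDerivAt_exp_neg_mul 2 t).const_mul _).add
        ((hasDerivAt_exp_neg_mul (1 + α) t).const_mul _)).const_mul K)
      (fun t ht => by
        have a := mul_le_mul_of_nonneg_left (hy.angle ht θ hd) (Real.exp_pos (-(2 * t))).le
        rw [u.fs_eq, u.fs_eq, ← mul_sub, abs_mul, abs_of_pos (Real.exp_pos _)]
        refine a.trans (le_of_eq ?_)
        rw [e1]
        field_simp
        ring)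
      (by simpa using (((hφ0 (θ + d)).sub_const (φ (θ + d))).sub ((hφ0 θ).sub_const (φ θ))))
      (by simpa using (((tendsto_exp_neg_mul two_pos).const_mul (d ^ α / 2)).add
        ((tendsto_exp_neg_mul hα1).const_mul (d / (1 + α)))).const_mul K) hs
    refine key.trans (mul_le_mul_of_nonneg_left ?_ hK0)
    have q1 : d ^ α / 2 * Real.exp (-(2 * s)) ≤ d ^ α * Real.exp (-(2 * s)) := by
      have : 0 ≤ d ^ α * Real.exp (-(2 * s)) := by positivity
      linarith
    have q2 : d / (1 + α) * Real.exp (-((1 + α) * s)) ≤ d * Real.exp (-((1 + α) * s)) :=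
      mul_le_mul_of_nonneg_right (div_le_self hd (by linarith)) (Real.exp_pos _).le
    rw [e1] at q2 ⊢
    linarith
  have hcancel : ∀ s : ℝ, Real.exp (2 * s) * Real.exp (-(2 * s)) = 1 := fun s => by
    rw [← Real.exp_add]; simp
  have hP : ∀ s > s₀, ∀ θ, |Real.exp (2 * s) * (u.f s θ - φ θ)| ≤ K := by
    intro s hs θ
    rw [abs_mul, abs_of_pos (Real.exp_pos _)]
    have := mul_le_mul_of_nonneg_left (h3 s hs θ) (Real.exp_pos (2 * s)).le
    have e : Real.exp (2 * s) * (K * Real.exp (-(2 * s))) = K := by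
      rw [mul_left_comm, hcancel, mul_one]
    linarith
  refine ⟨⟨φ, φ', φ'', h1, h2, fun θ => ?_, fun θ => (hφ θ).trans (by linarith),
    fun θ => (hφ' θ).trans (by linarith), fun θ => (hφ'' θ).trans (by linarith),
    fun θ d hd => (hφ''h θ d hd).trans ?_, ?_, fun {s} hs θ => ?_, ?_⟩⟩
  · refine tendsto_nhds_unique (hφ0 (θ + 2 * Real.pi)) ((hφ0 θ).congr' ?_)
    filter_upwards [eventually_ge_atTop s₀] with s hs
    exact (u.f_periodic hs θ).symm
  · rw [hC]
    exact mul_le_mul_of_nonneg_right (by linarith) (Real.rpow_nonneg hd _)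
  · rw [hC]
    refine ⟨fun {s} hs θ => (hP s hs θ).trans (by linarith), fun {s} hs θ d hd => ?_,
      fun {s} hs θ d hd hd' => ?_⟩
    · rw [← mul_sub, abs_mul, abs_of_pos (Real.exp_pos _)]
      have a := mul_le_mul_of_nonneg_left (hp s hs θ d hd) (Real.exp_pos (2 * s)).le
      have e : Real.exp (2 * s) * (K * (Real.exp (-(2 * s)) *
          (d ^ α + d * Real.exp ((1 - α) * s)))) = K * (d ^ α + d * Real.exp ((1 - α) * s)) := by
        linear_combination (K * (d ^ α + d * Real.exp ((1 - α) * s))) * hcancel s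
      have : 0 ≤ K * (d ^ α + d * Real.exp ((1 - α) * s)) := by positivity
      linarith
    · rcases hd.eq_or_lt with rfl | hd
      · simp only [add_zero, sub_self, abs_zero]; positivity
      have key := abs_sub_le_of_hasDerivAt (u := fun t => Real.exp (2 * t) * (u.f t θ - φ θ))
        (a := s) (b := s + d) (M := 3 * K) (by linarith)
        (fun t ht => (((hasDerivAt_id t).const_mul 2).exp).mul
          ((u.hasDerivAt_s (hs.trans_le ht.1) θ).sub_const (φ θ)))
        (fun t ht => by
          have a := abs_le.mp (hP t (hs.trans_le ht.1) θ)
          have b := abs_le.mp (hy.bdd (hs.trans_le ht.1) θ)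
          rw [y] at b
          simp only [id]
          exact abs_le.mpr ⟨by linarith, by linarith⟩)
      rw [add_sub_cancel_left] at key
      refine key.trans ?_
      have := self_le_rpow_of_le_one hα₁ hd (by linarith [hes hs])
      have := mul_le_mul_of_nonneg_left this hK0
      have : 0 ≤ K * d ^ α := by positivity
      linarith
  · rw [hC]
    -- Interpolation at scale `e^{-s}`, with second derivatives that are merely bounded.
    have key := abs_deriv_le_of_abs_second_deriv_le (w := fun x => u.f s x - φ x) (x := θ)
      (h := Real.exp (-s)) (Real.exp_pos _) (fun y => (u.hasDerivAt_θ hs y).sub (h1 y))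
      (fun y => (u.hasDerivAt_θθ hs y).sub (h2 y)) (M := 2 * K) (fun y => by
        have a := abs_le.mp (hθθ.bdd hs y)
        have b := abs_le.mp (hφ'' y)
        exact abs_le.mpr ⟨by linarith, by linarith⟩)
      (hp s hs θ (Real.exp (-s)) (Real.exp_pos _).le)
    refine key.trans ?_
    have e1 : Real.exp (-s) ^ α = Real.exp (-(α * s)) := by
      rw [← Real.exp_mul]; congr 1; ring
    have e2 : Real.exp (-s) * Real.exp ((1 - α) * s) = Real.exp (-(α * s)) := by
      rw [← Real.exp_add]; congr 1; ring
    have e3 : Real.exp (-(2 * s)) = Real.exp (-s) * Real.exp (-s) := by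
      rw [← Real.exp_add]; congr 1; ring
    have e4 : Real.exp (-(α * s)) ≤ 3 / 2 := by
      rcases le_total s 0 with h | h
      · refine le_trans (Real.exp_le_exp.mpr ?_) (hes hs)
        nlinarith
      · refine le_trans (Real.exp_le_one_iff.mpr ?_) (by norm_num)
        nlinarith
    have e5 : K * (Real.exp (-(2 * s)) * (Real.exp (-s) ^ α +
        Real.exp (-s) * Real.exp ((1 - α) * s))) / Real.exp (-s) =
        K * Real.exp (-s) * (2 * Real.exp (-(α * s))) := by
      rw [e1, e2, e3]
      have := (Real.exp_pos (-s)).ne'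
      field_simp
      ring
    rw [e5]
    have p : 0 ≤ K * Real.exp (-s) := by positivity
    have := mul_le_mul_of_nonneg_left e4 p
    linarith
  · rw [hC]
    have hφs : ShortHolder α s₀ K fun _ θ => φ'' θ := by
      refine ⟨fun _ θ => hφ'' θ, fun {s} _ θ d hd => (hφ''h θ d hd).trans ?_,
        fun {s} _ θ d hd _ => ?_⟩
      · have : 0 ≤ K * (d * Real.exp ((1 - α) * s)) := by positivity
        linarith
      · simp only [sub_self, abs_zero]; positivity
    exact (hθθ.sub hφs).mono (by linarith)

end PolarSolution

end

/-! ### Logarithmic polar coordinates -/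

noncomputable section

/-- The point `e^s (cos θ, sin θ)` with logarithmic polar coordinates `(s, θ)`. -/
def logPolar (s θ : ℝ) : Plane :=
  !₂[Real.exp s * Real.cos θ, Real.exp s * Real.sin θ]

/-- The rotation of `logPolar s θ` by a right angle. -/
def logPolarPerp (s θ : ℝ) : Plane :=
  !₂[-(Real.exp s * Real.sin θ), Real.exp s * Real.cos θ]

theorem norm_logPolar (s θ : ℝ) : ‖logPolar s θ‖ = Real.exp s := by
  rw [EuclideanSpace.norm_eq, Real.sqrt_eq_iff_mul_self_eq (by positivity) (Real.exp_pos s).le]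
  simp [logPolar, Fin.sum_univ_two]
  linear_combination (Real.exp s ^ 2) * Real.sin_sq_add_cos_sq θ

theorem norm_logPolarPerp (s θ : ℝ) : ‖logPolarPerp s θ‖ = Real.exp s := by
  rw [EuclideanSpace.norm_eq, Real.sqrt_eq_iff_mul_self_eq (by positivity) (Real.exp_pos s).le]
  simp [logPolarPerp, Fin.sum_univ_two]
  linear_combination (Real.exp s ^ 2) * Real.sin_sq_add_cos_sq θ

theorem logPolar_mem_exteriorDomain {R s : ℝ} (hR : 0 < R) (hs : Real.log R < s) (θ : ℝ) :
    logPolar s θ ∈ exteriorDomain R := by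
  change R < ‖logPolar s θ‖
  rw [norm_logPolar]
  exact (Real.log_lt_iff_lt_exp hR).mp hs

theorem hasDerivAt_plane {c : ℝ → Plane} {c' : Plane} {t : ℝ}
    (h : ∀ i, HasDerivAt (fun t => c t i) (c' i) t) : HasDerivAt c c' t := by
  rw [hasDerivAt_iff_hasFDerivAt, ← hasFDerivWithinAt_univ, hasFDerivWithinAt_euclidean]
  intro i
  rw [hasFDerivWithinAt_univ]
  exact (h i).hasFDerivAt

theorem hasDerivAt_logPolar_s (s θ : ℝ) :
    HasDerivAt (fun t => logPolar t θ) (logPolar s θ) s := by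
  refine hasDerivAt_plane fun i => ?_
  fin_cases i
  · exact ((Real.hasDerivAt_exp s).mul_const (Real.cos θ))
  · exact ((Real.hasDerivAt_exp s).mul_const (Real.sin θ))

theorem hasDerivAt_logPolar_θ (s θ : ℝ) :
    HasDerivAt (logPolar s) (logPolarPerp s θ) θ := by
  refine hasDerivAt_plane fun i => ?_
  fin_cases i
  · have h := (Real.hasDerivAt_cos θ).const_mul (Real.exp s)
    rw [mul_neg] at h
    exact h
  · exact ((Real.hasDerivAt_sin θ).const_mul (Real.exp s))

theorem hasDerivAt_logPolarPerp_θ (s θ : ℝ) :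
    HasDerivAt (logPolarPerp s) (-logPolar s θ) θ := by
  refine hasDerivAt_plane fun i => ?_
  fin_cases i
  · exact ((Real.hasDerivAt_sin θ).const_mul (Real.exp s)).neg
  · have h := (Real.hasDerivAt_cos θ).const_mul (Real.exp s)
    rw [mul_neg] at h
    exact h

theorem continuous_logPolar : Continuous fun p : ℝ × ℝ => logPolar p.1 p.2 := by
  unfold logPolar
  fun_prop

theorem continuous_logPolarPerp : Continuous fun p : ℝ × ℝ => logPolarPerp p.1 p.2 := by
  unfold logPolarPerp
  fun_prop

section ChainRule

variable {F : Plane → ℝ} {s θ : ℝ}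

theorem hasDerivAt_comp_logPolar_s {V : Type*} [NormedAddCommGroup V] [NormedSpace ℝ V]
    {G : Plane → V} (hG : DifferentiableAt ℝ G (logPolar s θ)) :
    HasDerivAt (fun t => G (logPolar t θ)) (fderiv ℝ G (logPolar s θ) (logPolar s θ)) s :=
  hG.hasFDerivAt.comp_hasDerivAt s (hasDerivAt_logPolar_s s θ)

theorem hasDerivAt_comp_logPolar_θ {V : Type*} [NormedAddCommGroup V] [NormedSpace ℝ V]
    {G : Plane → V} (hG : DifferentiableAt ℝ G (logPolar s θ)) :
    HasDerivAt (fun t => G (logPolar s t)) (fderiv ℝ G (logPolar s θ) (logPolarPerp s θ)) θ :=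
  hG.hasFDerivAt.comp_hasDerivAt θ (hasDerivAt_logPolar_θ s θ)

theorem differentiableAt_fderiv_of_contDiffAt {x : Plane} (hF : ContDiffAt ℝ 2 F x) :
    DifferentiableAt ℝ (fderiv ℝ F) x :=
  (hF.fderiv_right (m := 1) (by norm_num)).differentiableAt (by norm_num)

theorem hasDerivAt_fderiv_logPolar_s (hF : ContDiffAt ℝ 2 F (logPolar s θ)) :
    HasDerivAt (fun t => fderiv ℝ F (logPolar t θ) (logPolar t θ))
      (fderiv ℝ (fderiv ℝ F) (logPolar s θ) (logPolar s θ) (logPolar s θ) +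
        fderiv ℝ F (logPolar s θ) (logPolar s θ)) s :=
  (hasDerivAt_comp_logPolar_s (differentiableAt_fderiv_of_contDiffAt hF)).clm_apply
    (hasDerivAt_logPolar_s s θ)

theorem hasDerivAt_fderiv_logPolar_θ (hF : ContDiffAt ℝ 2 F (logPolar s θ)) :
    HasDerivAt (fun t => fderiv ℝ F (logPolar s t) (logPolar s t))
      (fderiv ℝ (fderiv ℝ F) (logPolar s θ) (logPolarPerp s θ) (logPolar s θ) +
        fderiv ℝ F (logPolar s θ) (logPolarPerp s θ)) θ :=
  (hasDerivAt_comp_logPolar_θ (differentiableAt_fderiv_of_contDiffAt hF)).clm_apply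
    (hasDerivAt_logPolar_θ s θ)

theorem hasDerivAt_fderiv_logPolarPerp_θ (hF : ContDiffAt ℝ 2 F (logPolar s θ)) :
    HasDerivAt (fun t => fderiv ℝ F (logPolar s t) (logPolarPerp s t))
      (fderiv ℝ (fderiv ℝ F) (logPolar s θ) (logPolarPerp s θ) (logPolarPerp s θ) -
        fderiv ℝ F (logPolar s θ) (logPolar s θ)) θ := by
  have h := (hasDerivAt_comp_logPolar_θ (differentiableAt_fderiv_of_contDiffAt hF)).clm_apply
    (hasDerivAt_logPolarPerp_θ s θ)
  rwa [map_neg, ← sub_eq_add_neg] at h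

end ChainRule

/-- The first standard basis vector in the frame of polar coordinates. -/
theorem basis_zero_eq (s θ : ℝ) : (EuclideanSpace.basisFun (Fin 2) ℝ 0 : Plane) =
    (Real.exp (-s) * Real.cos θ) • logPolar s θ -
      (Real.exp (-s) * Real.sin θ) • logPolarPerp s θ := by
  have h : Real.exp (-s) * Real.exp s = 1 := by rw [← Real.exp_add]; simp
  ext i
  fin_cases i
  · simp [logPolar, logPolarPerp]
    linear_combination (-(Real.cos θ ^ 2 + Real.sin θ ^ 2)) * h - Real.sin_sq_add_cos_sq θ
  · simp [logPolar, logPolarPerp]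
    ring

/-- The second standard basis vector in the frame of polar coordinates. -/
theorem basis_one_eq (s θ : ℝ) : (EuclideanSpace.basisFun (Fin 2) ℝ 1 : Plane) =
    (Real.exp (-s) * Real.sin θ) • logPolar s θ +
      (Real.exp (-s) * Real.cos θ) • logPolarPerp s θ := by
  have h : Real.exp (-s) * Real.exp s = 1 := by rw [← Real.exp_add]; simp
  ext i
  fin_cases i
  · simp [logPolar, logPolarPerp]
    ring
  · simp [logPolar, logPolarPerp]
    linear_combination (-(Real.cos θ ^ 2 + Real.sin θ ^ 2)) * h - Real.sin_sq_add_cos_sq θ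

theorem laplacian_logPolar (F : Plane → ℝ) (s θ : ℝ) :
    (Δ F) (logPolar s θ) = Real.exp (-(2 * s)) *
      (fderiv ℝ (fderiv ℝ F) (logPolar s θ) (logPolar s θ) (logPolar s θ) +
        fderiv ℝ (fderiv ℝ F) (logPolar s θ) (logPolarPerp s θ) (logPolarPerp s θ)) := by
  have h2 : Real.exp (-(2 * s)) = Real.exp (-s) ^ 2 := by
    rw [← Real.exp_nat_mul]; congr 1; push_cast; ring
  rw [InnerProductSpace.laplacian_eq_iteratedFDeriv_orthonormalBasis F
    (EuclideanSpace.basisFun (Fin 2) ℝ)]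
  simp only [Fin.sum_univ_two, iteratedFDeriv_two_apply, Matrix.cons_val_zero, Matrix.cons_val_one]
  rw [basis_zero_eq s θ, basis_one_eq s θ, h2]
  simp only [map_sub, map_add, map_smul, sub_apply,
    add_apply, smul_apply, smul_eq_mul]
  set a := fderiv ℝ (fderiv ℝ F) (logPolar s θ) (logPolar s θ) (logPolar s θ)
  set b := fderiv ℝ (fderiv ℝ F) (logPolar s θ) (logPolarPerp s θ) (logPolarPerp s θ)
  linear_combination (Real.exp (-s) ^ 2 * (a + b)) * Real.sin_sq_add_cos_sq θ

theorem inner_gradient_eq_fderiv (F : Plane → ℝ) (ξ : Plane) :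
    inner ℝ ξ (∇ F ξ) = fderiv ℝ F ξ ξ := by
  rw [real_inner_comm, gradient, InnerProductSpace.toDual_symm_apply]

/-- Chords of a circle are shorter than the arcs. -/
theorem norm_logPolar_sub_le_of_angle (s θ : ℝ) {d : ℝ} (hd : 0 ≤ d) :
    ‖logPolar s (θ + d) - logPolar s θ‖ ≤ Real.exp s * d := by
  have h := (convex_univ : Convex ℝ (univ : Set ℝ)).norm_image_sub_le_of_norm_hasDerivWithin_le
    (f := logPolar s) (f' := logPolarPerp s) (C := Real.exp s) (x := θ) (y := θ + d)
    (fun x _ => (hasDerivAt_logPolar_θ s x).hasDerivWithinAt)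
    (fun x _ => (norm_logPolarPerp s x).le) (mem_univ _) (mem_univ _)
  simpa [abs_of_nonneg hd] using h

theorem norm_logPolar_sub_of_radius (s θ : ℝ) {d : ℝ} (hd : 0 ≤ d) :
    ‖logPolar (s + d) θ - logPolar s θ‖ = Real.exp (s + d) - Real.exp s := by
  have h : logPolar (s + d) θ - logPolar s θ = (Real.exp d - 1) • logPolar s θ := by
    ext i
    fin_cases i <;> simp [logPolar, Real.exp_add] <;> ring
  have h1 : 1 ≤ Real.exp d := Real.one_le_exp hd
  rw [h, norm_smul, norm_logPolar, Real.norm_of_nonneg (by linarith), Real.exp_add]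
  ring

/-! ### The weighted norms in terms of real numbers -/

theorem enorm_div_rpow_le {X V : Type*} [NormedAddCommGroup X] [NormedAddCommGroup V]
    {α : ℝ} (hα : 0 < α) {K : ℝ} {a : V} {x : X} (h : ‖a‖ ≤ K * ‖x‖ ^ α) :
    ‖a‖ₑ / ‖x‖ₑ ^ α ≤ ENNReal.ofReal K := by
  refine ENNReal.div_le_of_le_mul ?_
  rw [← ofReal_norm, ← ofReal_norm, ENNReal.ofReal_rpow_of_nonneg (norm_nonneg _) hα.le,
    ← ENNReal.ofReal_mul' (by positivity)]
  exact ENNReal.ofReal_le_ofReal h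

theorem holderENorm_le {X V : Type*} [NormedAddCommGroup X] [NormedSpace ℝ X]
    [NormedAddCommGroup V] [NormedSpace ℝ V] {α : ℝ} (hα : 0 < α) {K : ℝ} {k : ℕ} {U : Set X}
    {f : X → V} (h : ∀ j ≤ k, ∀ x ∈ U, ‖iteratedFDeriv ℝ j f x‖ ≤ K)
    (h' : ∀ x ∈ U, ∀ y ∈ U,
      ‖iteratedFDeriv ℝ k f x - iteratedFDeriv ℝ k f y‖ ≤ K * ‖x - y‖ ^ α) :
    holderENorm k α U f ≤ ENNReal.ofReal K := by
  refine max_le ?_ ?_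
  · refine iSup₂_le fun j hj => iSup₂_le fun x hx => ?_
    rw [← ofReal_norm]
    exact ENNReal.ofReal_le_ofReal (h j (by simpa [Nat.lt_succ_iff] using hj) x hx)
  · exact iSup₂_le fun x hx => iSup₂_le fun y hy => enorm_div_rpow_le hα (h' x hx y hy)

section StarNorm

variable {V : Type*} [NormedAddCommGroup V] [NormedSpace ℝ V] {α : ℝ} {U : Set Plane}
  {f : Plane → V} {r : ℕ}

theorem norm_iteratedFDeriv_mul_le_starENorm (h : starENorm r α U f < ∞) {j : ℕ} (hj : j ≤ r)
    {ξ : Plane} (hξ : ξ ∈ U) :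
    ‖iteratedFDeriv ℝ j f ξ‖ * ‖ξ‖ ^ (-(r : ℝ) + 1 + j) ≤ (starENorm r α U f).toReal := by
  have h1 : ‖iteratedFDeriv ℝ j f ξ‖ₑ * ‖ξ‖ₑ ^ (-(r : ℝ) + 1 + (j : ℝ)) ≤ starENorm r α U f := by
    refine le_trans ?_ (le_max_left _ _)
    refine le_trans ?_ (le_iSup₂_of_le (i := j) (by simp; omega) le_rfl)
    exact le_iSup₂_of_le (i := ξ) hξ le_rfl
  have h2 := ENNReal.toReal_mono h.ne h1
  rw [ENNReal.toReal_mul, ← ENNReal.toReal_rpow] at h2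
  simpa using h2

theorem norm_iteratedFDeriv_sub_le_starENorm (hα : 0 < α) (h : starENorm r α U f < ∞)
    {ξ η η' : Plane} (hξ : ξ ∈ U) (h0 : ξ ≠ 0) (hη : η ∈ Metric.ball ξ 1 ∩ U)
    (hη' : η' ∈ Metric.ball ξ 1 ∩ U) :
    ‖iteratedFDeriv ℝ r f η - iteratedFDeriv ℝ r f η'‖ ≤
      (starENorm r α U f).toReal * ‖η - η'‖ ^ α * ‖ξ‖ ^ (-(1 + α)) := by
  rcases eq_or_ne η η' with rfl | hne
  · simp [Real.zero_rpow hα.ne']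
  have h1 : ‖iteratedFDeriv ℝ r f η - iteratedFDeriv ℝ r f η'‖ₑ / ‖η - η'‖ₑ ^ α *
      ‖ξ‖ₑ ^ (1 + α) ≤ starENorm r α U f := by
    refine le_trans ?_ (le_max_right _ _)
    refine le_trans ?_ (le_iSup₂_of_le (i := ξ) hξ le_rfl)
    gcongr
    exact le_iSup₂_of_le (i := η) hη (le_iSup₂_of_le (i := η') hη' le_rfl)
  have h2 := ENNReal.toReal_mono h.ne h1
  rw [ENNReal.toReal_mul, ENNReal.toReal_div, ← ENNReal.toReal_rpow, ← ENNReal.toReal_rpow,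
    toReal_enorm, toReal_enorm, toReal_enorm] at h2
  have h3 : 0 < ‖η - η'‖ ^ α := Real.rpow_pos_of_pos (norm_pos_iff.mpr (sub_ne_zero.mpr hne)) _
  have h4 : 0 < ‖ξ‖ ^ (1 + α) := Real.rpow_pos_of_pos (norm_pos_iff.mpr h0) _
  rw [Real.rpow_neg (norm_nonneg _), ← div_eq_mul_inv, le_div_iff₀ h4]
  rw [div_mul_eq_mul_div, div_le_iff₀ h3] at h2
  exact h2

theorem norm_iteratedFDeriv_zero_sub (f : Plane → V) (x y : Plane) :
    ‖iteratedFDeriv ℝ 0 f x - iteratedFDeriv ℝ 0 f y‖ = ‖f x - f y‖ := by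
  rw [iteratedFDeriv_zero_eq_comp]
  simp only [Function.comp]
  rw [← map_sub, LinearIsometryEquiv.norm_map]

theorem starENorm_zero_le (hα : 0 < α) {K : ℝ} (hU : (0 : Plane) ∉ U)
    (h : ∀ ξ ∈ U, ‖f ξ‖ * ‖ξ‖ ≤ K)
    (h' : ∀ ξ ∈ U, ∀ η ∈ Metric.ball ξ 1 ∩ U, ∀ η' ∈ Metric.ball ξ 1 ∩ U,
      ‖f η - f η'‖ ≤ K * ‖ξ‖ ^ (-(1 + α)) * ‖η - η'‖ ^ α) :
    starENorm 0 α U f ≤ ENNReal.ofReal K := by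
  refine max_le ?_ ?_
  · refine iSup₂_le fun j hj => iSup₂_le fun ξ hξ => ?_
    obtain rfl : j = 0 := by simpa using hj
    simp only [Nat.cast_zero, neg_zero, zero_add, add_zero, ENNReal.rpow_one]
    rw [← ofReal_norm, ← ofReal_norm, norm_iteratedFDeriv_zero,
      ← ENNReal.ofReal_mul (norm_nonneg _)]
    exact ENNReal.ofReal_le_ofReal (h ξ hξ)
  · refine iSup₂_le fun ξ hξ => ?_
    have h0 : 0 < ‖ξ‖ := norm_pos_iff.mpr fun h0 => hU (h0 ▸ hξ)
    have h1 : holderSeminorm α (Metric.ball ξ 1 ∩ U) (iteratedFDeriv ℝ 0 f) ≤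
        ENNReal.ofReal (K * ‖ξ‖ ^ (-(1 + α))) := by
      refine iSup₂_le fun η hη => iSup₂_le fun η' hη' => enorm_div_rpow_le hα ?_
      rw [norm_iteratedFDeriv_zero_sub]
      exact h' ξ hξ η hη η' hη'
    calc _ ≤ ENNReal.ofReal (K * ‖ξ‖ ^ (-(1 + α))) * ‖ξ‖ₑ ^ (1 + α) := by gcongr
      _ = ENNReal.ofReal K := by
        have h2 : 0 < ‖ξ‖ ^ (1 + α) := Real.rpow_pos_of_pos h0 _
        rw [← ofReal_norm, ENNReal.ofReal_rpow_of_pos h0, ← ENNReal.ofReal_mul' h2.le,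
          Real.rpow_neg h0.le, inv_mul_cancel_right₀ h2.ne']

end StarNorm

end

/-! ### Solutions of the Dirichlet problem in logarithmic polar coordinates -/

noncomputable section

theorem abs_mul_exp_neg_rpow_mul {A₀ a s α : ℝ} (ha : 0 ≤ a) :
    Real.exp s * (A₀ * (Real.exp s * a) ^ α * Real.exp s ^ (-(1 + α))) = A₀ * a ^ α := by
  rw [Real.mul_rpow (Real.exp_pos s).le ha, ← Real.exp_mul, ← Real.exp_mul]
  have h : Real.exp s * (Real.exp (s * α) * Real.exp (s * -(1 + α))) = 1 := by
    rw [← Real.exp_add, ← Real.exp_add, Real.exp_eq_one_iff]; ring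
  linear_combination (A₀ * a ^ α) * h

section RightHandSide

variable {α R : ℝ} {E : Plane → ℝ}

theorem abs_le_of_starENorm_zero (hR : 0 < R) (hE : starENorm 0 α (exteriorDomain R) E < ∞)
    {s : ℝ} (hs : Real.log R < s) (θ : ℝ) :
    |Real.exp s * E (logPolar s θ)| ≤ (starENorm 0 α (exteriorDomain R) E).toReal := by
  have h := norm_iteratedFDeriv_mul_le_starENorm hE le_rfl (logPolar_mem_exteriorDomain hR hs θ)
  rw [norm_iteratedFDeriv_zero, norm_logPolar] at h
  rw [abs_mul, abs_of_pos (Real.exp_pos s), mul_comm]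
  simpa using h

theorem ne_zero_of_mem_exteriorDomain (hR : 0 < R) {ξ : Plane} (hξ : ξ ∈ exteriorDomain R) :
    ξ ≠ 0 := by
  rintro rfl
  have h : R < ‖(0 : Plane)‖ := hξ
  rw [norm_zero] at h
  linarith

theorem abs_sub_le_of_starENorm_zero (hα : 0 < α) (hR : 0 < R)
    (hE : starENorm 0 α (exteriorDomain R) E < ∞)
    {s t θ ψ a : ℝ} (hs : Real.log R < s) (ht : Real.log R < t) (ha : 0 ≤ a)
    (h : ‖logPolar t ψ - logPolar s θ‖ ≤ Real.exp s * a) (h' : Real.exp s * a < 1) :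
    Real.exp s * |E (logPolar t ψ) - E (logPolar s θ)| ≤
      (starENorm 0 α (exteriorDomain R) E).toReal * a ^ α := by
  have hm := logPolar_mem_exteriorDomain hR hs θ
  have h1 := norm_iteratedFDeriv_sub_le_starENorm hα hE (ξ := logPolar s θ)
    (η := logPolar t ψ) (η' := logPolar s θ) hm (ne_zero_of_mem_exteriorDomain hR hm)
    ⟨by rw [mem_ball_iff_norm]; linarith, logPolar_mem_exteriorDomain hR ht ψ⟩ ⟨by simp, hm⟩
  rw [norm_iteratedFDeriv_zero_sub, Real.norm_eq_abs, norm_logPolar] at h1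
  rw [← abs_mul_exp_neg_rpow_mul ha (s := s)]
  gcongr
  exact h1.trans (by gcongr)

/-- The weighted norm controls arcs of length up to `1 / 2` on the circle of radius `e^s`; longer
arcs are reached by chaining. -/
theorem abs_sub_le_angle_of_starENorm_zero (hα₀ : 0 < α) (hα₁ : α < 1) (hR : 0 < R)
    (hE : starENorm 0 α (exteriorDomain R) E < ∞) {s : ℝ} (hs : Real.log R < s) (θ : ℝ) {d : ℝ}
    (hd : 0 ≤ d) :
    |Real.exp s * E (logPolar s (θ + d)) - Real.exp s * E (logPolar s θ)| ≤
      4 * (starENorm 0 α (exteriorDomain R) E).toReal *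
        (d ^ α + d * Real.exp ((1 - α) * s)) := by
  set A₀ := (starENorm 0 α (exteriorDomain R) E).toReal
  have hA : 0 ≤ A₀ := ENNReal.toReal_nonneg
  have hee : Real.exp s * Real.exp (-s) = 1 := by rw [← Real.exp_add]; simp
  have h1 := abs_sub_le_of_holder_short (u := fun ψ => Real.exp s * E (logPolar s ψ))
    (C := A₀) (α := α) (ℓ := Real.exp (-s) / 2) (x := θ) hA hα₀ (by positivity)
    (fun ψ δ hδ hδ' => by
      rw [← mul_sub, abs_mul, abs_of_pos (Real.exp_pos s)]
      refine abs_sub_le_of_starENorm_zero hα₀ hR hE hs hs hδ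
        (norm_logPolar_sub_le_of_angle s ψ hδ) ?_
      nlinarith [Real.exp_pos s]) hd
  refine h1.trans ?_
  have h2 : (Real.exp (-s) / 2) ^ (α - 1) ≤ 2 * Real.exp ((1 - α) * s) := by
    rw [div_eq_mul_inv, Real.mul_rpow (Real.exp_pos _).le (by norm_num), ← Real.exp_mul,
      Real.inv_rpow (by norm_num), ← Real.rpow_neg (by norm_num),
      show -s * (α - 1) = (1 - α) * s by ring, mul_comm]
    gcongr
    calc (2 : ℝ) ^ (-(α - 1)) ≤ 2 ^ (1 : ℝ) :=
          Real.rpow_le_rpow_of_exponent_le (by norm_num) (by linarith)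
      _ = 2 := by simp
  have h3 := Real.rpow_nonneg hd α
  have h4 : d * (Real.exp (-s) / 2) ^ (α - 1) ≤ d * (2 * Real.exp ((1 - α) * s)) := by gcongr
  calc 2 * A₀ * (d ^ α + d * (Real.exp (-s) / 2) ^ (α - 1))
      ≤ 2 * A₀ * (2 * d ^ α + d * (2 * Real.exp ((1 - α) * s))) := by gcongr; linarith
    _ = _ := by ring

/-- The additional term `(1 - e^{-d}) e^{s+d} E` from the factor `e^s` is Lipschitz in `d`. -/
theorem abs_sub_le_radial_of_starENorm_zero (hα₀ : 0 < α) (hα₁ : α < 1) (hR : 0 < R)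
    (h₀ : Real.exp (-Real.log R) ≤ 3 / 2)
    (hE : starENorm 0 α (exteriorDomain R) E < ∞) {s : ℝ} (hs : Real.log R < s) (θ : ℝ) {d : ℝ}
    (hd : 0 ≤ d) (hd' : d ≤ Real.exp (-s) / 4) :
    |Real.exp (s + d) * E (logPolar (s + d) θ) - Real.exp s * E (logPolar s θ)| ≤
      4 * (starENorm 0 α (exteriorDomain R) E).toReal * d ^ α := by
  have hA : 0 ≤ (starENorm 0 α (exteriorDomain R) E).toReal := ENNReal.toReal_nonneg
  rcases hd.eq_or_lt with rfl | hd0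
  · simp [Real.zero_rpow hα₀.ne']
  have hee : Real.exp s * Real.exp (-s) = 1 := by rw [← Real.exp_add]; simp
  have hes := PolarSolution.exp_neg_le h₀ hs.le
  have h1 := exp_sub_one_le hd (by linarith)
  have h2 : Real.exp (s + d) - Real.exp s ≤ Real.exp s * (2 * d) := by
    rw [Real.exp_add]; nlinarith [Real.exp_pos s]
  have h3 := abs_sub_le_of_starENorm_zero hα₀ hR hE (s := s) (t := s + d) (θ := θ) (ψ := θ)
    (a := 2 * d) hs (by linarith) (by linarith)
    (by rw [norm_logPolar_sub_of_radius s θ hd]; exact h2) (by nlinarith [Real.exp_pos s])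
  have h4 := abs_le_of_starENorm_zero hR hE (s := s + d) (by linarith) θ
  set A₀ := (starENorm 0 α (exteriorDomain R) E).toReal
  have h5 : (2 * d) ^ α ≤ 2 * d ^ α := by
    rw [Real.mul_rpow (by norm_num) hd]
    gcongr
    calc (2 : ℝ) ^ α ≤ 2 ^ (1 : ℝ) := Real.rpow_le_rpow_of_exponent_le (by norm_num) hα₁.le
      _ = 2 := by simp
  have h6 := self_le_rpow_of_le_one hα₁ hd0 (by linarith)
  have h7 : Real.exp (-d) ≤ 1 := Real.exp_le_one_iff.mpr (by linarith)
  have h8 : 1 - d ≤ Real.exp (-d) := Real.one_sub_le_exp_neg d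
  have h9 : Real.exp s = Real.exp (-d) * Real.exp (s + d) := by rw [← Real.exp_add]; ring_nf
  have h10 : Real.exp (s + d) * E (logPolar (s + d) θ) - Real.exp s * E (logPolar s θ) =
      Real.exp s * (E (logPolar (s + d) θ) - E (logPolar s θ)) +
        (1 - Real.exp (-d)) * (Real.exp (s + d) * E (logPolar (s + d) θ)) := by
    linear_combination (-E (logPolar (s + d) θ)) * h9
  rw [h10]
  calc _ ≤ Real.exp s * |E (logPolar (s + d) θ) - E (logPolar s θ)| +
        (1 - Real.exp (-d)) * |Real.exp (s + d) * E (logPolar (s + d) θ)| := by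
        refine (abs_add_le _ _).trans (le_of_eq ?_)
        rw [abs_mul (Real.exp s), abs_of_pos (Real.exp_pos s), abs_mul (1 - Real.exp (-d)),
          abs_of_nonneg (sub_nonneg.mpr h7)]
    _ ≤ A₀ * (2 * d) ^ α + d * A₀ := by
        gcongr
        linarith
    _ ≤ A₀ * (2 * d ^ α) + d ^ α * A₀ := by gcongr
    _ ≤ 4 * A₀ * d ^ α := by nlinarith [mul_nonneg hA (Real.rpow_nonneg hd α)]

end RightHandSide

/-- The hypothesis on the radius enters only through the bound `1 / R ≤ 3 / 2`. -/
theorem exp_neg_log_le {R : ℝ} (hR : 1 / Real.sqrt 2 < R) :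
    0 < R ∧ Real.exp (-Real.log R) ≤ 3 / 2 := by
  have h2 : 0 < Real.sqrt 2 := by positivity
  have hR0 : 0 < R := lt_trans (by positivity) hR
  refine ⟨hR0, ?_⟩
  have h3 : Real.sqrt 2 ≤ 3 / 2 := by
    rw [Real.sqrt_le_left (by norm_num)]; norm_num
  rw [Real.exp_neg, Real.exp_log hR0, inv_le_comm₀ hR0 (by norm_num)]
  refine le_trans ?_ hR.le
  rw [le_div_iff₀ h2]
  linarith

theorem logPolar_add_two_pi (s θ : ℝ) : logPolar s (θ + 2 * Real.pi) = logPolar s θ := by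
  simp [logPolar]

theorem logPolar_neg (s θ : ℝ) :
    logPolar s (-θ) = !₂[logPolar s θ 0, -(logPolar s θ 1)] := by
  simp [logPolar]

/-- The polar form of a solution of the Dirichlet problem that is odd in the second coordinate:
`f(s, θ) = e^{-s} v(e^s cos θ, e^s sin θ)` and `g(s, θ) = e^s E(e^s cos θ, e^s sin θ)`.  The
rotation by `180°` about the `x`-axis gives the oddness; the reflections, and with them `m`, play no
role. -/
def polarSolution {α R : ℝ} (hα₀ : 0 < α) (hα₁ : α < 1) (hR : 1 / Real.sqrt 2 < R) {m : ℕ}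
    {E v : Plane → ℝ} (hE : MemStar 0 α m R E) (hv : MemStar 2 α m R v)
    (h : IsDirichletSolution R E v) :
    PolarSolution α (Real.log R) (4 * (starENorm 0 α (exteriorDomain R) E).toReal) :=
  have hR0 : 0 < R := (exp_neg_log_le hR).1
  have hC : ∀ {s}, Real.log R < s → ∀ θ, ContDiffAt ℝ 2 v (logPolar s θ) := fun hs θ =>
    hv.memLoc.1.contDiffAt
      ((isOpen_exteriorDomain R).mem_nhds (logPolar_mem_exteriorDomain hR0 hs θ))
  have hD : ∀ {s}, Real.log R < s → ∀ θ, DifferentiableAt ℝ v (logPolar s θ) := fun hs θ =>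
    (hC hs θ).differentiableAt (by norm_num)
  have hexp : ∀ s, HasDerivAt (fun t => Real.exp (-t)) (-Real.exp (-s)) s := fun s => by
    simpa using (hasDerivAt_neg s).exp
  have hinit : ∀ θ, v (logPolar (Real.log R) θ) = 0 := fun θ =>
    h.eq_zero _ (by rw [norm_logPolar, Real.exp_log hR0])
  have hbdd : ∀ {s}, Real.log R < s → ∀ θ, |Real.exp (-s) * v (logPolar s θ)| ≤
      (starENorm 2 α (exteriorDomain R) v).toReal := fun {s} hs θ => by
    have h1 := norm_iteratedFDeriv_mul_le_starENorm hv.norm_lt_top (j := 0) (by norm_num)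
      (logPolar_mem_exteriorDomain hR0 hs θ)
    rw [norm_iteratedFDeriv_zero, norm_logPolar] at h1
    norm_num at h1
    rw [abs_mul, abs_of_pos (Real.exp_pos _), Real.exp_neg, mul_comm]
    rwa [Real.rpow_neg_one] at h1
  { f := fun s θ => Real.exp (-s) * v (logPolar s θ)
    fs := fun s θ => Real.exp (-s) * (fderiv ℝ v (logPolar s θ) (logPolar s θ) - v (logPolar s θ))
    fss := fun s θ => Real.exp (-s) *
      (fderiv ℝ (fderiv ℝ v) (logPolar s θ) (logPolar s θ) (logPolar s θ) -
        fderiv ℝ v (logPolar s θ) (logPolar s θ) + v (logPolar s θ))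
    fθ := fun s θ => Real.exp (-s) * fderiv ℝ v (logPolar s θ) (logPolarPerp s θ)
    fθθ := fun s θ => Real.exp (-s) *
      (fderiv ℝ (fderiv ℝ v) (logPolar s θ) (logPolarPerp s θ) (logPolarPerp s θ) -
        fderiv ℝ v (logPolar s θ) (logPolar s θ))
    fsθ := fun s θ => Real.exp (-s) *
      fderiv ℝ (fderiv ℝ v) (logPolar s θ) (logPolarPerp s θ) (logPolar s θ)
    g := fun s θ => Real.exp s * E (logPolar s θ)
    hasDerivAt_s := fun {s} hs θ =>
      ((hexp s).fun_mul (hasDerivAt_comp_logPolar_s (hD hs θ))).congr_deriv (by ring)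
    hasDerivAt_ss := fun {s} hs θ =>
      ((hexp s).fun_mul ((hasDerivAt_fderiv_logPolar_s (hC hs θ)).fun_sub
        (hasDerivAt_comp_logPolar_s (hD hs θ)))).congr_deriv (by ring)
    hasDerivAt_θ := fun {s} hs θ => (hasDerivAt_comp_logPolar_θ (hD hs θ)).const_mul _
    hasDerivAt_θθ := fun {s} hs θ => (hasDerivAt_fderiv_logPolarPerp_θ (hC hs θ)).const_mul _
    hasDerivAt_sθ := fun {s} hs θ =>
      (((hasDerivAt_fderiv_logPolar_θ (hC hs θ)).fun_sub
        (hasDerivAt_comp_logPolar_θ (hD hs θ))).const_mul (Real.exp (-s))).congr_deriv (by ring)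
    continuousOn_f := by
      refine ContinuousOn.mul (by fun_prop) (h.continuousOn.comp
        continuous_logPolar.continuousOn ?_)
      rintro ⟨s, θ⟩ ⟨hs, -⟩
      change R ≤ ‖logPolar s θ‖
      rw [norm_logPolar]
      exact (Real.log_le_iff_le_exp hR0).mp hs
    continuousOn_fsθ := by
      rintro ⟨s, θ⟩ ⟨hs, -⟩
      have h1 : ContinuousAt (fun p : ℝ × ℝ => fderiv ℝ (fderiv ℝ v) (logPolar p.1 p.2)) (s, θ) :=
        ContinuousAt.comp (f := fun p : ℝ × ℝ => logPolar p.1 p.2) (g := fderiv ℝ (fderiv ℝ v))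
          (((hC hs θ).fderiv_right (m := 1) (by norm_num)).fderiv_right (m := 0)
            (by norm_num)).continuousAt continuous_logPolar.continuousAt
      refine ContinuousAt.continuousWithinAt (ContinuousAt.mul (by fun_prop) ?_)
      exact (h1.clm_apply continuous_logPolarPerp.continuousAt).clm_apply
        continuous_logPolar.continuousAt
    continuous_fθθ := fun {s} hs => by
      rw [continuous_iff_continuousAt]
      intro θ
      have c1 : ContinuousAt (logPolar s) θ := (hasDerivAt_logPolar_θ s θ).continuousAt
      have c2 : ContinuousAt (logPolarPerp s) θ := (hasDerivAt_logPolarPerp_θ s θ).continuousAt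
      have h0 := (hC hs θ).fderiv_right (m := 1) (by norm_num)
      have h1 : ContinuousAt (fun t => fderiv ℝ v (logPolar s t)) θ :=
        ContinuousAt.comp (f := logPolar s) (g := fderiv ℝ v) h0.continuousAt c1
      have h2 : ContinuousAt (fun t => fderiv ℝ (fderiv ℝ v) (logPolar s t)) θ :=
        ContinuousAt.comp (f := logPolar s) (g := fderiv ℝ (fderiv ℝ v))
          (h0.fderiv_right (m := 0) (by norm_num)).continuousAt c1
      exact continuousAt_const.mul (((h2.clm_apply c2).clm_apply c2).sub (h1.clm_apply c1))
    f_init := fun θ => by rw [hinit, mul_zero]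
    f_periodic := fun {s} hs θ => by rw [logPolar_add_two_pi]
    f_odd := fun {s} hs θ => by
      rcases hs.eq_or_lt with rfl | hs
      · rw [hinit, hinit]; simp
      · rw [logPolar_neg, hv.symm.1 _ (logPolar_mem_exteriorDomain hR0 hs θ), mul_neg]
    f_bdd := by
      refine ⟨(starENorm 2 α (exteriorDomain R) v).toReal, fun {s} hs θ => ?_⟩
      rcases hs.eq_or_lt with rfl | hs
      · rw [hinit]; simp
      · exact hbdd hs θ
    fs_bdd := by
      refine ⟨2 * (starENorm 2 α (exteriorDomain R) v).toReal, fun {s} hs θ => ?_⟩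
      have h1 := norm_iteratedFDeriv_mul_le_starENorm hv.norm_lt_top (j := 1) (by norm_num)
        (logPolar_mem_exteriorDomain hR0 hs θ)
      rw [norm_iteratedFDeriv_one] at h1
      norm_num at h1
      have h2 : |Real.exp (-s) * fderiv ℝ v (logPolar s θ) (logPolar s θ)| ≤
          (starENorm 2 α (exteriorDomain R) v).toReal := by
        have h3 := (fderiv ℝ v (logPolar s θ)).le_opNorm (logPolar s θ)
        rw [norm_logPolar, Real.norm_eq_abs] at h3
        have hee : Real.exp (-s) * Real.exp s = 1 := by rw [← Real.exp_add]; simp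
        rw [abs_mul, abs_of_pos (Real.exp_pos _)]
        calc _ ≤ Real.exp (-s) * (‖fderiv ℝ v (logPolar s θ)‖ * Real.exp s) := by gcongr
          _ = ‖fderiv ℝ v (logPolar s θ)‖ := by linear_combination ‖fderiv ℝ v (logPolar s θ)‖ * hee
          _ ≤ _ := h1
      rw [mul_sub]
      refine (abs_sub _ _).trans ?_
      linarith [hbdd hs θ]
    eq := fun {s} hs θ => by
      have h1 := h.eq _ (logPolar_mem_exteriorDomain hR0 hs θ)
      rw [shrinkerOperator, inner_gradient_eq_fderiv, laplacian_logPolar] at h1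
      have e1 : Real.exp s * Real.exp (-(2 * s)) = Real.exp (-s) := by
        rw [← Real.exp_add]; ring_nf
      have e2 : Real.exp (-s) * Real.exp (2 * s) = Real.exp s := by
        rw [← Real.exp_add]; ring_nf
      rw [← h1]
      linear_combination (v (logPolar s θ) - fderiv ℝ v (logPolar s θ) (logPolar s θ)) * e2 -
        (fderiv ℝ (fderiv ℝ v) (logPolar s θ) (logPolar s θ) (logPolar s θ) +
          fderiv ℝ (fderiv ℝ v) (logPolar s θ) (logPolarPerp s θ) (logPolarPerp s θ)) * e1
    g_le := fun {s} hs θ => by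
      have := abs_le_of_starENorm_zero hR0 hE.norm_lt_top hs θ
      have : 0 ≤ (starENorm 0 α (exteriorDomain R) E).toReal := ENNReal.toReal_nonneg
      linarith
    g_θ := fun {s} hs θ {d} hd =>
      abs_sub_le_angle_of_starENorm_zero hα₀ hα₁ hR0 hE.norm_lt_top hs θ hd
    g_s := fun {s} hs θ {d} hd hd' =>
      abs_sub_le_radial_of_starENorm_zero hα₀ hα₁ hR0 (exp_neg_log_le hR).2 hE.norm_lt_top
        hs θ hd hd' }

end

/-! ### Hölder bounds in the plane from bounds in logarithmic polar coordinates -/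

noncomputable section

/-- The polar angle in `(-π, π]`. -/
def polarAngle (ξ : Plane) : ℝ := Complex.arg ⟨ξ 0, ξ 1⟩

theorem eq_logPolar_polarAngle {ξ : Plane} (h : ξ ≠ 0) :
    ξ = logPolar (Real.log ‖ξ‖) (polarAngle ξ) := by
  have hn : ‖(⟨ξ 0, ξ 1⟩ : ℂ)‖ = ‖ξ‖ := by
    rw [Complex.norm_eq_sqrt_sq_add_sq, EuclideanSpace.norm_eq]
    simp [Fin.sum_univ_two]
  have h1 := Complex.norm_mul_cos_arg ⟨ξ 0, ξ 1⟩
  have h2 := Complex.norm_mul_sin_arg ⟨ξ 0, ξ 1⟩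
  rw [hn] at h1 h2
  ext i
  fin_cases i
  · simp [logPolar, Real.exp_log (norm_pos_iff.mpr h), polarAngle, h1]
  · simp [logPolar, Real.exp_log (norm_pos_iff.mpr h), polarAngle, h2]

theorem logPolar_add_int_mul (s θ : ℝ) (n : ℤ) :
    logPolar s (θ + n * (2 * Real.pi)) = logPolar s θ := by
  simp [logPolar, Real.cos_add_int_mul_two_pi, Real.sin_add_int_mul_two_pi]

/-- The polar angle may be chosen at distance at most `π` from a given one. -/
theorem exists_eq_logPolar_add (θ : ℝ) {η : Plane} (hη : η ≠ 0) :
    ∃ d, |d| ≤ Real.pi ∧ η = logPolar (Real.log ‖η‖) (θ + d) := by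
  have hpi := Real.pi_pos
  set x : ℝ := (polarAngle η - θ) / (2 * Real.pi) with hx
  have hx' : polarAngle η - θ = x * (2 * Real.pi) := by rw [hx]; field_simp
  refine ⟨(x - round x) * (2 * Real.pi), ?_, ?_⟩
  · rw [abs_mul, abs_of_pos (by positivity : (0 : ℝ) < 2 * Real.pi)]
    have := abs_sub_round x
    nlinarith
  · rw [← logPolar_add_int_mul _ _ (round x)]
    rw [show θ + (x - round x) * (2 * Real.pi) + round x * (2 * Real.pi) = polarAngle η by
      linear_combination -hx']
    exact eq_logPolar_polarAngle hη

theorem norm_logPolar_sub_sq (s t θ d : ℝ) :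
    ‖logPolar t (θ + d) - logPolar s θ‖ ^ 2 =
      (Real.exp t - Real.exp s) ^ 2 + 2 * Real.exp s * Real.exp t * (1 - Real.cos d) := by
  rw [EuclideanSpace.norm_sq_eq]
  simp only [logPolar, Fin.sum_univ_two, Real.norm_eq_abs, sq_abs, PiLp.sub_apply,
    Matrix.cons_val_zero, Matrix.cons_val_one]
  have h : Real.cos d = Real.cos (θ + d) * Real.cos θ + Real.sin (θ + d) * Real.sin θ := by
    rw [← Real.cos_sub]; ring_nf
  rw [h]
  linear_combination Real.exp s ^ 2 * Real.sin_sq_add_cos_sq θ +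
    Real.exp t ^ 2 * Real.sin_sq_add_cos_sq (θ + d)

/-- Arcs of the smaller circle, up to a half circle, are at most twice as long as the segment. -/
theorem exp_mul_abs_le_norm_logPolar_sub {s t : ℝ} (hst : s ≤ t) (θ : ℝ) {d : ℝ}
    (hd : |d| ≤ Real.pi) :
    Real.exp s * |d| ≤ 2 * ‖logPolar t (θ + d) - logPolar s θ‖ := by
  have h1 := norm_logPolar_sub_sq s t θ d
  have h2 := Real.cos_le_one_sub_mul_cos_sq hd
  have h3 : Real.exp s ≤ Real.exp t := Real.exp_le_exp.mpr hst
  have h4 : 1 / 8 ≤ 2 / Real.pi ^ 2 := by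
    rw [div_le_div_iff₀ (by norm_num) (by positivity)]
    nlinarith [Real.pi_le_four, Real.pi_pos]
  have h5 : 1 / 8 * d ^ 2 ≤ 1 - Real.cos d := by nlinarith [sq_nonneg d]
  have hes := Real.exp_pos s
  refine abs_le_of_sq_le_sq' ?_ (by positivity) |>.2
  rw [mul_pow, mul_pow, h1, sq_abs]
  have h6 : Real.exp s * Real.exp s * (1 / 8 * d ^ 2) ≤
      Real.exp s * Real.exp t * (1 - Real.cos d) := by gcongr
  nlinarith [sq_nonneg (Real.exp t - Real.exp s)]

theorem abs_exp_sub_le_norm_logPolar_sub (s t θ d : ℝ) :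
    Real.exp t - Real.exp s ≤ ‖logPolar t (θ + d) - logPolar s θ‖ := by
  have h := norm_sub_norm_le (logPolar t (θ + d)) (logPolar s θ)
  rwa [norm_logPolar, norm_logPolar] at h

/-- Points of the unit ball about a point of the exterior domain have comparable norms. -/
theorem norm_le_of_mem_ball_inter_exteriorDomain {R : ℝ} (hR : 2 / 3 ≤ R) {ξ η : Plane}
    (hη : η ∈ Metric.ball ξ 1 ∩ exteriorDomain R) : ‖ξ‖ ≤ 5 / 2 * ‖η‖ := by
  have h1 : ‖η - ξ‖ < 1 := mem_ball_iff_norm.mp hη.1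
  have h2 : R < ‖η‖ := hη.2
  have h3 := norm_sub_norm_le ξ η
  rw [norm_sub_rev] at h3
  linarith

namespace ShortHolder

variable {α s₀ C : ℝ} {q : ℝ → ℝ → ℝ}

theorem abs_angle (hq : ShortHolder α s₀ C q) {s : ℝ} (hs : s₀ < s) (θ d : ℝ) :
    |q s (θ + d) - q s θ| ≤ C * (|d| ^ α + |d| * Real.exp ((1 - α) * s)) := by
  rcases le_total 0 d with h | h
  · rw [abs_of_nonneg h]; exact hq.angle hs θ h
  · have := hq.angle hs (θ + d) (d := -d) (by linarith)
    rw [abs_of_nonpos h, abs_sub_comm]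
    simpa using this

/-- The function `e^{-s} q` is Hölder at distances up to `2` in the plane, with the weight
`e^{-(1+α)s}`.  The two points are joined along the circle of the smaller radius and then along a
ray. -/
theorem abs_sub_le_of_le (hα₀ : 0 < α) (hα₁ : α < 1) (h₀ : Real.exp (-s₀) ≤ 3 / 2)
    (hq : ShortHolder α s₀ C q) {s t : ℝ} (hs : s₀ < s) (hst : s ≤ t) (θ : ℝ) {d : ℝ}
    (hd : |d| ≤ Real.pi) {D : ℝ} (hD : ‖logPolar t (θ + d) - logPolar s θ‖ = D) (hD2 : D ≤ 2) :
    |Real.exp (-t) * q t (θ + d) - Real.exp (-s) * q s θ| ≤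
      140 * C * D ^ α * Real.exp (-(1 + α) * s) := by
  have hC := hq.nonneg
  have hD0 : 0 ≤ D := hD ▸ norm_nonneg _
  rcases hD0.eq_or_lt with hD00 | hDpos
  · have h1 : Real.exp s * |d| ≤ 2 * 0 := by
      rw [hD00, ← hD]; exact exp_mul_abs_le_norm_logPolar_sub hst θ hd
    have h2 : Real.exp t - Real.exp s ≤ 0 := by
      rw [hD00, ← hD]; exact abs_exp_sub_le_norm_logPolar_sub s t θ d
    have h3 : d = 0 := by
      have := abs_nonneg d
      have := Real.exp_pos s
      exact abs_eq_zero.mp (by nlinarith)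
    have h4 : t = s := le_antisymm (Real.exp_le_exp.mp (by linarith)) hst
    subst h3 h4
    simp only [add_zero, sub_self, abs_zero]
    positivity
  have hes := PolarSolution.exp_neg_le h₀ hs.le
  have hee : Real.exp s * Real.exp (-s) = 1 := by rw [← Real.exp_add]; simp
  have heet : Real.exp t * Real.exp (-t) = 1 := by rw [← Real.exp_add]; simp
  have hps := Real.exp_pos s
  have hpns := Real.exp_pos (-s)
  have hpnt := Real.exp_pos (-t)
  have hangle : Real.exp s * |d| ≤ 2 * D := by
    rw [← hD]; exact exp_mul_abs_le_norm_logPolar_sub hst θ hd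
  have hrad : Real.exp t - Real.exp s ≤ D := by
    rw [← hD]; exact abs_exp_sub_le_norm_logPolar_sub s t θ d
  have hd1 : |d| ≤ 2 * D * Real.exp (-s) := by
    have : |d| = Real.exp s * |d| * Real.exp (-s) := by linear_combination (-|d|) * hee
    rw [this]; gcongr
  have hδ : t - s ≤ D * Real.exp (-s) := by
    have h1 := Real.add_one_le_exp (t - s)
    have h2 : Real.exp (t - s) = Real.exp t * Real.exp (-s) := by rw [← Real.exp_add]; ring_nf
    nlinarith
  have ht4 : Real.exp (-s) ≤ 4 * Real.exp (-t) := by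
    have h1 : Real.exp t ≤ 4 * Real.exp s := by nlinarith
    calc Real.exp (-s) = Real.exp t * (Real.exp (-t) * Real.exp (-s)) := by
          linear_combination (-Real.exp (-s)) * heet
      _ ≤ 4 * Real.exp s * (Real.exp (-t) * Real.exp (-s)) := by gcongr
      _ = _ := by linear_combination 4 * Real.exp (-t) * hee
  set X : ℝ := D ^ α * Real.exp (-α * s) with hX
  have hX0 : 0 ≤ X := by positivity
  have hDα : (D * Real.exp (-s)) ^ α = X := by
    rw [Real.mul_rpow hD0 hpns.le, ← Real.exp_mul, hX]; ring_nf
  have hDle : D ≤ 2 * D ^ α := by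
    have h1 : D = D ^ α * D ^ (1 - α) := by rw [← Real.rpow_add hDpos]; simp
    have h2 : D ^ (1 - α) ≤ 2 := by
      calc D ^ (1 - α) ≤ 2 ^ (1 - α) := Real.rpow_le_rpow hD0 hD2 (by linarith)
        _ ≤ 2 ^ (1 : ℝ) := Real.rpow_le_rpow_of_exponent_le (by norm_num) (by linarith)
        _ = 2 := by simp
    have h3 : 0 ≤ D ^ α := by positivity
    calc D = D ^ α * D ^ (1 - α) := h1
      _ ≤ D ^ α * 2 := by gcongr
      _ = _ := by ring
  have hDX : D * Real.exp (-α * s) ≤ 2 * X := by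
    rw [hX, ← mul_assoc]; gcongr
  -- The angular increment, along the circle of the smaller radius.
  have hA : |q s (θ + d) - q s θ| ≤ C * (6 * X) := by
    refine (hq.abs_angle hs θ d).trans ?_
    gcongr
    have h1 : |d| ^ α ≤ 2 * X := by
      calc |d| ^ α ≤ (2 * (D * Real.exp (-s))) ^ α :=
            Real.rpow_le_rpow (abs_nonneg d) (by linarith) hα₀.le
        _ = 2 ^ α * X := by rw [Real.mul_rpow (by norm_num) (by positivity), hDα]
        _ ≤ 2 ^ (1 : ℝ) * X := by
            gcongr
            · norm_num
        _ = 2 * X := by simp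
    have h2 : |d| * Real.exp ((1 - α) * s) ≤ 4 * X := by
      calc |d| * Real.exp ((1 - α) * s)
          ≤ 2 * D * Real.exp (-s) * Real.exp ((1 - α) * s) := by gcongr
        _ = 2 * (D * Real.exp (-α * s)) := by
            rw [mul_assoc (2 * D), ← Real.exp_add]; ring_nf
        _ ≤ _ := by linarith
    linarith
  -- The radial increment, in `128` steps of admissible length.
  have hB : |q t (θ + d) - q s (θ + d)| ≤ 128 * (C * X) := by
    have h1 := abs_sub_le_of_steps (u := fun x => q x (θ + d)) (x := s) (d := (t - s) / 128)
      (B := C * X) 128 (by linarith) (fun y hy hy' => by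
        have hyt : y ≤ t := by push_cast at hy'; linarith
        have h2 : (t - s) / 128 ≤ Real.exp (-y) / 16 := by
          have : Real.exp (-t) ≤ Real.exp (-y) := Real.exp_le_exp.mpr (by linarith)
          nlinarith
        refine (hq.radial (lt_of_lt_of_le hs hy) (θ + d) (by linarith) h2).trans ?_
        gcongr
        rw [← hDα]
        exact Real.rpow_le_rpow (by linarith) (by nlinarith) hα₀.le)
    push_cast at h1
    rwa [show s + 128 * ((t - s) / 128) = t by ring] at h1
  have hS : |q s θ| ≤ C := hq.bdd hs θ
  have hE : |Real.exp (-t) - Real.exp (-s)| ≤ Real.exp (-s) * (3 * X) := by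
    have h1 : Real.exp (-t) ≤ Real.exp (-s) := Real.exp_le_exp.mpr (by linarith)
    have h2 : Real.exp (-t) = Real.exp (-s) * Real.exp (-(t - s)) := by
      rw [← Real.exp_add]; ring_nf
    have h3 := Real.one_sub_le_exp_neg (t - s)
    have h4 : Real.exp (-s) ≤ 3 / 2 * Real.exp (-α * s) := by
      have h5 : Real.exp (-s) = Real.exp (-s) ^ (1 - α) * Real.exp (-α * s) := by
        rw [← Real.exp_mul, ← Real.exp_add]; ring_nf
      rw [h5]
      gcongr
      calc Real.exp (-s) ^ (1 - α) ≤ (3 / 2) ^ (1 - α) :=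
            Real.rpow_le_rpow hpns.le hes (by linarith)
        _ ≤ (3 / 2) ^ (1 : ℝ) :=
            Real.rpow_le_rpow_of_exponent_le (by norm_num) (by linarith)
        _ = 3 / 2 := by simp
    have h6 : t - s ≤ 3 * X := by
      calc t - s ≤ D * Real.exp (-s) := hδ
        _ ≤ D * (3 / 2 * Real.exp (-α * s)) := by gcongr
        _ ≤ 3 * X := by linarith
    rw [abs_sub_comm, abs_of_nonneg (by linarith), h2]
    calc Real.exp (-s) - Real.exp (-s) * Real.exp (-(t - s))
        = Real.exp (-s) * (1 - Real.exp (-(t - s))) := by ring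
      _ ≤ Real.exp (-s) * (3 * X) := by gcongr; linarith
  have hfin : Real.exp (-(1 + α) * s) = Real.exp (-s) * Real.exp (-α * s) := by
    rw [← Real.exp_add]; ring_nf
  have hts : Real.exp (-t) ≤ Real.exp (-s) := Real.exp_le_exp.mpr (by linarith)
  calc |Real.exp (-t) * q t (θ + d) - Real.exp (-s) * q s θ|
      = |Real.exp (-t) * (q t (θ + d) - q s (θ + d)) + Real.exp (-t) * (q s (θ + d) - q s θ) +
          (Real.exp (-t) - Real.exp (-s)) * q s θ| := by congr 1; ring
    _ ≤ Real.exp (-t) * |q t (θ + d) - q s (θ + d)| + Real.exp (-t) * |q s (θ + d) - q s θ| +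
          |Real.exp (-t) - Real.exp (-s)| * |q s θ| := by
        refine (abs_add_le _ _).trans ?_
        refine add_le_add ((abs_add_le _ _).trans ?_) (abs_mul _ _).le
        rw [abs_mul, abs_mul, abs_of_pos hpnt]
    _ ≤ Real.exp (-s) * (128 * (C * X)) + Real.exp (-s) * (C * (6 * X)) +
          Real.exp (-s) * (3 * X) * C := by gcongr
    _ ≤ 140 * C * D ^ α * Real.exp (-(1 + α) * s) := by
        rw [hfin, show 140 * C * D ^ α * (Real.exp (-s) * Real.exp (-α * s)) =
          140 * (Real.exp (-s) * (C * X)) by rw [hX]; ring]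
        have : 0 ≤ Real.exp (-s) * (C * X) := by positivity
        linarith

variable {R : ℝ} {Φ : Plane → ℝ}

/-- A function with polar form `e^{-s} q`, `q` bounded, is `O(|ξ|⁻¹)`. -/
theorem abs_mul_norm_le (hR : 0 < R) (hq : ShortHolder α (Real.log R) C q)
    (hΦ : ∀ {s}, Real.log R < s → ∀ θ, Φ (logPolar s θ) = Real.exp (-s) * q s θ)
    {ξ : Plane} (hξ : ξ ∈ exteriorDomain R) : |Φ ξ| * ‖ξ‖ ≤ C := by
  have h0 := norm_pos_iff.mpr (ne_zero_of_mem_exteriorDomain hR hξ)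
  have hθ := eq_logPolar_polarAngle (ne_zero_of_mem_exteriorDomain hR hξ)
  have hs : Real.log R < Real.log ‖ξ‖ := Real.log_lt_log hR hξ
  have h1 := hΦ hs (polarAngle ξ)
  rw [← hθ, Real.exp_neg, Real.exp_log h0] at h1
  rw [h1, abs_mul, abs_of_pos (inv_pos.mpr h0)]
  have h2 := hq.bdd hs (polarAngle ξ)
  rwa [mul_right_comm, inv_mul_cancel₀ h0.ne', one_mul]

/-- A function with polar form `e^{-s} q`, where `q` satisfies short-range Hölder bounds, satisfies
the Hölder bounds of the weighted norm of order zero. -/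
theorem abs_sub_le_of_mem_ball (hα₀ : 0 < α) (hα₁ : α < 1) (hR : 0 < R)
    (h₀ : Real.exp (-Real.log R) ≤ 3 / 2) (hq : ShortHolder α (Real.log R) C q)
    (hΦ : ∀ {s}, Real.log R < s → ∀ θ, Φ (logPolar s θ) = Real.exp (-s) * q s θ)
    {ξ η η' : Plane} (hξ : ξ ∈ exteriorDomain R) (hη : η ∈ Metric.ball ξ 1 ∩ exteriorDomain R)
    (hη' : η' ∈ Metric.ball ξ 1 ∩ exteriorDomain R) :
    |Φ η - Φ η'| ≤ 1000 * C * ‖ξ‖ ^ (-(1 + α)) * ‖η - η'‖ ^ α := by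
  wlog h : ‖η'‖ ≤ ‖η‖ generalizing η η'
  · rw [abs_sub_comm, norm_sub_rev]
    exact this hη' hη (not_le.mp h).le
  have hR23 : 2 / 3 ≤ R := by
    rw [Real.exp_neg, Real.exp_log hR, inv_le_comm₀ hR (by norm_num)] at h₀
    norm_num at h₀
    exact h₀
  have hC := hq.nonneg
  have hn := ne_zero_of_mem_exteriorDomain hR hη.2
  have hn' := ne_zero_of_mem_exteriorDomain hR hη'.2
  have hp' := norm_pos_iff.mpr hn'
  have hpξ := norm_pos_iff.mpr (ne_zero_of_mem_exteriorDomain hR hξ)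
  obtain ⟨d, hd, h2⟩ := exists_eq_logPolar_add (polarAngle η') hn
  have h1 := eq_logPolar_polarAngle hn'
  set θ := polarAngle η'
  have hs' : Real.log R < Real.log ‖η'‖ := Real.log_lt_log hR hη'.2
  have hs : Real.log R < Real.log ‖η‖ := Real.log_lt_log hR hη.2
  have hst : Real.log ‖η'‖ ≤ Real.log ‖η‖ := Real.log_le_log hp' h
  have hD : ‖logPolar (Real.log ‖η‖) (θ + d) - logPolar (Real.log ‖η'‖) θ‖ = ‖η - η'‖ := by
    rw [← h1, ← h2]
  have hD2 : ‖η - η'‖ ≤ 2 := by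
    have a := mem_ball_iff_norm.mp hη.1
    have b := mem_ball_iff_norm'.mp hη'.1
    have c := norm_add_le (η - ξ) (ξ - η')
    rw [sub_add_sub_cancel] at c
    linarith
  have key := hq.abs_sub_le_of_le hα₀ hα₁ h₀ hs' hst θ hd hD hD2
  rw [← hΦ hs, ← hΦ hs', ← h1, ← h2] at key
  refine key.trans ?_
  have e1 : Real.exp (-(1 + α) * Real.log ‖η'‖) = ‖η'‖ ^ (-(1 + α)) := by
    rw [Real.rpow_def_of_pos hp', mul_comm]
  have e2 : ‖η'‖ ^ (-(1 + α)) ≤ 7 * ‖ξ‖ ^ (-(1 + α)) := by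
    have h3 : (5 / 2 * ‖η'‖) ^ (-(1 + α)) ≤ ‖ξ‖ ^ (-(1 + α)) :=
      Real.rpow_le_rpow_of_nonpos hpξ (norm_le_of_mem_ball_inter_exteriorDomain hR23 hη')
        (by linarith)
    rw [Real.mul_rpow (by norm_num) hp'.le] at h3
    have h4 : 1 ≤ 7 * (5 / 2 : ℝ) ^ (-(1 + α)) := by
      have : (5 / 2 : ℝ) ^ (-2 : ℝ) ≤ (5 / 2) ^ (-(1 + α)) :=
        Real.rpow_le_rpow_of_exponent_le (by norm_num) (by linarith)
      have h5 : (5 / 2 : ℝ) ^ (-2 : ℝ) = 4 / 25 := by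
        rw [Real.rpow_neg (by norm_num)]; norm_num
      linarith
    have h6 : 0 ≤ ‖η'‖ ^ (-(1 + α)) := by positivity
    nlinarith
  rw [e1]
  calc 140 * C * ‖η - η'‖ ^ α * ‖η'‖ ^ (-(1 + α))
      ≤ 140 * C * ‖η - η'‖ ^ α * (7 * ‖ξ‖ ^ (-(1 + α))) := by gcongr
    _ = 980 * (C * ‖ξ‖ ^ (-(1 + α)) * ‖η - η'‖ ^ α) := by ring
    _ ≤ 1000 * (C * ‖ξ‖ ^ (-(1 + α)) * ‖η - η'‖ ^ α) := by gcongr; norm_num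
    _ = _ := by ring

end ShortHolder

end

/-! ### The homogeneous extension of a function on the circle -/

noncomputable section

/-- The function `|ξ| φ(θ)` of degree one with the `2π`-periodic profile `φ` of the angle. -/
def coneFunction (φ : ℝ → ℝ) (ξ : Plane) : ℝ := ‖ξ‖ * φ (polarAngle ξ)

section ConeFunction

variable {φ : ℝ → ℝ}

theorem apply_polarAngle_logPolar (hφ : Function.Periodic φ (2 * Real.pi)) (s θ : ℝ) :
    φ (polarAngle (logPolar s θ)) = φ θ := by
  have hn : logPolar s θ ≠ 0 := by
    rw [← norm_pos_iff, norm_logPolar]; exact Real.exp_pos s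
  have h := eq_logPolar_polarAngle hn
  rw [norm_logPolar, Real.log_exp] at h
  have hc := congrArg (fun x : Plane => x 0) h
  have hs := congrArg (fun x : Plane => x 1) h
  simp only [logPolar, Matrix.cons_val_zero, Matrix.cons_val_one] at hc hs
  have ha := Real.Angle.cos_sin_inj (mul_left_cancel₀ (Real.exp_pos s).ne' hc)
    (mul_left_cancel₀ (Real.exp_pos s).ne' hs)
  exact (congrArg hφ.lift ha).symm

theorem coneFunction_logPolar (hφ : Function.Periodic φ (2 * Real.pi)) (s θ : ℝ) :
    coneFunction φ (logPolar s θ) = Real.exp s * φ θ := by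
  rw [coneFunction, norm_logPolar, apply_polarAngle_logPolar hφ]

/-- Near a point with polar angle `θ` the angle is `θ` plus an arc tangent, a smooth function. -/
theorem contDiffAt_coneFunction (hφ : Function.Periodic φ (2 * Real.pi)) (hC : ContDiff ℝ 2 φ)
    {ξ₀ : Plane} (h0 : ξ₀ ≠ 0) : ContDiffAt ℝ 2 (coneFunction φ) ξ₀ := by
  set θ := polarAngle ξ₀ with hθ
  set a : Plane → ℝ := fun ξ => Real.cos θ * ξ 0 + Real.sin θ * ξ 1 with ha
  set b : Plane → ℝ := fun ξ => -Real.sin θ * ξ 0 + Real.cos θ * ξ 1 with hb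
  have haC : ContDiff ℝ 2 a := by fun_prop
  have hbC : ContDiff ℝ 2 b := by fun_prop
  have hab : ∀ t d, a (logPolar t (θ + d)) = Real.exp t * Real.cos d ∧
      b (logPolar t (θ + d)) = Real.exp t * Real.sin d := by
    intro t d
    have h1 : Real.cos d = Real.cos (θ + d - θ) := by ring_nf
    have h2 : Real.sin d = Real.sin (θ + d - θ) := by ring_nf
    rw [h1, h2, Real.cos_sub, Real.sin_sub]
    constructor <;> simp [ha, hb, logPolar] <;> ring
  have ha0 : 0 < a ξ₀ := by
    have h1 := eq_logPolar_polarAngle h0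
    rw [← hθ] at h1
    have h2 := (hab (Real.log ‖ξ₀‖) 0).1
    rw [add_zero, ← h1, Real.cos_zero, mul_one] at h2
    rw [h2]
    exact Real.exp_pos _
  have hev : coneFunction φ =ᶠ[𝓝 ξ₀] fun ξ => ‖ξ‖ * φ (θ + Real.arctan (b ξ / a ξ)) := by
    filter_upwards [(haC.continuous.tendsto ξ₀).eventually (lt_mem_nhds ha0)] with ξ hξ
    have hξ0 : ξ ≠ 0 := by
      rintro rfl
      simp [ha] at hξ
    obtain ⟨d, hd, h1⟩ := exists_eq_logPolar_add θ hξ0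
    have h2 := hab (Real.log ‖ξ‖) d
    rw [← h1] at h2
    have he := Real.exp_pos (Real.log ‖ξ‖)
    have hcos : 0 < Real.cos d := by
      rw [h2.1] at hξ
      exact pos_of_mul_pos_right hξ he.le
    have hd2 : |d| < Real.pi / 2 := by
      by_contra hcon
      have := Real.cos_nonpos_of_pi_div_two_le_of_le (not_lt.mp hcon)
        (by linarith [Real.pi_pos])
      rw [Real.cos_abs] at this
      linarith
    have h3 : b ξ / a ξ = Real.tan d := by
      rw [h2.1, h2.2, Real.tan_eq_sin_div_cos, mul_div_mul_left _ _ he.ne']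
    rw [h3, Real.arctan_tan (abs_lt.mp hd2).1 (abs_lt.mp hd2).2, coneFunction]
    congr 1
    conv_lhs => rw [h1]
    exact apply_polarAngle_logPolar hφ _ _
  refine ContDiffAt.congr_of_eventuallyEq ?_ hev
  refine (contDiffAt_norm ℝ h0).mul (hC.contDiffAt.comp ξ₀ ?_)
  exact contDiffAt_const.add (Real.contDiff_arctan.contDiffAt.comp ξ₀
    (hbC.contDiffAt.div haC.contDiffAt ha0.ne'))

theorem contDiff_two_of_hasDerivAt {φ' φ'' : ℝ → ℝ} (h : ∀ θ, HasDerivAt φ (φ' θ) θ)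
    (h' : ∀ θ, HasDerivAt φ' (φ'' θ) θ) (hc : Continuous φ'') : ContDiff ℝ 2 φ := by
  have e1 : deriv φ = φ' := funext fun θ => (h θ).deriv
  have e2 : deriv φ' = φ'' := funext fun θ => (h' θ).deriv
  rw [show (2 : WithTop ℕ∞) = 1 + 1 by norm_num, contDiff_succ_iff_deriv]
  refine ⟨fun θ => (h θ).differentiableAt, by simp, ?_⟩
  rw [e1, contDiff_one_iff_deriv, e2]
  exact ⟨fun θ => (h' θ).differentiableAt, hc⟩

end ConeFunction

/-! ### The derivatives of a function in terms of its polar form -/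

section PolarForm

variable {F : Plane → ℝ} {s₀ : ℝ} {q qs qss qθ qθθ qsθ : ℝ → ℝ → ℝ}

/-- The polar form `q` of `F`, given by `F(e^s cos θ, e^s sin θ) = e^s q(s, θ)`, together with the
derivatives of `q`, for a function `F` of class `C²`. -/
structure IsPolarForm (s₀ : ℝ) (F : Plane → ℝ) (q qs qss qθ qθθ qsθ : ℝ → ℝ → ℝ) : Prop where
  contDiffAt : ∀ {s}, s₀ < s → ∀ θ, ContDiffAt ℝ 2 F (logPolar s θ)
  eq : ∀ {s}, s₀ < s → ∀ θ, F (logPolar s θ) = Real.exp s * q s θ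
  hasDerivAt_s : ∀ {s}, s₀ < s → ∀ θ, HasDerivAt (fun t => q t θ) (qs s θ) s
  hasDerivAt_ss : ∀ {s}, s₀ < s → ∀ θ, HasDerivAt (fun t => qs t θ) (qss s θ) s
  hasDerivAt_θ : ∀ {s}, s₀ < s → ∀ θ, HasDerivAt (q s) (qθ s θ) θ
  hasDerivAt_θθ : ∀ {s}, s₀ < s → ∀ θ, HasDerivAt (qθ s) (qθθ s θ) θ
  hasDerivAt_sθ : ∀ {s}, s₀ < s → ∀ θ, HasDerivAt (qs s) (qsθ s θ) θ

namespace IsPolarForm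

theorem fderiv_radial (h : IsPolarForm s₀ F q qs qss qθ qθθ qsθ) {s : ℝ} (hs : s₀ < s) (θ : ℝ) :
    fderiv ℝ F (logPolar s θ) (logPolar s θ) = Real.exp s * (q s θ + qs s θ) := by
  have h1 := hasDerivAt_comp_logPolar_s ((h.contDiffAt hs θ).differentiableAt (by norm_num))
  have h2 : HasDerivAt (fun t => F (logPolar t θ)) (Real.exp s * q s θ + Real.exp s * qs s θ) s :=
    ((Real.hasDerivAt_exp s).fun_mul (h.hasDerivAt_s hs θ)).congr_of_eventuallyEq
      (by filter_upwards [lt_mem_nhds hs] with t ht using h.eq ht θ)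
  rw [h1.unique h2, mul_add]

theorem fderiv_angular (h : IsPolarForm s₀ F q qs qss qθ qθθ qsθ) {s : ℝ} (hs : s₀ < s) (θ : ℝ) :
    fderiv ℝ F (logPolar s θ) (logPolarPerp s θ) = Real.exp s * qθ s θ := by
  have h1 := hasDerivAt_comp_logPolar_θ ((h.contDiffAt hs θ).differentiableAt (by norm_num))
  have h2 : HasDerivAt (fun t => F (logPolar s t)) (Real.exp s * qθ s θ) θ :=
    ((h.hasDerivAt_θ hs θ).const_mul (Real.exp s)).congr_of_eventuallyEq
      (.of_forall fun t => h.eq hs t)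
  exact h1.unique h2

theorem hessian_radial (h : IsPolarForm s₀ F q qs qss qθ qθθ qsθ) {s : ℝ} (hs : s₀ < s) (θ : ℝ) :
    fderiv ℝ (fderiv ℝ F) (logPolar s θ) (logPolar s θ) (logPolar s θ) =
      Real.exp s * (qss s θ + qs s θ) := by
  have h1 := hasDerivAt_fderiv_logPolar_s (h.contDiffAt hs θ)
  have h2 : HasDerivAt (fun t => fderiv ℝ F (logPolar t θ) (logPolar t θ))
      (Real.exp s * (q s θ + qs s θ) + Real.exp s * (qs s θ + qss s θ)) s :=
    ((Real.hasDerivAt_exp s).fun_mul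
      ((h.hasDerivAt_s hs θ).fun_add (h.hasDerivAt_ss hs θ))).congr_of_eventuallyEq
      (by filter_upwards [lt_mem_nhds hs] with t ht using h.fderiv_radial ht θ)
  have h3 := h1.unique h2
  rw [h.fderiv_radial hs θ] at h3
  linear_combination h3

theorem hessian_mixed (h : IsPolarForm s₀ F q qs qss qθ qθθ qsθ) {s : ℝ} (hs : s₀ < s) (θ : ℝ) :
    fderiv ℝ (fderiv ℝ F) (logPolar s θ) (logPolarPerp s θ) (logPolar s θ) =
      Real.exp s * qsθ s θ := by
  have h1 := hasDerivAt_fderiv_logPolar_θ (h.contDiffAt hs θ)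
  have h2 : HasDerivAt (fun t => fderiv ℝ F (logPolar s t) (logPolar s t))
      (Real.exp s * (qθ s θ + qsθ s θ)) θ :=
    (((h.hasDerivAt_θ hs θ).fun_add (h.hasDerivAt_sθ hs θ)).const_mul
      (Real.exp s)).congr_of_eventuallyEq (.of_forall fun t => h.fderiv_radial hs t)
  have h3 := h1.unique h2
  rw [h.fderiv_angular hs θ] at h3
  linear_combination h3

theorem hessian_mixed_symm (h : IsPolarForm s₀ F q qs qss qθ qθθ qsθ) {s : ℝ} (hs : s₀ < s)
    (θ : ℝ) :
    fderiv ℝ (fderiv ℝ F) (logPolar s θ) (logPolar s θ) (logPolarPerp s θ) =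
      Real.exp s * qsθ s θ := by
  rw [← h.hessian_mixed hs θ]
  exact ((h.contDiffAt hs θ).isSymmSndFDerivAt (by simp)).eq _ _

theorem hessian_angular (h : IsPolarForm s₀ F q qs qss qθ qθθ qsθ) {s : ℝ} (hs : s₀ < s) (θ : ℝ) :
    fderiv ℝ (fderiv ℝ F) (logPolar s θ) (logPolarPerp s θ) (logPolarPerp s θ) =
      Real.exp s * (qθθ s θ + q s θ + qs s θ) := by
  have h1 := hasDerivAt_fderiv_logPolarPerp_θ (h.contDiffAt hs θ)
  have h2 : HasDerivAt (fun t => fderiv ℝ F (logPolar s t) (logPolarPerp s t))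
      (Real.exp s * qθθ s θ) θ :=
    ((h.hasDerivAt_θθ hs θ).const_mul (Real.exp s)).congr_of_eventuallyEq
      (.of_forall fun t => h.fderiv_angular hs t)
  have h3 := h1.unique h2
  rw [h.fderiv_radial hs θ] at h3
  linear_combination h3

/-- The entries of the Hessian matrix are `e^{-s}` times bounded functions with short-range Hölder
bounds. -/
theorem exists_hessian_entry {α M : ℝ} (hα₀ : 0 < α) (hα₁ : α < 1)
    (h₀ : Real.exp (-s₀) ≤ 3 / 2) (h : IsPolarForm s₀ F q qs qss qθ qθθ qsθ)
    (hss : ShortHolder α s₀ M fun s θ => qss s θ + qs s θ) (hsθ : ShortHolder α s₀ M qsθ)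
    (hθθ : ShortHolder α s₀ M fun s θ => qθθ s θ + q s θ + qs s θ) (i j : Fin 2) :
    ∃ e, ShortHolder α s₀ (64 * M) e ∧ ∀ {s}, s₀ < s → ∀ θ,
      iteratedFDeriv ℝ 2 F (logPolar s θ) ![EuclideanSpace.basisFun (Fin 2) ℝ i,
        EuclideanSpace.basisFun (Fin 2) ℝ j] = Real.exp (-s) * e s θ := by
  have hM := hsθ.nonneg
  have c := ShortHolder.cos hα₀ hα₁ h₀
  have d := ShortHolder.sin hα₀ hα₁ h₀
  have hee : ∀ s : ℝ, Real.exp (-s) * Real.exp (-s) * Real.exp s = Real.exp (-s) := fun s => by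
    rw [← Real.exp_add, ← Real.exp_add]; ring_nf
  have key : ∀ {a b : ℝ → ℝ → ℝ}, ShortHolder α s₀ 2 a → ShortHolder α s₀ 2 b →
      ∀ {e : ℝ → ℝ → ℝ}, ShortHolder α s₀ M e →
        ShortHolder α s₀ (16 * M) fun s θ => a s θ * b s θ * e s θ := fun ha hb _ he =>
    ((ha.mul hb).mul he).mono (by linarith)
  fin_cases i <;> fin_cases j
  · refine ⟨_, ((((key c c hss).sub (key c d hsθ)).sub (key d c hsθ)).add
      (key d d hθθ)).mono (by linarith), fun {s} hs θ => ?_⟩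
    simp only [iteratedFDeriv_two_apply, Matrix.cons_val_zero, Matrix.cons_val_one, Fin.zero_eta]
    rw [basis_zero_eq s θ]
    simp only [map_sub, map_smul, sub_apply, smul_apply, smul_eq_mul,
      h.hessian_radial hs, h.hessian_mixed hs, h.hessian_mixed_symm hs, h.hessian_angular hs]
    conv_rhs => rw [← hee s]
    ring
  · refine ⟨_, ((((key c d hss).add (key c c hsθ)).sub (key d d hsθ)).sub
      (key d c hθθ)).mono (by linarith), fun {s} hs θ => ?_⟩
    simp only [iteratedFDeriv_two_apply, Matrix.cons_val_zero, Matrix.cons_val_one, Fin.zero_eta,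
      Fin.mk_one]
    rw [basis_zero_eq s θ, basis_one_eq s θ]
    simp only [map_sub, map_add, map_smul, sub_apply, smul_apply, smul_eq_mul,
      h.hessian_radial hs, h.hessian_mixed hs, h.hessian_mixed_symm hs, h.hessian_angular hs]
    conv_rhs => rw [← hee s]
    ring
  · refine ⟨_, ((((key c d hss).add (key c c hsθ)).sub (key d d hsθ)).sub
      (key d c hθθ)).mono (by linarith), fun {s} hs θ => ?_⟩
    simp only [iteratedFDeriv_two_apply, Matrix.cons_val_zero, Matrix.cons_val_one, Fin.zero_eta,
      Fin.mk_one]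
    rw [basis_zero_eq s θ, basis_one_eq s θ]
    simp only [map_sub, map_add, map_smul, add_apply, smul_apply, smul_eq_mul,
      h.hessian_radial hs, h.hessian_mixed hs, h.hessian_mixed_symm hs, h.hessian_angular hs]
    conv_rhs => rw [← hee s]
    ring
  · refine ⟨_, ((((key d d hss).add (key c d hsθ)).add (key d c hsθ)).add
      (key c c hθθ)).mono (by linarith), fun {s} hs θ => ?_⟩
    simp only [iteratedFDeriv_two_apply, Matrix.cons_val_zero, Matrix.cons_val_one, Fin.mk_one]
    rw [basis_one_eq s θ]
    simp only [map_add, map_smul, add_apply, smul_apply, smul_eq_mul,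
      h.hessian_radial hs, h.hessian_mixed hs, h.hessian_mixed_symm hs, h.hessian_angular hs]
    conv_rhs => rw [← hee s]
    ring

end IsPolarForm

end PolarForm

/-! ### Norms of linear and bilinear forms on the plane -/

theorem eq_smul_basis_add (x : Plane) : x = x 0 • EuclideanSpace.basisFun (Fin 2) ℝ 0 +
    x 1 • EuclideanSpace.basisFun (Fin 2) ℝ 1 := by
  ext i
  fin_cases i <;> simp

theorem abs_apply_le_norm (x : Plane) (i : Fin 2) : |x i| ≤ ‖x‖ :=
  PiLp.norm_apply_le x i

theorem norm_le_sum_basis (L : Plane →L[ℝ] ℝ) :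
    ‖L‖ ≤ ∑ i, |L (EuclideanSpace.basisFun (Fin 2) ℝ i)| := by
  refine L.opNorm_le_bound (by positivity) fun x => ?_
  conv_lhs => rw [eq_smul_basis_add x]
  rw [map_add, map_smul, map_smul, Fin.sum_univ_two, add_mul]
  refine (norm_add_le _ _).trans (add_le_add ?_ ?_)
  · rw [norm_smul, mul_comm]
    exact mul_le_mul_of_nonneg_left (abs_apply_le_norm x 0) (norm_nonneg _)
  · rw [norm_smul, mul_comm]
    exact mul_le_mul_of_nonneg_left (abs_apply_le_norm x 1) (norm_nonneg _)

theorem norm_le_sum_basis_two (B : ContinuousMultilinearMap ℝ (fun _ : Fin 2 => Plane) ℝ) :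
    ‖B‖ ≤ ∑ i, ∑ j, |B ![EuclideanSpace.basisFun (Fin 2) ℝ i,
      EuclideanSpace.basisFun (Fin 2) ℝ j]| := by
  refine B.opNorm_le_bound (by positivity) fun m => ?_
  have hm : B m = ∑ i, ∑ j, m 0 i * m 1 j * B ![EuclideanSpace.basisFun (Fin 2) ℝ i,
      EuclideanSpace.basisFun (Fin 2) ℝ j] := by
    have h0 : m = ![m 0, m 1] := by ext i : 1; fin_cases i <;> rfl
    have hu0 : ∀ x z w : Plane, Function.update ![x, z] 0 w = ![w, z] := fun x z w => by
      ext i : 1; fin_cases i <;> rfl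
    have hu1 : ∀ x z w : Plane, Function.update ![z, x] 1 w = ![z, w] := fun x z w => by
      ext i : 1; fin_cases i <;> rfl
    have hadd0 : ∀ x y z : Plane, B ![x + y, z] = B ![x, z] + B ![y, z] := fun x y z => by
      have := B.map_update_add ![x, z] 0 x y
      rwa [hu0, hu0, hu0] at this
    have hadd1 : ∀ x y z : Plane, B ![z, x + y] = B ![z, x] + B ![z, y] := fun x y z => by
      have := B.map_update_add ![z, x] 1 x y
      rwa [hu1, hu1, hu1] at this
    have hs0 : ∀ (c : ℝ) (x z : Plane), B ![c • x, z] = c * B ![x, z] := fun c x z => by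
      have := B.map_update_smul ![x, z] 0 c x
      rwa [hu0, hu0] at this
    have hs1 : ∀ (c : ℝ) (x z : Plane), B ![z, c • x] = c * B ![z, x] := fun c x z => by
      have := B.map_update_smul ![z, x] 1 c x
      rwa [hu1, hu1] at this
    conv_lhs => rw [h0, eq_smul_basis_add (m 0), eq_smul_basis_add (m 1)]
    simp only [hadd0, hadd1, hs0, hs1, Fin.sum_univ_two]
    ring
  rw [hm, Finset.sum_mul]
  refine (norm_sum_le _ _).trans (Finset.sum_le_sum fun i _ => ?_)
  rw [Finset.sum_mul]
  refine (norm_sum_le _ _).trans (Finset.sum_le_sum fun j _ => ?_)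
  rw [Fin.prod_univ_two, Real.norm_eq_abs, abs_mul, abs_mul, mul_comm]
  gcongr
  · exact abs_apply_le_norm _ _
  · exact abs_apply_le_norm _ _

end

/-! ### The norms of the remainder and of the profile -/

noncomputable section

namespace IsPolarForm

variable {α R K : ℝ} {F : Plane → ℝ} {q qs qss qθ qθθ qsθ : ℝ → ℝ → ℝ}

/-- Bounds in logarithmic polar coordinates for a function that is `O(|ξ|⁻¹)` together with its
derivatives of order at most two and with `ξ·∇F`.  Only a supremum bound is needed for the angular
derivative of first order. -/
structure DecayBounds (α s₀ K : ℝ) (q qs qss qθ qθθ qsθ : ℝ → ℝ → ℝ) : Prop where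
  val : ShortHolder α s₀ K fun s θ => Real.exp (2 * s) * q s θ
  s : ShortHolder α s₀ K fun s θ => Real.exp (2 * s) * qs s θ
  ss : ShortHolder α s₀ K qss
  θ : ∀ {s}, s₀ < s → ∀ θ, |qθ s θ| ≤ K * Real.exp (-s)
  θθ : ShortHolder α s₀ K qθθ
  sθ : ShortHolder α s₀ K qsθ

/-- The Hessian is `O(|ξ|⁻¹)` and satisfies the Hölder bounds of the weighted norm of order zero,
since its entries are `e^{-s}` times functions with short-range Hölder bounds. -/
theorem iteratedFDeriv_two_bounds (hα₀ : 0 < α) (hα₁ : α < 1) (hR : 0 < R)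
    (h₀ : Real.exp (-Real.log R) ≤ 3 / 2) (h : IsPolarForm (Real.log R) F q qs qss qθ qθθ qsθ)
    (b : DecayBounds α (Real.log R) K q qs qss qθ qθθ qsθ) :
    (∀ ξ ∈ exteriorDomain R, ‖iteratedFDeriv ℝ 2 F ξ‖ * ‖ξ‖ ≤ 6 * 10 ^ 6 * K) ∧
    ∀ ξ ∈ exteriorDomain R, ∀ η ∈ Metric.ball ξ 1 ∩ exteriorDomain R,
      ∀ η' ∈ Metric.ball ξ 1 ∩ exteriorDomain R,
      ‖iteratedFDeriv ℝ 2 F η - iteratedFDeriv ℝ 2 F η'‖ ≤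
        6 * 10 ^ 6 * K * ‖ξ‖ ^ (-(1 + α)) * ‖η - η'‖ ^ α := by
  have hK := b.val.nonneg
  have hmul : ∀ {p : ℝ → ℝ → ℝ},
      ShortHolder α (Real.log R) K (fun s θ => Real.exp (2 * s) * p s θ) →
      ShortHolder α (Real.log R) (10 * K) p := fun {p} hp =>
    (((ShortHolder.exp_neg_two hα₁ h₀).mul hp).mono (by linarith)).congr fun {s} _ θ => by
      rw [← mul_assoc, ← Real.exp_add]; simp
  have hq := hmul b.val
  have hs := hmul b.s
  have entry := h.exists_hessian_entry hα₀ hα₁ h₀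
    ((b.ss.add hs).mono (C' := 21 * K) (by linarith)) (b.sθ.mono (by linarith))
    (((b.θθ.add hq).add hs).mono (by linarith))
  choose e he heq using entry
  constructor
  · intro ξ hξ
    have h1 : ∀ i j, |iteratedFDeriv ℝ 2 F ξ ![EuclideanSpace.basisFun (Fin 2) ℝ i,
        EuclideanSpace.basisFun (Fin 2) ℝ j]| * ‖ξ‖ ≤ 64 * (21 * K) := fun i j =>
      (he i j).abs_mul_norm_le hR (Φ := fun ξ => iteratedFDeriv ℝ 2 F ξ
        ![EuclideanSpace.basisFun (Fin 2) ℝ i, EuclideanSpace.basisFun (Fin 2) ℝ j])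
        (heq i j) hξ
    have h2 := mul_le_mul_of_nonneg_right (norm_le_sum_basis_two (iteratedFDeriv ℝ 2 F ξ))
      (norm_nonneg ξ)
    simp only [Fin.sum_univ_two] at h2
    linarith [h1 0 0, h1 0 1, h1 1 0, h1 1 1]
  · intro ξ hξ η hη η' hη'
    have h1 : ∀ i j, |iteratedFDeriv ℝ 2 F η ![EuclideanSpace.basisFun (Fin 2) ℝ i,
        EuclideanSpace.basisFun (Fin 2) ℝ j] - iteratedFDeriv ℝ 2 F η'
        ![EuclideanSpace.basisFun (Fin 2) ℝ i, EuclideanSpace.basisFun (Fin 2) ℝ j]| ≤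
        1000 * (64 * (21 * K)) * ‖ξ‖ ^ (-(1 + α)) * ‖η - η'‖ ^ α := fun i j =>
      (he i j).abs_sub_le_of_mem_ball hα₀ hα₁ hR h₀ (Φ := fun ξ => iteratedFDeriv ℝ 2 F ξ
        ![EuclideanSpace.basisFun (Fin 2) ℝ i, EuclideanSpace.basisFun (Fin 2) ℝ j])
        (heq i j) hξ hη hη'
    have h2 := norm_le_sum_basis_two (iteratedFDeriv ℝ 2 F η - iteratedFDeriv ℝ 2 F η')
    simp only [Fin.sum_univ_two, sub_apply] at h2
    have : 0 ≤ K * ‖ξ‖ ^ (-(1 + α)) * ‖η - η'‖ ^ α := by positivity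
    linarith [h1 0 0, h1 0 1, h1 1 0, h1 1 1]

/-- The gradient is the combination of `q + q_s` and `q_θ` in the polar frame. -/
theorem norm_fderiv_mul_le (hR : 0 < R)
    (h₀ : Real.exp (-Real.log R) ≤ 3 / 2) (h : IsPolarForm (Real.log R) F q qs qss qθ qθθ qsθ)
    (b : DecayBounds α (Real.log R) K q qs qss qθ qθθ qsθ) {ξ : Plane}
    (hξ : ξ ∈ exteriorDomain R) : ‖fderiv ℝ F ξ‖ * ‖ξ‖ ≤ 8 * K := by
  have hK := b.val.nonneg
  have hne := ne_zero_of_mem_exteriorDomain hR hξ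
  have hs : Real.log R < Real.log ‖ξ‖ := Real.log_lt_log hR hξ
  have hθ := eq_logPolar_polarAngle hne
  set s := Real.log ‖ξ‖ with hsdef
  set θ := polarAngle ξ
  have hn : ‖ξ‖ = Real.exp s := by rw [hsdef, Real.exp_log (norm_pos_iff.mpr hne)]
  have hee : Real.exp s * Real.exp (-s) = 1 := by rw [← Real.exp_add]; simp
  have hes := PolarSolution.exp_neg_le h₀ hs.le
  have hmul : ∀ x, |Real.exp (2 * s) * x| ≤ K → |x| ≤ 3 / 2 * K * Real.exp (-s) := by
    intro x hx
    rw [abs_mul, abs_of_pos (Real.exp_pos _)] at hx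
    have h1 : Real.exp (2 * s) = Real.exp s ^ 2 := by
      rw [← Real.exp_nat_mul]; norm_num
    rw [h1] at hx
    calc |x| = Real.exp (-s) * (Real.exp (-s) * (Real.exp s ^ 2 * |x|)) := by
          linear_combination (-|x| * (Real.exp s * Real.exp (-s) + 1)) * hee
      _ ≤ Real.exp (-s) * (3 / 2 * K) := by gcongr
      _ = _ := by ring
  have hq := hmul _ (b.val.bdd hs θ)
  have hqs := hmul _ (b.s.bdd hs θ)
  have hqθ := b.θ hs θ
  have e1 := h.fderiv_radial hs θ
  have e2 := h.fderiv_angular hs θ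
  rw [← hθ] at e1 e2
  have h0 : fderiv ℝ F ξ (EuclideanSpace.basisFun (Fin 2) ℝ 0) =
      Real.cos θ * (q s θ + qs s θ) - Real.sin θ * qθ s θ := by
    rw [basis_zero_eq s θ, ← hθ, map_sub, map_smul, map_smul, e1, e2]
    simp only [smul_eq_mul]
    linear_combination (Real.cos θ * (q s θ + qs s θ) - Real.sin θ * qθ s θ) * hee
  have h1 : fderiv ℝ F ξ (EuclideanSpace.basisFun (Fin 2) ℝ 1) =
      Real.sin θ * (q s θ + qs s θ) + Real.cos θ * qθ s θ := by
    rw [basis_one_eq s θ, ← hθ, map_add, map_smul, map_smul, e1, e2]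
    simp only [smul_eq_mul]
    linear_combination (Real.sin θ * (q s θ + qs s θ) + Real.cos θ * qθ s θ) * hee
  have hqq : |q s θ + qs s θ| ≤ 3 * K * Real.exp (-s) := (abs_add_le _ _).trans (by linarith)
  have hmul1 : ∀ c x : ℝ, |c| ≤ 1 → |c * x| ≤ |x| := fun c x hc => by
    rw [abs_mul]; exact mul_le_of_le_one_left (abs_nonneg x) hc
  have hb : ‖fderiv ℝ F ξ‖ ≤ 8 * K * Real.exp (-s) := by
    refine (norm_le_sum_basis _).trans ?_
    rw [Fin.sum_univ_two, h0, h1]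
    have c1 := hmul1 _ (q s θ + qs s θ) (Real.abs_cos_le_one θ)
    have c2 := hmul1 _ (q s θ + qs s θ) (Real.abs_sin_le_one θ)
    have c3 := hmul1 _ (qθ s θ) (Real.abs_cos_le_one θ)
    have c4 := hmul1 _ (qθ s θ) (Real.abs_sin_le_one θ)
    have d1 := abs_sub (Real.cos θ * (q s θ + qs s θ)) (Real.sin θ * qθ s θ)
    have d2 := abs_add_le (Real.sin θ * (q s θ + qs s θ)) (Real.cos θ * qθ s θ)
    linarith
  calc ‖fderiv ℝ F ξ‖ * ‖ξ‖ ≤ 8 * K * Real.exp (-s) * Real.exp s := by rw [hn]; gcongr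
    _ = 8 * K := by linear_combination 8 * K * hee

theorem abs_mul_norm_le (hR : 0 < R) (h : IsPolarForm (Real.log R) F q qs qss qθ qθθ qsθ)
    (b : DecayBounds α (Real.log R) K q qs qss qθ qθθ qsθ) {ξ : Plane}
    (hξ : ξ ∈ exteriorDomain R) : |F ξ| * ‖ξ‖ ≤ K :=
  b.val.abs_mul_norm_le hR (fun {s} hs θ => by
    rw [h.eq hs, ← mul_assoc, ← Real.exp_add]; ring_nf) hξ

theorem starENorm_hessian_le (hα₀ : 0 < α) (hα₁ : α < 1) (hR : 0 < R)
    (h₀ : Real.exp (-Real.log R) ≤ 3 / 2) (h : IsPolarForm (Real.log R) F q qs qss qθ qθθ qsθ)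
    (b : DecayBounds α (Real.log R) K q qs qss qθ qθθ qsθ) :
    starENorm 0 α (exteriorDomain R) (iteratedFDeriv ℝ 2 F) ≤
      ENNReal.ofReal (6 * 10 ^ 6 * K) := by
  obtain ⟨h1, h2⟩ := h.iteratedFDeriv_two_bounds hα₀ hα₁ hR h₀ b
  exact starENorm_zero_le hα₀ (fun h0 => ne_zero_of_mem_exteriorDomain hR h0 rfl) h1 h2

theorem starENorm_radial_derivative_le (hα₀ : 0 < α) (hα₁ : α < 1) (hR : 0 < R)
    (h₀ : Real.exp (-Real.log R) ≤ 3 / 2) (h : IsPolarForm (Real.log R) F q qs qss qθ qθθ qsθ)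
    (b : DecayBounds α (Real.log R) K q qs qss qθ qθθ qsθ) :
    starENorm 0 α (exteriorDomain R) (fun ξ => inner ℝ ξ (∇ F ξ)) ≤
      ENNReal.ofReal (6 * 10 ^ 6 * K) := by
  have hK := b.val.nonneg
  have hq := b.val.add b.s
  have hΦ : ∀ {s}, Real.log R < s → ∀ θ,
      inner ℝ (logPolar s θ) (∇ F (logPolar s θ)) =
        Real.exp (-s) * (Real.exp (2 * s) * q s θ + Real.exp (2 * s) * qs s θ) := by
    intro s hs θ
    rw [inner_gradient_eq_fderiv, h.fderiv_radial hs]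
    have : Real.exp s = Real.exp (-s) * Real.exp (2 * s) := by rw [← Real.exp_add]; ring_nf
    rw [this]
    ring
  refine starENorm_zero_le hα₀ (fun h0 => ne_zero_of_mem_exteriorDomain hR h0 rfl) ?_ ?_
  · intro ξ hξ
    have := hq.abs_mul_norm_le hR (Φ := fun ξ => inner ℝ ξ (∇ F ξ)) hΦ hξ
    rw [Real.norm_eq_abs]
    linarith
  · intro ξ hξ η hη η' hη'
    have := hq.abs_sub_le_of_mem_ball hα₀ hα₁ hR h₀ (Φ := fun ξ => inner ℝ ξ (∇ F ξ)) hΦ hξ hη hη'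
    rw [Real.norm_eq_abs]
    refine this.trans (mul_le_mul_of_nonneg_right (mul_le_mul_of_nonneg_right ?_ ?_) ?_)
    · linarith
    · positivity
    · positivity

/-- The bound for `|ξ| ‖F : C^{2,α}(Ω ∩ B(ξ))‖`. -/
theorem weightedHolderENorm_le (hα₀ : 0 < α) (hα₁ : α < 1) (hR : 0 < R)
    (h₀ : Real.exp (-Real.log R) ≤ 3 / 2) (h : IsPolarForm (Real.log R) F q qs qss qθ qθθ qsθ)
    (b : DecayBounds α (Real.log R) K q qs qss qθ qθθ qsθ) :
    weightedHolderENorm 2 α (exteriorDomain R) (fun ξ => ‖ξ‖ₑ⁻¹) F ≤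
      ENNReal.ofReal (2 * 10 ^ 7 * K) := by
  have hK := b.val.nonneg
  obtain ⟨h1, h2⟩ := h.iteratedFDeriv_two_bounds hα₀ hα₁ hR h₀ b
  have hR23 : 2 / 3 ≤ R := by
    rw [Real.exp_neg, Real.exp_log hR, inv_le_comm₀ hR (by norm_num)] at h₀
    norm_num at h₀
    exact h₀
  refine iSup₂_le fun ξ hξ => ?_
  have hp := norm_pos_iff.mpr (ne_zero_of_mem_exteriorDomain hR hξ)
  have hξR : 2 / 3 ≤ ‖ξ‖ := hR23.trans (le_of_lt hξ)
  have hsup : ∀ j ≤ 2, ∀ η ∈ exteriorDomain R, ‖iteratedFDeriv ℝ j F η‖ * ‖η‖ ≤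
      6 * 10 ^ 6 * K := by
    intro j hj η hη
    interval_cases j
    · rw [norm_iteratedFDeriv_zero, Real.norm_eq_abs]
      linarith [h.abs_mul_norm_le hR b hη]
    · rw [norm_iteratedFDeriv_one]
      linarith [h.norm_fderiv_mul_le hR h₀ b hη]
    · exact h1 η hη
  have key : holderENorm 2 α (exteriorDomain R ∩ Metric.ball ξ 1) F ≤
      ENNReal.ofReal (2 * 10 ^ 7 * K * ‖ξ‖⁻¹) := by
    refine holderENorm_le hα₀ ?_ ?_
    · intro j hj η hη
      have h3 := hsup j hj η hη.1
      have h4 := norm_le_of_mem_ball_inter_exteriorDomain hR23 hη.symm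
      rw [← div_eq_mul_inv, le_div_iff₀ hp]
      have h5 := mul_le_mul_of_nonneg_left h4 (norm_nonneg (iteratedFDeriv ℝ j F η))
      linarith
    · intro η hη η' hη'
      refine (h2 ξ hξ η hη.symm η' hη'.symm).trans ?_
      have h3 : ‖ξ‖ ^ (-(1 + α)) ≤ 3 / 2 * ‖ξ‖⁻¹ := by
        rw [neg_add, Real.rpow_add hp, Real.rpow_neg_one, mul_comm]
        gcongr
        calc ‖ξ‖ ^ (-α) ≤ (2 / 3) ^ (-α) :=
              Real.rpow_le_rpow_of_nonpos (by norm_num) hξR (by linarith)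
          _ ≤ (2 / 3) ^ (-1 : ℝ) :=
              Real.rpow_le_rpow_of_exponent_ge (by norm_num) (by norm_num) (by linarith)
          _ = 3 / 2 := by rw [Real.rpow_neg_one]; norm_num
      have h4 : 6 * 10 ^ 6 * K * ‖ξ‖ ^ (-(1 + α)) ≤ 2 * 10 ^ 7 * K * ‖ξ‖⁻¹ := by
        have h5 := mul_le_mul_of_nonneg_left h3 hK
        have h6 : 0 ≤ K * ‖ξ‖⁻¹ := by positivity
        linarith
      gcongr
  calc _ ≤ ‖ξ‖ₑ * ENNReal.ofReal (2 * 10 ^ 7 * K * ‖ξ‖⁻¹) := by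
        rw [inv_inv]; gcongr
    _ = ENNReal.ofReal (2 * 10 ^ 7 * K) := by
        rw [← ofReal_norm, ← ENNReal.ofReal_mul (norm_nonneg _)]
        congr 1
        field_simp

end IsPolarForm

theorem holderENorm_univ_two_le {α K : ℝ} (hα₀ : 0 < α) {φ φ' φ'' : ℝ → ℝ}
    (h : ∀ θ, HasDerivAt φ (φ' θ) θ) (h' : ∀ θ, HasDerivAt φ' (φ'' θ) θ)
    (b : ∀ θ, |φ θ| ≤ K) (b' : ∀ θ, |φ' θ| ≤ K) (b'' : ∀ θ, |φ'' θ| ≤ K)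
    (hh : ∀ θ d, 0 ≤ d → |φ'' (θ + d) - φ'' θ| ≤ K * d ^ α) :
    holderENorm 2 α univ φ ≤ ENNReal.ofReal K := by
  have e1 : deriv φ = φ' := funext fun θ => (h θ).deriv
  have e2 : iteratedDeriv 2 φ = φ'' := by
    rw [iteratedDeriv_succ, iteratedDeriv_one, e1]
    exact funext fun θ => (h' θ).deriv
  refine holderENorm_le hα₀ ?_ ?_
  · intro j hj θ _
    rw [norm_iteratedFDeriv_eq_norm_iteratedDeriv, Real.norm_eq_abs]
    interval_cases j
    · rw [iteratedDeriv_zero]; exact b θ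
    · rw [iteratedDeriv_one, e1]; exact b' θ
    · rw [e2]; exact b'' θ
  · intro x _ y _
    rw [iteratedFDeriv_eq_equiv_comp, e2]
    simp only [Function.comp]
    rw [← map_sub, LinearIsometryEquiv.norm_map]
    rcases le_total y x with hxy | hxy
    · have := hh y (x - y) (by linarith)
      rw [Real.norm_eq_abs, Real.norm_eq_abs, abs_of_nonneg (sub_nonneg.mpr hxy)]
      simpa using this
    · have := hh x (y - x) (by linarith)
      rw [norm_sub_rev, norm_sub_rev x, Real.norm_eq_abs, Real.norm_eq_abs,
        abs_of_nonneg (sub_nonneg.mpr hxy)]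
      simpa using this

theorem circlePoint_eq_logPolar (θ : ℝ) : (circlePoint θ : Plane) = logPolar 0 θ := by
  simp [circlePoint, logPolar]

theorem direction_eq_circlePoint {ξ : Plane} (h : ξ ≠ 0) :
    direction ξ h = circlePoint (polarAngle ξ) := by
  apply Subtype.ext
  have h1 := eq_logPolar_polarAngle h
  change ‖ξ‖⁻¹ • ξ = (circlePoint (polarAngle ξ) : Plane)
  have hp := norm_pos_iff.mpr h
  rw [circlePoint_eq_logPolar]
  conv_lhs => rw [h1]
  rw [norm_logPolar, ← Real.exp_neg]
  ext i
  fin_cases i <;> simp [logPolar, ← mul_assoc, ← Real.exp_add]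

/-- A solution of the Dirichlet problem is the sum of the homogeneous extension of its profile and
of a remainder, with norms controlled by the right-hand side. -/
theorem exists_isConeDecomposition {α R : ℝ} (hα₀ : 0 < α) (hα₁ : α < 1)
    (hR : 1 / Real.sqrt 2 < R) : ∃ C : ℝ, 0 ≤ C ∧ ∀ m : ℕ, ∀ E v : Plane → ℝ,
      MemStar 0 α m R E → MemStar 2 α m R v → IsDirichletSolution R E v →
        ∃ φ w, IsConeDecomposition R v φ w ∧ coneQuantity α R φ w ≤
          ENNReal.ofReal (C * (starENorm 0 α (exteriorDomain R) E).toReal) := by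
  obtain ⟨hR0, h₀⟩ := exp_neg_log_le hR
  obtain ⟨C₁, hC₁, hpure⟩ := PolarSolution.exists_shortHolder_pure hα₀ hα₁
  obtain ⟨C₂, hC₂, hmixed⟩ := PolarSolution.exists_shortHolder_mixed hα₀ hα₁
  obtain ⟨C₃, hC₃, hprofile⟩ := PolarSolution.exists_profile hα₀ hα₁
  refine ⟨2 * 10 ^ 7 * ((C₁ + C₂ + C₃) * 4), by positivity, fun m E v hE hv h => ?_⟩
  set A₀ := (starENorm 0 α (exteriorDomain R) E).toReal with hA₀
  set u := polarSolution hα₀ hα₁ hR hE hv h with hu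
  set K := (C₁ + C₂ + C₃) * (4 * A₀) with hK
  have hA := u.A_nonneg
  have hK0 : 0 ≤ K := by positivity
  have k1 : C₁ * (4 * A₀) ≤ K := by rw [hK]; gcongr; linarith
  have k2 : C₂ * (4 * A₀) ≤ K := by rw [hK]; gcongr; linarith
  have k3 : C₃ * (4 * A₀) ≤ K := by rw [hK]; gcongr; linarith
  have k4 : K ≤ 2 * 10 ^ 7 * K := by linarith
  have k5 : 2 * 10 ^ 7 * ((C₁ + C₂ + C₃) * 4) * A₀ = 2 * 10 ^ 7 * K := by rw [hK]; ring
  rw [k5]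
  obtain ⟨-, hy, -, hss, -⟩ := hpure h₀ u
  have hsθ := hmixed h₀ u
  obtain ⟨P⟩ := hprofile h₀ u
  have hper : Function.Periodic P.φ (2 * Real.pi) := P.periodic
  -- The profile is `C²` because its second derivative is Hölder continuous.
  have hcont : Continuous P.φ'' := by
    rw [continuous_iff_continuousAt]
    intro θ
    rw [ContinuousAt, tendsto_iff_norm_sub_tendsto_zero]
    have hlim : Tendsto (fun x => C₃ * (4 * A₀) * |x - θ| ^ α) (𝓝 θ) (𝓝 0) := by
      have : ContinuousAt (fun x => C₃ * (4 * A₀) * |x - θ| ^ α) θ :=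
        continuousAt_const.mul (ContinuousAt.rpow_const (by fun_prop) (Or.inr hα₀.le))
      simpa [ContinuousAt, Real.zero_rpow hα₀.ne'] using this
    refine squeeze_zero (fun _ => norm_nonneg _) (fun x => ?_) hlim
    rw [Real.norm_eq_abs]
    rcases le_total θ x with hx | hx
    · have := P.φ''_holder θ (x - θ) (by linarith)
      rw [abs_of_nonneg (sub_nonneg.mpr hx)]
      simpa using this
    · have := P.φ''_holder x (θ - x) (by linarith)
      rw [abs_sub_comm, abs_sub_comm x, abs_of_nonneg (sub_nonneg.mpr hx)]
      simpa using this
  have hC2 : ContDiff ℝ 2 P.φ := contDiff_two_of_hasDerivAt P.hasDerivAt P.hasDerivAt' hcont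
  set w : Plane → ℝ := fun ξ => v ξ - coneFunction P.φ ξ with hw
  have hwC : ∀ ξ ∈ exteriorDomain R, ContDiffAt ℝ 2 w ξ := fun ξ hξ =>
    (hv.memLoc.1.contDiffAt ((isOpen_exteriorDomain R).mem_nhds hξ)).sub
      (contDiffAt_coneFunction hper hC2 (ne_zero_of_mem_exteriorDomain hR0 hξ))
  set φ : UnitCircle → ℝ := fun ω => P.φ (polarAngle ω) with hφ
  have hφc : (fun θ => φ (circlePoint θ)) = P.φ := funext fun θ => by
    rw [hφ]
    simp only [circlePoint_eq_logPolar]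
    exact apply_polarAngle_logPolar hper 0 θ
  have hform : IsPolarForm (Real.log R) w (fun s θ => u.f s θ - P.φ θ) u.fs u.fss
      (fun s θ => u.fθ s θ - P.φ' θ) (fun s θ => u.fθθ s θ - P.φ'' θ) u.fsθ :=
    { contDiffAt := fun hs θ => hwC _ (logPolar_mem_exteriorDomain hR0 hs θ)
      eq := fun {s} hs θ => by
        have h1 : u.f s θ = Real.exp (-s) * v (logPolar s θ) := rfl
        have hee : Real.exp s * Real.exp (-s) = 1 := by rw [← Real.exp_add]; simp
        rw [hw]
        simp only [coneFunction_logPolar hper, h1]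
        linear_combination (-v (logPolar s θ)) * hee
      hasDerivAt_s := fun hs θ => (u.hasDerivAt_s hs θ).sub_const _
      hasDerivAt_ss := u.hasDerivAt_ss
      hasDerivAt_θ := fun hs θ => (u.hasDerivAt_θ hs θ).sub (P.hasDerivAt θ)
      hasDerivAt_θθ := fun hs θ => (u.hasDerivAt_θθ hs θ).sub (P.hasDerivAt' θ)
      hasDerivAt_sθ := u.hasDerivAt_sθ }
  have hb : IsPolarForm.DecayBounds α (Real.log R) K (fun s θ => u.f s θ - P.φ θ) u.fs u.fss
      (fun s θ => u.fθ s θ - P.φ' θ) (fun s θ => u.fθθ s θ - P.φ'' θ) u.fsθ :=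
    { val := P.diff.mono k3
      s := hy.mono k1
      ss := hss.mono k1
      θ := fun hs θ => (P.diff_θ hs θ).trans (by gcongr)
      θθ := P.diff_θθ.mono k3
      sθ := hsθ.mono k2 }
  refine ⟨φ, w, ⟨?_, ?_, fun ξ hξ => (hwC ξ hξ).contDiffWithinAt⟩, ?_⟩
  · intro ξ hξ _
    rw [direction_eq_circlePoint, congrFun hφc, hw]
    simp only [coneFunction]
    ring
  · rw [hφc]
    exact hC2
  · refine max_le (max_le ?_ ?_) (max_le ?_ ?_)
    -- The four norms are those of the profile, of the remainder, of its Hessian and of its radial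
    -- derivative.
    · rw [circleENorm, hφc]
      refine (holderENorm_univ_two_le hα₀ P.hasDerivAt P.hasDerivAt' P.φ_le P.φ'_le P.φ''_le
        P.φ''_holder).trans (ENNReal.ofReal_le_ofReal (k3.trans k4))
    · exact hform.weightedHolderENorm_le hα₀ hα₁ hR0 h₀ hb
    · exact (hform.starENorm_hessian_le hα₀ hα₁ hR0 h₀ hb).trans
        (ENNReal.ofReal_le_ofReal (by linarith))
    · exact (hform.starENorm_radial_derivative_le hα₀ hα₁ hR0 h₀ hb).trans
        (ENNReal.ofReal_le_ofReal (by linarith))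

end

end

theorem mainTheorem4 (α : ℝ) (hα₀ : 0 < α) (hα₁ : α < 1) (R : ℝ) (hR : 1 / Real.sqrt 2 < R) :
    ∃ C : ℝ≥0, ∀ m : ℕ, 1 ≤ m → ∀ E : Plane → ℝ, MemStar 0 α m R E →
      ∀ v : Plane → ℝ, MemStar 2 α m R v → IsDirichletSolution R E v →
        MemCone α R v ∧
          coneENorm α R v ≤ (C : ℝ≥0∞) * starENorm 0 α (exteriorDomain R) E := by
  obtain ⟨C, hC, h⟩ := exists_isConeDecomposition hα₀ hα₁ hR
  refine ⟨C.toNNReal, fun m _ E hE v hv hs => ?_⟩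
  obtain ⟨φ, w, hd, hq⟩ := h m E v hE hv hs
  refine ⟨⟨hv.memLoc, φ, w, hd, hq.trans_lt ENNReal.ofReal_lt_top⟩, ?_⟩
  have hle : coneENorm α R v ≤ coneQuantity α R φ w :=
    iInf_le_of_le φ (iInf_le_of_le w (iInf_le_of_le hd le_rfl))
  refine hle.trans (hq.trans_eq ?_)
  rw [ENNReal.ofReal_mul hC, ENNReal.ofReal_toReal hE.norm_lt_top.ne]
  rfl
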